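/- Let $X$ be either the line $\mathbb{R}$ or the torus $\mathbb{T}=\mathbb{R}/2\pi\mathbb{Z}$, let $\langle f,g\rangle=\int_X \bar f g\,dx$, let $L^2_+=L^2_+(X)$ be the Hardy space of those $f\in L^2(X)$ whose Fourier transform vanishes at all negative frequencies, let $C_+$ be the orthogonal projection of $L^2(X)$ onto $L^2_+$, and for an integer $n\ge 0$ let $H^n_+$ be the space of $f\in L^2_+$ with $n$ derivatives in $L^2$. Upper signs refer to the focusing case, lower signs to the defocusing case. Put $M(q)=\int_X|q|^2\,dx$, $M_*=2\pi$ in the focusing case, $M_*=\infty$ in the defocusing case, and $B_{M_*}=\{q\in L^2_+: M(q)<M_*\}$. For $q\in L^2_+$ let $$\mathcal L_q f=-i f'\mp q\,C_+(\bar q f),$$ with domain $H^1_+$, and define $$\beta_\kappa(q)=\langle q,(\mathcal L_q+\kappa)^{-1}q\rangle \quad(\kappa\ge 1),\qquad \mathcal E_n(q)=\langle q,\mathcal L_q^n q\rangle\quad (n\ge 0,\ q\in H^n_+).$$ The form $\omega$ is $$\omega_q(f,g)=\operatorname{Re}\langle f,\Omega(q)g\rangle,\quad \Omega(q)g=i\bigl(1\mp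 2C_+\Theta(q)\bigr)g,\quad \Theta(q)g=i q\,\tilde\partial^{-1}\operatorname{Re}(\bar q g),$$ where $[\tilde\partial^{-1}f](x)=\tfrac12\int_{\mathbb R}\operatorname{sgn}(x-y)f(y)\,dy$ on $\mathbb R$ and $[\tilde\partial^{-1}f](x)=\tfrac12\int_0^{2\pi}(1-\tfrac y\pi)f(x-y)\,dy$ on $\mathbb T$. A symplectic gradient $\nabla_\omega F(q)\in L^2_+$ of a real-valued observable $F$ at $q$ is a vector such that the directional derivative $dF|_q(f)=\lim_{\varepsilon\to0}\varepsilon^{-1}\bigl(F(q+\varepsilon f)-F(q)\bigr)$ exists and equals $\omega_q(f,\nabla_\omega F(q))$ for all directions $f$ in $L^2_+$ if $F=\beta_\kappa$, and for all $f\in H^n_+$ if $F=\mathcal E_n$. The Poisson bracket is $\{F,G\}(q)=\omega_q(\nabla_\omega G(q),\nabla_\omega F(q))$. **Proposition.** In both geometries, in both the focusing and the defocusing case, and for all $q\in B_{M_*}$: (a) for each $\kappa\ge1$, $\mathcal L_q+\kappa$ is a bijection from its domain onto $L^2_+$, $\beta_\kappa(q)$ is real, and $\beta_\kappa$ has a symplectic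 gradient at $q$; for each $n\ge0$ with $q\in H^n_+$, the iterates $\mathcal L_q^kq$ are defined in $L^2_+$ for $k\le n$, $\mathcal E_n(q)$ is real, and $\mathcal E_n$ has a symplectic gradient at $q$. Hence the brackets below are meaningful. (b) For all $\kappa,\varkappa\ge1$, $$\{\beta_\varkappa,\beta_\kappa\}(q)=0 .$$ (c) For all $\varkappa\ge1$ and $n\ge0$, if $q\in H^n_+$ then $$\{\beta_\varkappa,\mathcal E_n\}(q)=0 .$$ (d) For all $m,n\ge0$, if $q\in H^m_+\cap H^n_+$ then $$\{\mathcal E_m,\mathcal E_n\}(q)=0 .$$ -/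

import Mathlib

open MeasureTheory FourierTransform ComplexConjugate
open scoped Real InnerProductSpace

noncomputable section

namespace CCM

/-! ### The two geometries -/

/-- The two geometries: the real line `ℝ` and the torus `ℝ / 2πℤ`. -/
inductive Geometry
  | line
  | torus

instance factTwoPiPos : Fact (0 < 2 * π) := ⟨Real.two_pi_pos⟩

/-- The underlying space. -/
abbrev Geometry.Space : Geometry → Type
  | .line => ℝ
  | .torus => AddCircle (2 * π)

/-- Lebesgue measure; the torus has total measure `2π`. -/
@[reducible]
instance Geometry.instMeasureSpace : (g : Geometry) → MeasureSpace g.Space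
  | .line => inferInstanceAs (MeasureSpace ℝ)
  | .torus => inferInstanceAs (MeasureSpace (AddCircle (2 * π)))

/-- The Hilbert space `L²` of complex-valued functions; its inner product
`⟪f, h⟫_ℂ = ∫ conj (f x) * h x` is linear in the second argument. -/
abbrev L2 (g : Geometry) : Type := Lp (α := g.Space) ℂ 2 volume

/-- The element of `L²` given by a square integrable function. (The value `0` for other functions
is never relevant.) -/
def toL2 (g : Geometry) (f : g.Space → ℂ) : L2 g :=
  open Classical in if hf : MemLp f 2 (volume : Measure g.Space) then hf.toLp f else 0

/-! ### Fourier support, Hardy space, Cauchy–Szegő projection -/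

/-- The Fourier transform on `L²(ℝ)`, with kernel `e^{-2πixξ}`: the variable `ξ` stands for the
angular frequency `2πξ`. -/
def lineFourier (f : L2 .line) : ℝ → ℂ :=
  ⇑(Lp.fourierTransformₗᵢ ℝ ℂ f)

/-- The Fourier coefficients `(2π)⁻¹ ∫ e^{-inx} f x dx` on the torus. -/
def torusFourier (f : L2 .torus) : ℤ → ℂ :=
  fourierCoeff (T := 2 * π) f

/-- `f` has no negative frequencies. -/
def NoNegFreq : (g : Geometry) → L2 g → Prop
  | .line, f => ∀ᵐ ξ : ℝ, ξ < 0 → lineFourier f ξ = 0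
  | .torus, f => ∀ n : ℤ, n < 0 → torusFourier f n = 0

/-- `p = -i ∂ₓ f` in `L²`, expressed on the Fourier side. -/
def IsMomentum : (g : Geometry) → L2 g → L2 g → Prop
  | .line, f, p => ∀ᵐ ξ : ℝ, lineFourier p ξ = (2 * π * ξ : ℝ) * lineFourier f ξ
  | .torus, f, p => ∀ n : ℤ, torusFourier p n = (n : ℂ) * torusFourier f n

theorem lineSupport_iff (f : L2 .line) : NoNegFreq .line f ↔
    LpToLpRestrictCLM ℝ ℂ ℂ volume 2 (Set.Iio (0 : ℝ)) (Lp.fourierTransformₗᵢ ℝ ℂ f) = 0 := by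
  rw [Lp.eq_zero_iff_ae_eq_zero]
  have h := LpToLpRestrictCLM_coeFn (μ := (volume : Measure ℝ)) (p := 2) ℂ (Set.Iio (0 : ℝ))
    (Lp.fourierTransformₗᵢ ℝ ℂ f)
  have h2 : NoNegFreq .line f ↔
      ∀ᵐ ξ : ℝ ∂(volume.restrict (Set.Iio 0)), lineFourier f ξ = 0 := by
    rw [ae_restrict_iff' measurableSet_Iio]; rfl
  rw [h2]
  constructor
  · intro h3
    filter_upwards [h, h3] with ξ h4 h5
    rw [h4]; exact h5
  · intro h3
    filter_upwards [h, h3] with ξ h4 h5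
    rw [h4] at h5; exact h5

theorem torusFourier_eq_inner (f : L2 .torus) (n : ℤ) :
    torusFourier f n = ((2 * π : ℝ) : ℂ)⁻¹ *
      ⟪toL2 .torus (fun t => fourier (T := 2 * π) n t), f⟫_ℂ := by
  have hm : MemLp (fun t : AddCircle (2 * π) => (fourier n t : ℂ)) 2 volume :=
    MemLp.of_bound (fourier n).continuous.aestronglyMeasurable 1
      (Filter.Eventually.of_forall fun t => by
        rw [fourier_apply, Circle.norm_coe])
  have h1 : toL2 .torus (fun t => fourier (T := 2 * π) n t) = hm.toLp _ := dif_pos hm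
  rw [h1, L2.inner_def, torusFourier, fourierCoeff, AddCircle.integral_haarAddCircle,
    ← Complex.ofReal_inv]
  change _ • _ = _
  rw [Complex.real_smul]
  congr 1
  refine integral_congr_ae ?_
  filter_upwards [hm.coeFn_toLp] with t ht
  rw [ht, RCLike.inner_apply, fourier_neg, smul_eq_mul, mul_comm]

/-- The Hardy space `L²₊`: the functions in `L²` without negative frequencies. -/
def hardy : (g : Geometry) → Submodule ℂ (L2 g)
  | .line =>
    { carrier := {f | NoNegFreq .line f}
      add_mem' := fun {a b} ha hb => by
        have ha' := (lineSupport_iff a).1 ha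
        have hb' := (lineSupport_iff b).1 hb
        refine (lineSupport_iff (a + b)).2 ?_
        rw [map_add, map_add, ha', hb', add_zero]
      zero_mem' := (lineSupport_iff 0).2 (by rw [map_zero, map_zero])
      smul_mem' := fun c a ha => by
        have ha' := (lineSupport_iff a).1 ha
        refine (lineSupport_iff (c • a)).2 ?_
        rw [map_smul, map_smul, ha', smul_zero] }
  | .torus =>
    { carrier := {f | NoNegFreq .torus f}
      add_mem' := fun {a b} ha hb n hn => by
        have ha' := ha n hn
        have hb' := hb n hn
        rw [torusFourier_eq_inner] at ha' hb' ⊢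
        rw [inner_add_right, mul_add, ha', hb', add_zero]
      zero_mem' := fun n hn => by
        rw [torusFourier_eq_inner, inner_zero_right, mul_zero]
      smul_mem' := fun c a ha n hn => by
        have ha' := ha n hn
        rw [torusFourier_eq_inner] at ha' ⊢
        rw [inner_smul_right, mul_left_comm, ha', mul_zero] }

theorem mem_hardy {g : Geometry} {f : L2 g} : f ∈ hardy g ↔ NoNegFreq g f := by
  cases g <;> rfl

theorem isClosed_hardy : (g : Geometry) → IsClosed (hardy g : Set (L2 g))
  | .line => by
    have h : (hardy .line : Set (L2 .line)) =
        (fun f : L2 .line => LpToLpRestrictCLM ℝ ℂ ℂ volume 2 (Set.Iio (0 : ℝ))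
          (Lp.fourierTransformₗᵢ ℝ ℂ f)) ⁻¹' {0} := by
      ext f; exact lineSupport_iff f
    rw [h]
    exact isClosed_singleton.preimage
      ((ContinuousLinearMap.continuous _).comp (Lp.fourierTransformₗᵢ ℝ ℂ).continuous)
  | .torus => by
    have h : (hardy .torus : Set (L2 .torus)) =
        ⋂ n : ℤ, ⋂ _ : n < 0, {f : L2 .torus | torusFourier f n = 0} := by
      ext f; simp only [Set.mem_iInter]; rfl
    rw [h]
    refine isClosed_iInter fun n => isClosed_iInter fun _ => ?_
    simp only [torusFourier_eq_inner]
    exact isClosed_eq (by fun_prop) continuous_const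

instance instCompleteSpaceHardy (g : Geometry) : CompleteSpace (hardy g) :=
  (isClosed_hardy g).completeSpace_coe

/-- The Hardy space as a Hilbert space: the phase space. -/
abbrev Hardy (g : Geometry) : Type := hardy g

/-- The Cauchy–Szegő projection: the orthogonal projection of `L²` onto the Hardy space. -/
def szego (g : Geometry) : L2 g →L[ℂ] Hardy g := (hardy g).orthogonalProjectionOnto

/-- The Hardy–Sobolev spaces `Hⁿ₊` of integer order: `n` derivatives in `L²`. -/
def HardySobolev (g : Geometry) : ℕ → Set (Hardy g)
  | 0 => Set.univ
  | n + 1 => {f | ∃ p ∈ HardySobolev g n, IsMomentum g f p}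

/-! ### The Lax operator -/

/-- Focusing (upper signs) or defocusing (lower signs). -/
inductive Interaction
  | focusing
  | defocusing

/-- The sign `±`. -/
def Interaction.sign : Interaction → ℝ
  | .focusing => 1
  | .defocusing => -1

/-- The critical mass `M_*`. -/
def Interaction.criticalMass : Interaction → EReal
  | .focusing => ((2 * π : ℝ) : EReal)
  | .defocusing => ⊤

/-- The mass `M(q) = ∫ |q|²`. -/
def mass {g : Geometry} (q : Hardy g) : ℝ := ∫ x : g.Space, ‖(q : L2 g) x‖ ^ 2

/-- The ball `B_M = {q ∈ L²₊ : M(q) < M}`. -/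
def massBall (g : Geometry) (M : EReal) : Set (Hardy g) := {q | (mass q : EReal) < M}

/-- The graph of the Lax operator: `f` lies in its domain (that is, in `H¹₊`) and
`h = L_q f = -i ∂ₓ f ∓ q C₊(q̄ f)`. The product of `q` and `C₊(q̄ f)` is the pointwise one. -/
def IsLax (s : Interaction) {g : Geometry} (q f h : Hardy g) : Prop :=
  ∃ p : L2 g, IsMomentum g f p ∧
    ∀ᵐ x : g.Space, (h : L2 g) x = p x - s.sign *
      ((q : L2 g) x *
        (szego g (toL2 g fun y => conj ((q : L2 g) y) * (f : L2 g) y) : L2 g) x)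

/-- The Lax operator as a function, meaningful on its domain. -/
def lax (s : Interaction) {g : Geometry} (q f : Hardy g) : Hardy g :=
  open Classical in if h : ∃ k, IsLax s q f k then h.choose else 0

/-- `m(κ,q) = (L_q + κ)⁻¹ q`, the vector `m` in the domain of `L_q` with `L_q m = q - κ m`. -/
def resolventVector (s : Interaction) {g : Geometry} (κ : ℝ) (q : Hardy g) : Hardy g :=
  open Classical in if h : ∃ m, IsLax s q m (q - (κ : ℂ) • m) then h.choose else 0

/-! ### The symplectic form -/

/-- The primitive `∂̃⁻¹ f` of an integrable real-valued function. -/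
def primitive : (g : Geometry) → (g.Space → ℝ) → g.Space → ℝ
  | .line, f, x => (1 / 2) * ∫ y : ℝ, Real.sign (x - y) * f y
  | .torus, f, x => (1 / 2) * ∫ y in (0 : ℝ)..(2 * π), (1 - y / π) * f (x - (y : AddCircle (2 * π)))

/-- `Θ(q)h = i q ∂̃⁻¹ Re(q̄ h)`. -/
def theta {g : Geometry} (q h : Hardy g) : L2 g :=
  toL2 g fun x => Complex.I * (q : L2 g) x *
    (primitive g (fun y => (conj ((q : L2 g) y) * (h : L2 g) y).re) x : ℂ)

/-- `Ω(q)h = i (1 ∓ 2 C₊ Θ(q)) h`. -/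
def bigOmega (s : Interaction) {g : Geometry} (q h : Hardy g) : Hardy g :=
  Complex.I • (h - ((2 * s.sign : ℝ) : ℂ) • szego g (theta q h))

/-- The symplectic form `ω_q(f,h) = Re ⟪f, Ω(q)h⟫`. -/
def omega (s : Interaction) {g : Geometry} (q f h : Hardy g) : ℝ :=
  (⟪f, bigOmega s q h⟫_ℂ).re

/-! ### Observables, symplectic gradients and the Poisson bracket -/

/-- A real-valued observable together with the dense space of directions in which it is
differentiated (an observable such as `⟪q, L_qⁿ q⟫` is defined only for regular `q`). -/
structure Observable (g : Geometry) where
  dom : Set (Hardy g)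
  val : Hardy g → ℝ

/-- `X ∈ L²₊` is the symplectic gradient `∇_ω F(q)`: the directional derivative
`dF|_q(f) = lim_{ε → 0} (F(q + ε f) - F(q)) / ε` exists and equals `ω_q(f, X)`
for all admissible directions `f`. -/
def HasSymplecticGradient (s : Interaction) {g : Geometry} (F : Observable g) (q X : Hardy g) :
    Prop :=
  ∀ f ∈ F.dom, HasDerivAt (fun ε : ℝ => F.val (q + (ε : ℂ) • f)) (omega s q f X) 0

/-- The symplectic gradient `∇_ω F(q)`, where it exists. It is unique when the form `ω_q` is
nondegenerate, as it is on `B_{M_*}`; in general it is determined up to the kernel of `ω_q`, which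
does not affect Poisson brackets. -/
def symplecticGradient (s : Interaction) {g : Geometry} (F : Observable g) (q : Hardy g) :
    Hardy g :=
  open Classical in if h : ∃ X, HasSymplecticGradient s F q X then h.choose else 0

/-- The Poisson bracket `{F, G}(q) = ω_q(∇_ω G, ∇_ω F)`. -/
def poissonBracket (s : Interaction) {g : Geometry} (F G : Observable g) (q : Hardy g) : ℝ :=
  omega s q (symplecticGradient s G q) (symplecticGradient s F q)

/-- The generating function `β(κ,q) = ⟪q, (L_q + κ)⁻¹ q⟫`, differentiated in all directions. -/
def beta (s : Interaction) (g : Geometry) (κ : ℝ) : Observable g where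
  dom := Set.univ
  val q := (⟪q, resolventVector s κ q⟫_ℂ).re

/-- The conserved quantity `E_n(q) = ⟪q, L_qⁿ q⟫` (a real number, since `L_q` is symmetric) on
`Hⁿ₊`. -/
def energy (s : Interaction) (g : Geometry) (n : ℕ) : Observable g where
  dom := HardySobolev g n
  val q := (⟪q, (lax s q)^[n] q⟫_ℂ).re

end CCM

end

open CCM

/-!
Everything rests on an explicit symplectic gradient.

**Analysis.** Write `T(b, f) = C₊(b̄ f)`. On the Fourier side `-i ∂ₓ` is multiplication by the
frequency, on the Hardy space a nonnegative one, and `b̄ f` is a correlation of the two Fourier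
transforms. This is set up once for both geometries, and gives two estimates. The first,
`‖T(b, u)‖_∞ ≤ C ‖b‖ ‖u‖_{H¹}` (a Hardy-type inequality, from a Schur test), makes the cubic
term `a C₊(b̄ u)` a bounded operator from `H¹₊` to `L²₊`, although `a` and `b` are merely square
integrable. The second, `‖T(q, f)‖² ≤ M(q) / 2π · ⟪f, (-i ∂ₓ + 1) f⟫`, has the sharp constant:
it makes `L_q + κ` coercive for `κ ≥ 1` below the critical mass (`exists_coercive`). For large
`κ` the cubic term is a small perturbation of `-i ∂ₓ + κ`; coercivity then carries the
bijectivity down to `κ = 1` (`shiftL_bijective`). Since `L_q` is symmetric and depends on `q`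
through the cubic term, the observables can be differentiated by telescoping (`hasDerivAt_beta`,
`hasDerivAt_energy`).

**Symplectic gradients.** Both kinds of observables come from a chain `(L_q + κ) z_a = z_{a+1}`,
`a < N`, that has `q` at one end and a vector `w` at the other (`LaxChain`; the sign `e = ±1`
tells which end). Let `r_a` be the conjugate of the strictly negative part of `q̄ z_a`, and put
`Y = w ± e Σ z_a r_{N-1-a}`. By the chain relation the derivative of `Σ z_a z̄_{N-1-a}` is a
multiple of `Im(q̄ Y)`, so that `∂̃⁻¹` can be evaluated on it, and the vector `X = -2iY + icq`,
with a suitable real constant `c` that accounts for the mean on the torus, satisfies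
`Ω(q) X = ∇F(q)`, the gradient for the real inner product (`LaxChain.bigOmega_field`).

**Involution.** Let `S(f, h) = Σ ⟪T(z_a, f), T(z_{N-1-a}, h)⟫`. Its commutator with `L_q` is
`S(f, L_q h) - S(L_q f, h) = e (⟪T(q, f), T(Y, h)⟫ - ⟪T(Y, f), T(q, h)⟫)`
(`LaxChain.form_laxL_sub`). Sum this over consecutive members of a second chain: the left side
telescopes to its ends, `q` and `w'`, and the result is that `Re ⟪X, ∇F'(q)⟫` vanishes as soon
as all inner products between members of the two chains are real
(`LaxChain.re_inner_field_grad`). They are, by the symmetry of `L_q` and the resolvent identity.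

A symplectic gradient is characterised by the values of `ω_q` on a dense set of directions. As
`ω_q` is continuous and antisymmetric, brackets do not depend on its choice
(`omega_symplecticGradient`).
-/

noncomputable section

namespace CCM

open Filter Topology
open scoped ENNReal

variable {g : Geometry}

/-! ### The Fourier transform on the line -/

/-- On integrable functions the `L²` Fourier transform is given by the Fourier integral. -/
theorem lineFourier_ae_eq_fourier {f : L2 .line} (hf : Integrable (f : ℝ → ℂ)) :
    lineFourier f =ᵐ[volume] 𝓕 (f : ℝ → ℂ) := by
  refine ae_eq_of_integral_contDiff_smul_eq ?_ ?_ fun φ hφ hφc => ?_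
  · exact (Lp.memLp (Lp.fourierTransformₗᵢ ℝ ℂ f)).locallyIntegrable (by norm_num)
  · exact (VectorFourier.fourierIntegral_continuous Real.continuous_fourierChar
      (by fun_prop) hf).locallyIntegrable
  · have hc : HasCompactSupport (fun x => (φ x : ℂ)) := hφc.comp_left Complex.ofReal_zero
    have hd : ContDiff ℝ (⊤ : ℕ∞) (fun x => (φ x : ℂ)) := Complex.ofRealCLM.contDiff.comp hφ
    set g : SchwartzMap ℝ ℂ := hc.toSchwartzMap hd with hg
    have h2 := congrArg (fun T => T g) (Lp.fourier_toTemperedDistribution_eq (E := ℝ) (F := ℂ) f)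
    simp only [TemperedDistribution.fourier_apply, Lp.toTemperedDistribution_apply] at h2
    have h3 : ∫ x, (𝓕 (g : ℝ → ℂ)) x • (f : ℝ → ℂ) x = ∫ x, g x • (𝓕 (f : ℝ → ℂ)) x := by
      have h := VectorFourier.integral_fourierIntegral_smul_eq_flip (L := innerₗ ℝ)
        Real.continuous_fourierChar (by fun_prop) (g.integrable (μ := volume)) hf
      rwa [flip_innerₗ] at h
    exact h2.symm.trans h3

theorem lineFourier_inversion {f : L2 .line} (hf : Integrable (lineFourier f)) :
    (f : ℝ → ℂ) =ᵐ[volume] 𝓕⁻ (lineFourier f) := by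
  refine ae_eq_of_integral_contDiff_smul_eq ?_ ?_ fun φ hφ hφc => ?_
  · exact (Lp.memLp f).locallyIntegrable (by norm_num)
  · have h : Continuous (𝓕⁻ (lineFourier f)) :=
      VectorFourier.fourierIntegral_continuous Real.continuous_fourierChar
        (L := -innerₗ ℝ) (by simp only [LinearMap.neg_apply]; fun_prop) hf
    exact h.locallyIntegrable
  · have hc : HasCompactSupport (fun x => (φ x : ℂ)) := hφc.comp_left Complex.ofReal_zero
    have hd : ContDiff ℝ (⊤ : ℕ∞) (fun x => (φ x : ℂ)) := Complex.ofRealCLM.contDiff.comp hφ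
    set g : SchwartzMap ℝ ℂ := hc.toSchwartzMap hd with hg
    have h2 := congrArg (fun T => T g) (Lp.fourierInv_toTemperedDistribution_eq (E := ℝ) (F := ℂ)
      (Lp.fourierTransformₗᵢ ℝ ℂ f))
    have h0 : (𝓕⁻ (Lp.fourierTransformₗᵢ ℝ ℂ f) : L2 .line) = f :=
      (Lp.fourierTransformₗᵢ ℝ ℂ).symm_apply_apply f
    rw [h0] at h2
    simp only [TemperedDistribution.fourierInv_apply, Lp.toTemperedDistribution_apply,
      SchwartzMap.fourierInv_coe] at h2
    have h3 : ∫ x, (𝓕⁻ (g : ℝ → ℂ)) x • (lineFourier f) x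
        = ∫ x, g x • (𝓕⁻ (lineFourier f)) x := by
      have h := VectorFourier.integral_fourierIntegral_smul_eq_flip (L := -innerₗ ℝ)
        Real.continuous_fourierChar (by simp only [LinearMap.neg_apply]; fun_prop)
        (g.integrable (μ := volume)) hf
      have hflip : (-innerₗ ℝ : ℝ →ₗ[ℝ] ℝ →ₗ[ℝ] ℝ).flip = -innerₗ ℝ := by
        ext; simp
      rwa [hflip] at h
    exact h2.symm.trans h3

theorem memLp_lineFourier (f : L2 .line) : MemLp (lineFourier f) 2 volume :=
  Lp.memLp (Lp.fourierTransformₗᵢ ℝ ℂ f)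

theorem lineFourier_inner (f h : L2 .line) :
    ⟪f, h⟫_ℂ = ∫ ξ, conj (lineFourier f ξ) * lineFourier h ξ := by
  rw [← (Lp.fourierTransformₗᵢ ℝ ℂ).inner_map_map f h, L2.inner_def]
  simp [lineFourier, RCLike.inner_apply, mul_comm]

theorem exists_lineFourier {φ : ℝ → ℂ} (hφ : MemLp φ 2 volume) :
    ∃ f : L2 .line, lineFourier f =ᵐ[volume] φ := by
  refine ⟨(Lp.fourierTransformₗᵢ ℝ ℂ).symm (hφ.toLp φ), ?_⟩
  rw [lineFourier, LinearIsometryEquiv.apply_symm_apply]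
  exact hφ.coeFn_toLp

theorem norm_fourierChar_mul (t : ℝ) (z : ℂ) : ‖(Real.fourierChar t : ℂ) * z‖ = ‖z‖ := by
  rw [norm_mul, Circle.norm_coe, one_mul]

theorem memLp_fourierChar_mul (b : L2 .line) (ξ : ℝ) :
    MemLp (fun x => (Real.fourierChar (x * ξ) : ℂ) * b x) 2 volume := by
  refine (Lp.memLp b).of_le (AEStronglyMeasurable.mul ?_ (Lp.aestronglyMeasurable b))
    (Eventually.of_forall fun x => (norm_fourierChar_mul _ _).le)
  exact (by fun_prop : Continuous fun x : ℝ =>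
    (Real.fourierChar (x * ξ) : ℂ)).aestronglyMeasurable

/-- The Fourier transform of `ā b` is the correlation of the Fourier transforms. -/
theorem lineFourier_conj_mul {a b p : L2 .line}
    (hp : (p : ℝ → ℂ) =ᵐ[volume] fun x => conj (a x) * b x) :
    ∀ᵐ ξ : ℝ, lineFourier p ξ = ∫ η, conj (lineFourier a η) * lineFourier b (η + ξ) := by
  have hint : Integrable (p : ℝ → ℂ) :=
    (MemLp.integrable_mul (Lp.memLp a).star (Lp.memLp b)).congr hp.symm
  filter_upwards [lineFourier_ae_eq_fourier hint] with ξ hξ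
  rw [hξ, Real.fourier_congr_ae hp, Real.fourier_real_eq]
  -- both sides are continuous in `b`, so it suffices to take `b` a Schwartz function
  have hm := memLp_fourierChar_mul a ξ
  have hn : MemLp (fun η => lineFourier a (η - ξ)) 2 volume :=
    (memLp_lineFourier a).comp_measurePreserving (measurePreserving_sub_right volume ξ)
  have hl : ∀ b : L2 .line, ⟪hm.toLp _, b⟫_ℂ =
      ∫ x, Real.fourierChar (-(x * ξ)) • (conj (a x) * b x) := fun b => by
    rw [L2.inner_def]
    refine integral_congr_ae ?_
    filter_upwards [hm.coeFn_toLp] with x hx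
    rw [hx, RCLike.inner_apply, AddChar.map_neg_eq_inv, Circle.smul_def]
    simp [← Circle.coe_inv_eq_conj]; ring
  have hr : ∀ b : L2 .line, ⟪hn.toLp _, Lp.fourierTransformₗᵢ ℝ ℂ b⟫_ℂ =
      ∫ η, conj (lineFourier a η) * lineFourier b (η + ξ) := fun b => by
    have h := integral_add_right_eq_self
      (fun η => conj (lineFourier a (η - ξ)) * lineFourier b η) ξ (μ := volume)
    simp only [add_sub_cancel_right] at h
    rw [h, L2.inner_def]
    refine integral_congr_ae ?_
    filter_upwards [hn.coeFn_toLp] with x hx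
    rw [hx, RCLike.inner_apply, mul_comm]; rfl
  rw [← hl, ← hr]
  refine DenseRange.induction_on (p := fun b : L2 .line => ⟪hm.toLp _, b⟫_ℂ =
    ⟪hn.toLp _, Lp.fourierTransformₗᵢ ℝ ℂ b⟫_ℂ)
    (SchwartzMap.denseRange_toLpCLM (E := ℝ) (F := ℂ) (μ := volume) (p := 2) ENNReal.ofNat_ne_top) b
    (isClosed_eq (by fun_prop) (by fun_prop)) fun g => ?_
  set b : L2 .line := SchwartzMap.toLpCLM ℝ ℂ 2 volume g with hb
  have hbi : Integrable (b : ℝ → ℂ) :=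
    (g.integrable (μ := volume)).congr (g.coeFn_toLp 2 volume).symm
  have hcm : MemLp (fun x => (Real.fourierChar (-(x * ξ)) : ℂ) * b x) 2 volume := by
    simpa only [mul_neg] using memLp_fourierChar_mul b (-ξ)
  have hci : Integrable (hcm.toLp _ : ℝ → ℂ) := by
    refine (hbi.mono (Lp.aestronglyMeasurable _) ?_)
    filter_upwards [hcm.coeFn_toLp] with x hx
    rw [hx, norm_fourierChar_mul]
  have hshift : ∀ᵐ η : ℝ, lineFourier (hcm.toLp _) η = lineFourier b (η + ξ) := by
    have h1 := (measurePreserving_add_right volume ξ).quasiMeasurePreserving.ae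
      (lineFourier_ae_eq_fourier hbi)
    filter_upwards [lineFourier_ae_eq_fourier hci, h1] with η h2 h3
    rw [h2, h3, Real.fourier_congr_ae hcm.coeFn_toLp, Real.fourier_real_eq, Real.fourier_real_eq]
    refine integral_congr_ae (Eventually.of_forall fun x => ?_)
    simp only [Circle.smul_def, smul_eq_mul]
    rw [← mul_assoc, ← Circle.coe_mul, ← AddChar.map_add_eq_mul]
    congr 3; ring
  rw [hl, hr]
  calc ∫ x, Real.fourierChar (-(x * ξ)) • (conj (a x) * b x)
      = ⟪a, hcm.toLp _⟫_ℂ := by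
        rw [L2.inner_def]
        refine integral_congr_ae ?_
        filter_upwards [hcm.coeFn_toLp] with x hx
        rw [hx, RCLike.inner_apply, Circle.smul_def, smul_eq_mul]; ring
    _ = _ := by
        rw [lineFourier_inner]
        refine integral_congr_ae ?_
        filter_upwards [hshift] with η hη
        rw [hη]

theorem lineFourier_conj {a p : L2 .line}
    (hp : (p : ℝ → ℂ) =ᵐ[volume] fun x => conj (a x)) :
    ∀ᵐ ξ : ℝ, lineFourier p ξ = conj (lineFourier a (-ξ)) := by
  set C : L2 .line →L[ℝ] L2 .line := (Complex.conjCLE : ℂ →L[ℝ] ℂ).compLpL 2 volume with hC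
  have hCf : ∀ f : L2 .line, (C f : ℝ → ℂ) =ᵐ[volume] fun x => conj (f x) := fun f =>
    (Complex.conjCLE : ℂ →L[ℝ] ℂ).coeFn_compLpL f
  set N : L2 .line →ₗᵢ[ℂ] L2 .line := Lp.compMeasurePreservingₗᵢ ℂ (fun x : ℝ => -x)
    (Measure.measurePreserving_neg volume) with hN
  have hNf : ∀ f : L2 .line, (N f : ℝ → ℂ) =ᵐ[volume] fun x => f (-x) := fun f =>
    Lp.coeFn_compMeasurePreserving f (Measure.measurePreserving_neg volume)
  have hpa : p = C a := Lp.ext (hp.trans (hCf a).symm)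
  suffices h : Lp.fourierTransformₗᵢ ℝ ℂ (C a) = C (N (Lp.fourierTransformₗᵢ ℝ ℂ a)) by
    rw [lineFourier, hpa, h]
    filter_upwards [hCf (N (Lp.fourierTransformₗᵢ ℝ ℂ a)), hNf (Lp.fourierTransformₗᵢ ℝ ℂ a)]
      with ξ h1 h2
    rw [h1, h2]; rfl
  refine DenseRange.induction_on (p := fun a : L2 .line => Lp.fourierTransformₗᵢ ℝ ℂ (C a) =
    C (N (Lp.fourierTransformₗᵢ ℝ ℂ a)))
    (SchwartzMap.denseRange_toLpCLM (E := ℝ) (F := ℂ) (μ := volume) (p := 2) ENNReal.ofNat_ne_top) a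
    (isClosed_eq (by fun_prop) (C.continuous.comp (N.continuous.comp
      (LinearIsometryEquiv.continuous _)))) fun g => ?_
  set b : L2 .line := SchwartzMap.toLpCLM ℝ ℂ 2 volume g with hb
  have hbi : Integrable (b : ℝ → ℂ) :=
    (g.integrable (μ := volume)).congr (g.coeFn_toLp 2 volume).symm
  have hci : Integrable (C b : ℝ → ℂ) := by
    refine hbi.mono (Lp.aestronglyMeasurable _) ?_
    filter_upwards [hCf b] with x hx
    rw [hx, RCLike.norm_conj]
  refine Lp.ext ?_
  have h1 := (Measure.measurePreserving_neg (volume : Measure ℝ)).quasiMeasurePreserving.ae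
    (lineFourier_ae_eq_fourier hbi)
  filter_upwards [lineFourier_ae_eq_fourier hci, h1, hCf (N (Lp.fourierTransformₗᵢ ℝ ℂ b)),
    hNf (Lp.fourierTransformₗᵢ ℝ ℂ b)] with ξ h2 h3 h4 h5
  rw [h4, h5]
  change lineFourier (C b) ξ = conj (lineFourier b (-ξ))
  rw [h2, h3, Real.fourier_congr_ae (hCf b), Real.fourier_real_eq, Real.fourier_real_eq,
    ← integral_conj]
  refine integral_congr_ae (Eventually.of_forall fun x => ?_)
  simp only [Circle.smul_def, smul_eq_mul, map_mul]
  rw [← Circle.coe_inv_eq_conj, ← AddChar.map_neg_eq_inv, mul_neg, neg_neg]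

theorem norm_le_integral_lineFourier {f : L2 .line} (hf : Integrable (lineFourier f)) :
    ∀ᵐ x : ℝ, ‖f x‖ ≤ ∫ ξ, ‖lineFourier f ξ‖ := by
  filter_upwards [lineFourier_inversion hf] with x hx
  rw [hx]
  exact VectorFourier.norm_fourierIntegral_le_integral_norm _ _ _ _ _

/-- An antisymmetric bounded kernel defines an antisymmetric form on integrable functions. -/
theorem integral_kernel_antisymm {X : Type*} [MeasurableSpace X] {μ : Measure X} [SFinite μ]
    {K : X → X → ℝ} (hK : Measurable (Function.uncurry K)) {C : ℝ} (hC : ∀ x y, |K x y| ≤ C)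
    (hanti : ∀ x y, K y x = -K x y) {F G : X → ℝ} (hF : Integrable F μ) (hG : Integrable G μ) :
    ∫ x, F x * ∫ y, K x y * G y ∂μ ∂μ = -∫ x, G x * ∫ y, K x y * F y ∂μ ∂μ := by
  have hint : Integrable (fun z : X × X => K z.1 z.2 * (F z.1 * G z.2)) (μ.prod μ) :=
    (hF.mul_prod hG).bdd_mul hK.aestronglyMeasurable (Eventually.of_forall fun z => hC z.1 z.2)
  calc ∫ x, F x * ∫ y, K x y * G y ∂μ ∂μ
      = ∫ x, ∫ y, K x y * (F x * G y) ∂μ ∂μ := by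
        congr 1; ext x; rw [← integral_const_mul]; congr 1; ext y; ring
    _ = ∫ y, ∫ x, K x y * (F x * G y) ∂μ ∂μ := integral_integral_swap hint
    _ = -∫ x, G x * ∫ y, K x y * F y ∂μ ∂μ := by
        rw [← integral_neg]; congr 1; ext x
        rw [← integral_const_mul, ← integral_neg]; congr 1; ext y
        rw [hanti x y]; ring

/-- The Fourier transform of the indicator of an interval, multiplied by the frequency. -/
theorem lineFourier_indicator {a b : ℝ} (hab : a ≤ b) {c : L2 .line}
    (hc : (c : ℝ → ℂ) =ᵐ[volume] (Set.Ioc a b).indicator 1) :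
    ∀ᵐ ξ : ℝ, (2 * π * ξ : ℝ) * (Complex.I * conj (lineFourier c ξ)) =
      Real.fourierChar (b * ξ) - Real.fourierChar (a * ξ) := by
  have hi : Integrable ((Set.Ioc a b).indicator (1 : ℝ → ℂ)) :=
    (integrable_indicator_iff measurableSet_Ioc).2 (integrable_const (1:ℂ))
  have hne : ∀ᵐ ξ : ℝ, ξ ≠ 0 := by simp [ae_iff]
  filter_upwards [lineFourier_ae_eq_fourier (hi.congr hc.symm), hne] with ξ h1 h2
  rw [h1, Real.fourier_congr_ae hc, Real.fourier_real_eq]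
  have h3 : ∫ x, Real.fourierChar (-(x * ξ)) • (Set.Ioc a b).indicator (1 : ℝ → ℂ) x =
      ∫ x in a..b, Complex.exp ((-(2 * π * ξ) * Complex.I) * x) := by
    rw [intervalIntegral.integral_of_le hab, ← integral_indicator measurableSet_Ioc]
    congr 1; ext x
    by_cases hx : x ∈ Set.Ioc a b
    · simp only [Set.indicator_of_mem hx, Circle.smul_def, Real.fourierChar_apply, Pi.one_apply,
        smul_eq_mul, mul_one]
      congr 1; push_cast; ring
    · simp [Set.indicator_of_notMem hx]
  have hξ : (ξ : ℂ) ≠ 0 := by exact_mod_cast h2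
  have hpi : (π : ℂ) ≠ 0 := by exact_mod_cast Real.pi_ne_zero
  rw [h3, integral_exp_mul_complex (by simp [hξ, hpi]), map_div₀, map_sub, ← Complex.exp_conj,
    ← Complex.exp_conj]
  simp only [map_mul, map_neg, Complex.conj_I, Complex.conj_ofReal, map_ofNat,
    Real.fourierChar_apply]
  push_cast
  have hI := Complex.I_ne_zero
  field_simp

/-- The fundamental theorem of calculus for the weak derivative `φ' = i p`, by Plancherel's identity
with the indicator of `(a, b]`. -/
theorem line_ftc {φ p : L2 .line} (hφp : IsMomentum .line φ p)
    (hφ : Integrable (lineFourier φ)) {a b : ℝ} (hab : a ≤ b) :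
    ∫ x in a..b, Complex.I * p x = (𝓕⁻ (lineFourier φ)) b - (𝓕⁻ (lineFourier φ)) a := by
  have hm : MemLp ((Set.Ioc a b).indicator (1 : ℝ → ℂ)) 2 volume :=
    memLp_indicator_const 2 measurableSet_Ioc 1 (Or.inr (by simp))
  have h1 : ∫ x in a..b, Complex.I * p x = Complex.I * ⟪hm.toLp _, p⟫_ℂ := by
    rw [intervalIntegral.integral_const_mul, L2.inner_def, intervalIntegral.integral_of_le hab,
      ← integral_indicator measurableSet_Ioc]
    congr 1
    refine integral_congr_ae ?_
    filter_upwards [hm.coeFn_toLp] with x hx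
    rw [hx]
    by_cases h : x ∈ Set.Ioc a b <;> simp [h]
  have hb : ∀ t : ℝ, Integrable fun ξ : ℝ => (Real.fourierChar (t * ξ) : ℂ) * lineFourier φ ξ :=
    fun t => hφ.bdd_mul
      (by fun_prop : Continuous fun ξ : ℝ => (Real.fourierChar (t * ξ) : ℂ)).aestronglyMeasurable
      (Eventually.of_forall fun ξ => (Circle.norm_coe _).le)
  rw [h1, lineFourier_inner, ← integral_const_mul, Real.fourierInv_eq, Real.fourierInv_eq]
  simp only [Circle.smul_def, smul_eq_mul, RCLike.inner_apply, conj_trivial]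
  rw [← integral_sub (by simpa using hb b) (by simpa using hb a)]
  refine integral_congr_ae ?_
  filter_upwards [hφp, lineFourier_indicator hab hm.coeFn_toLp] with ξ h2 h3
  rw [h2, ← sub_mul, ← h3]
  ring

/-- On the line, `∂̃⁻¹` inverts the derivative of a function that vanishes at infinity. -/
theorem line_primitive_momentum {φ p : L2 .line} (hφp : IsMomentum .line φ p)
    (hφ : Integrable (lineFourier φ)) (hp : Integrable (p : ℝ → ℂ)) :
    ∀ᵐ x : ℝ, primitive .line (fun y => (Complex.I * p y).re) x = (φ x).re := by
  set Φ := 𝓕⁻ (lineFourier φ) with hΦ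
  have hip : Integrable (fun y : ℝ => Complex.I * p y) := hp.const_mul _
  have hz : Tendsto Φ (cocompact ℝ) (𝓝 0) := by
    rw [hΦ, Real.fourierInv_eq_fourier_comp_neg]
    exact Real.zero_at_infty_fourier _
  rw [cocompact_eq_atBot_atTop, tendsto_sup] at hz
  have hI : ∀ x, ∫ y in Set.Iic x, Complex.I * p y = Φ x := fun x => by
    refine tendsto_nhds_unique (intervalIntegral_tendsto_integral_Iic x hip.integrableOn
      tendsto_id) ?_
    have : Tendsto (fun a => Φ x - Φ a) atBot (𝓝 (Φ x - 0)) := tendsto_const_nhds.sub hz.1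
    rw [sub_zero] at this
    refine this.congr' ?_
    filter_upwards [eventually_le_atBot x] with a ha
    exact (line_ftc hφp hφ ha).symm
  have hJ : ∀ x, ∫ y in Set.Ioi x, Complex.I * p y = -Φ x := fun x => by
    refine tendsto_nhds_unique (intervalIntegral_tendsto_integral_Ioi x hip.integrableOn
      tendsto_id) ?_
    have : Tendsto (fun b => Φ b - Φ x) atTop (𝓝 (0 - Φ x)) := hz.2.sub tendsto_const_nhds
    rw [zero_sub] at this
    refine this.congr' ?_
    filter_upwards [eventually_ge_atTop x] with a ha
    exact (line_ftc hφp hφ ha).symm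
  filter_upwards [lineFourier_inversion hφ] with x hx
  rw [hx]
  have hr : Integrable (fun y : ℝ => (Complex.I * p y).re) := hip.re
  have hs : ∀ y : ℝ, Real.sign (x - y) * (Complex.I * p y).re =
      (Set.Iio x).indicator (fun y => (Complex.I * p y).re) y -
      (Set.Ioi x).indicator (fun y => (Complex.I * p y).re) y := fun y => by
    rcases lt_trichotomy y x with h | h | h
    · rw [Real.sign_of_pos (by linarith), Set.indicator_of_mem (by exact h),
        Set.indicator_of_notMem (by simp [h.le])]; ring
    · subst h; simp
    · rw [Real.sign_of_neg (by linarith), Set.indicator_of_notMem (by simp [h.le]),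
        Set.indicator_of_mem (by exact h)]; ring
  simp only [primitive, hs]
  rw [integral_sub (hr.indicator measurableSet_Iio) (hr.indicator measurableSet_Ioi),
    integral_indicator measurableSet_Iio, integral_indicator measurableSet_Ioi,
    ← integral_Iic_eq_integral_Iio]
  have e1 : ∫ y in Set.Iic x, (Complex.I * p y).re = (Φ x).re := by
    rw [← hI x]; exact integral_re hip.integrableOn
  have e2 : ∫ y in Set.Ioi x, (Complex.I * p y).re = -(Φ x).re := by
    rw [← Complex.neg_re, ← hJ x]; exact integral_re hip.integrableOn
  rw [e1, e2]; ring

theorem measurable_sign_real : Measurable Real.sign := by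
  have h : Real.sign = fun x : ℝ => if x < 0 then -1 else if 0 < x then 1 else 0 := by
    ext x; rfl
  rw [h]
  exact Measurable.ite measurableSet_Iio measurable_const
    (Measurable.ite measurableSet_Ioi measurable_const measurable_const)

theorem abs_sign_le_one (x : ℝ) : |Real.sign x| ≤ 1 := by
  rcases Real.sign_apply_eq x with h | h | h <;> simp [h]

theorem line_primitive_antisymm {F G : ℝ → ℝ} (hF : Integrable F) (hG : Integrable G) :
    ∫ x, F x * primitive .line G x = -∫ x, G x * primitive .line F x := by
  have h := integral_kernel_antisymm (μ := (volume : Measure ℝ))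
    (K := fun x y => 1 / 2 * Real.sign (x - y)) (C := 1)
    ((measurable_sign_real.comp (measurable_fst.sub measurable_snd)).const_mul _)
    (fun x y => by
      rw [abs_mul]
      have := abs_sign_le_one (x - y)
      norm_num; linarith)
    (fun x y => by rw [← neg_sub, Real.sign_neg]; ring) hF hG
  simpa only [primitive, mul_assoc, integral_const_mul] using h

theorem line_primitive_bdd {F : ℝ → ℝ} (hF : Integrable F) :
    ∀ x, |primitive .line F x| ≤ ∫ y, |F y| := by
  intro x
  have h1 : |∫ y, Real.sign (x - y) * F y| ≤ ∫ y, |F y| := by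
    rw [← Real.norm_eq_abs]
    refine norm_integral_le_of_norm_le hF.abs (Eventually.of_forall fun y => ?_)
    rw [Real.norm_eq_abs, abs_mul]
    exact mul_le_of_le_one_left (abs_nonneg _) (abs_sign_le_one _)
  have h2 : 0 ≤ ∫ y, |F y| := integral_nonneg fun y => abs_nonneg _
  simp only [primitive]
  rw [abs_mul]; norm_num; linarith

theorem line_primitive_meas {F : ℝ → ℝ} (hF : Integrable F) :
    AEStronglyMeasurable (primitive .line F) volume := by
  have h : AEStronglyMeasurable (fun z : ℝ × ℝ => Real.sign (z.1 - z.2) * F z.2)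
      (volume.prod volume) :=
    (measurable_sign_real.comp (measurable_fst.sub measurable_snd)).aestronglyMeasurable.mul
      hF.aestronglyMeasurable.comp_snd
  exact (h.integral_prod_right').const_mul _

/-! ### Fourier series on the torus -/

/-- The measure on the frequencies of the torus for which Plancherel's identity holds without a
constant: `2π` times the counting measure. -/
abbrev torusFreqMeasure : Measure ℤ := ENNReal.ofReal (2 * π) • Measure.count

theorem ofReal_two_pi_ne_zero : ENNReal.ofReal (2 * π) ≠ 0 := by
  rw [ne_eq, ENNReal.ofReal_eq_zero, not_le]; positivity

theorem ae_haarAddCircle {P : AddCircle (2 * π) → Prop} :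
    (∀ᵐ x ∂AddCircle.haarAddCircle, P x) ↔ ∀ᵐ x : AddCircle (2 * π), P x := by
  rw [AddCircle.volume_eq_smul_haarAddCircle,
    Measure.ae_ennreal_smul_measure_iff ofReal_two_pi_ne_zero]

theorem ae_torusFreqMeasure {P : ℤ → Prop} : (∀ᵐ n ∂torusFreqMeasure, P n) ↔ ∀ n, P n := by
  rw [Measure.ae_ennreal_smul_measure_iff ofReal_two_pi_ne_zero, ae_iff,
    Measure.count_eq_zero_iff]
  simp [Set.eq_empty_iff_forall_notMem]

theorem integrable_torusFreqMeasure {f : ℤ → ℂ} :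
    Integrable f torusFreqMeasure ↔ Summable fun n => ‖f n‖ := by
  rw [integrable_smul_measure ofReal_two_pi_ne_zero ENNReal.ofReal_ne_top, integrable_count_iff]

theorem integral_torusFreqMeasure {f : ℤ → ℂ} (hf : Summable fun n => ‖f n‖) :
    ∫ n, f n ∂torusFreqMeasure = (2 * π : ℝ) * ∑' n, f n := by
  rw [integral_smul_measure, integral_countable (integrable_count_iff.2 hf),
    ENNReal.toReal_ofReal (by positivity)]
  simp [Measure.real]

theorem torusFourier_congr {f : L2 .torus} {h : AddCircle (2 * π) → ℂ}
    (hf : (f : AddCircle (2 * π) → ℂ) =ᵐ[volume] h) (n : ℤ) :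
    torusFourier f n = fourierCoeff h n := by
  refine congrFun (fourierCoeff_congr_ae ?_) n
  exact ae_haarAddCircle.2 hf

/-- The same function, as an element of `L²` for normalised Haar measure. -/
def toHaar (f : L2 .torus) : Lp ℂ 2 (AddCircle.haarAddCircle (T := 2 * π)) :=
  (Lp.memLp f).haarAddCircle.toLp f

theorem coeFn_toHaar (f : L2 .torus) :
    (toHaar f : AddCircle (2 * π) → ℂ) =ᵐ[AddCircle.haarAddCircle] f :=
  MemLp.coeFn_toLp _

theorem fourierBasis_repr_toHaar (f : L2 .torus) (n : ℤ) :
    fourierBasis.repr (toHaar f) n = torusFourier f n := by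
  rw [fourierBasis_repr]
  exact congrFun (fourierCoeff_congr_ae (coeFn_toHaar f)) n

theorem inner_toHaar (f h : L2 .torus) :
    ⟪f, h⟫_ℂ = (2 * π : ℝ) * ⟪toHaar f, toHaar h⟫_ℂ := by
  rw [L2.inner_def, L2.inner_def]
  have h1 : ∫ x, ⟪toHaar f x, toHaar h x⟫_ℂ ∂AddCircle.haarAddCircle =
      ∫ x, ⟪(f : AddCircle (2 * π) → ℂ) x, (h : AddCircle (2 * π) → ℂ) x⟫_ℂ
        ∂AddCircle.haarAddCircle := by
    refine integral_congr_ae ?_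
    filter_upwards [coeFn_toHaar f, coeFn_toHaar h] with x h2 h3
    rw [h2, h3]
  rw [h1, AddCircle.integral_haarAddCircle, Complex.real_smul, ← mul_assoc, ← Complex.ofReal_mul,
    mul_inv_cancel₀ (by positivity), Complex.ofReal_one, one_mul]

theorem summable_torusFourier_sq (f : L2 .torus) : Summable fun n => ‖torusFourier f n‖ ^ 2 := by
  have h := (fourierBasis.repr (toHaar f)).2.summable (by norm_num)
  simpa [← fourierBasis_repr_toHaar] using h

theorem memLp_torusFreqMeasure {φ : ℤ → ℂ} :
    MemLp φ 2 torusFreqMeasure ↔ Summable fun n => ‖φ n‖ ^ 2 := by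
  rw [memLp_two_iff_integrable_sq_norm (measurable_of_countable φ).aestronglyMeasurable,
    integrable_smul_measure ofReal_two_pi_ne_zero ENNReal.ofReal_ne_top, integrable_count_iff]
  simp only [norm_pow, norm_norm]

theorem memLp_torusFourier (f : L2 .torus) : MemLp (torusFourier f) 2 torusFreqMeasure :=
  memLp_torusFreqMeasure.2 (summable_torusFourier_sq f)

theorem torusFourier_inner (f h : L2 .torus) :
    ⟪f, h⟫_ℂ = ∫ n, conj (torusFourier f n) * torusFourier h n ∂torusFreqMeasure := by
  have hi : Integrable (fun n => conj (torusFourier f n) * torusFourier h n) torusFreqMeasure :=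
    MemLp.integrable_mul (memLp_torusFourier f).star (memLp_torusFourier h)
  rw [integral_torusFreqMeasure (integrable_torusFreqMeasure.1 hi), inner_toHaar,
    ← fourierBasis.repr.inner_map_map, lp.inner_eq_tsum]
  simp [fourierBasis_repr_toHaar, mul_comm]

theorem exists_torusFourier {φ : ℤ → ℂ} (hφ : MemLp φ 2 torusFreqMeasure) :
    ∃ f : L2 .torus, ∀ n, torusFourier f n = φ n := by
  have hs := memLp_torusFreqMeasure.1 hφ
  have hm : Memℓp φ 2 := memℓp_gen (by simpa using hs)
  set F := (fourierBasis (T := 2 * π)).repr.symm (⟨φ, hm⟩ : lp (fun _ : ℤ => ℂ) 2) with hF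
  have hFm : MemLp (F : AddCircle (2 * π) → ℂ) 2 volume := (Lp.memLp F).of_haarAddCircle
  refine ⟨hFm.toLp _, fun n => ?_⟩
  rw [torusFourier_congr hFm.coeFn_toLp, ← fourierBasis_repr, hF,
    LinearIsometryEquiv.apply_symm_apply]

theorem torusFourier_conj {a p : L2 .torus}
    (hp : (p : AddCircle (2 * π) → ℂ) =ᵐ[volume] fun x => conj (a x)) (n : ℤ) :
    torusFourier p n = conj (torusFourier a (-n)) := by
  rw [torusFourier_congr hp, torusFourier, fourierCoeff, fourierCoeff, ← integral_conj]
  congr 1; ext x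
  rw [neg_neg, smul_eq_mul, smul_eq_mul, map_mul, fourier_neg]

/-- The Fourier coefficients of `ā b` are the correlation of the Fourier coefficients. -/
theorem torusFourier_conj_mul {a b p : L2 .torus}
    (hp : (p : AddCircle (2 * π) → ℂ) =ᵐ[volume] fun x => conj (a x) * b x) (n : ℤ) :
    torusFourier p n = ((2 * π)⁻¹ : ℝ) *
      ∫ k, conj (torusFourier a k) * torusFourier b (k + n) ∂torusFreqMeasure := by
  have hm : MemLp (fun x : AddCircle (2 * π) => fourier (-n) x * b x) 2 volume := by
    refine (Lp.memLp b).of_le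
      ((fourier (-n)).continuous.aestronglyMeasurable.mul (Lp.aestronglyMeasurable b))
      (Eventually.of_forall fun x => ?_)
    rw [norm_mul, fourier_apply, Circle.norm_coe, one_mul]
  have hs : ∀ k, torusFourier (hm.toLp _) k = torusFourier b (k + n) := fun k => by
    rw [torusFourier_congr hm.coeFn_toLp, torusFourier, fourierCoeff, fourierCoeff]
    congr 1; ext x
    rw [smul_eq_mul, smul_eq_mul, ← mul_assoc, neg_add, fourier_add]
  have h1 := torusFourier_inner a (hm.toLp _)
  simp only [hs] at h1
  rw [← h1, torusFourier_congr hp, fourierCoeff, AddCircle.integral_haarAddCircle, L2.inner_def,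
    Complex.real_smul]
  congr 1
  refine integral_congr_ae ?_
  filter_upwards [hm.coeFn_toLp] with x hx
  rw [hx, RCLike.inner_apply, smul_eq_mul]; ring

theorem torusFourier_inversion {f : L2 .torus} (hf : Summable fun n => ‖torusFourier f n‖) :
    ∀ᵐ x : AddCircle (2 * π), f x = ∑' n, torusFourier f n * fourier n x := by
  have hs : Summable fun n => torusFourier f n • (fourier n : C(AddCircle (2 * π), ℂ)) := by
    refine Summable.of_norm ?_
    simpa [norm_smul, fourier_norm] using hf
  set g := ∑' n, torusFourier f n • (fourier n : C(AddCircle (2 * π), ℂ)) with hg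
  have h1 : HasSum (fun n => torusFourier f n • fourierLp (T := 2 * π) 2 n)
      (ContinuousMap.toLp 2 AddCircle.haarAddCircle ℂ g) := by
    have := hs.hasSum.mapL (ContinuousMap.toLp 2 (AddCircle.haarAddCircle (T := 2 * π)) ℂ
      (E := ℂ))
    simpa [fourierLp] using this
  have h2 := hasSum_fourier_series_L2 (toHaar f)
  have h3 : ∀ n, fourierCoeff (toHaar f : AddCircle (2 * π) → ℂ) n = torusFourier f n := fun n =>
    congrFun (fourierCoeff_congr_ae (coeFn_toHaar f)) n
  simp only [h3] at h2
  have h4 := h1.unique h2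
  have h5 : (f : AddCircle (2 * π) → ℂ) =ᵐ[AddCircle.haarAddCircle] g := by
    refine (coeFn_toHaar f).symm.trans ?_
    rw [← h4]
    exact ContinuousMap.coeFn_toLp _ _
  have h6 := ae_haarAddCircle.1 h5
  filter_upwards [h6] with x hx
  rw [hx, hg]
  have := (ContinuousMap.hasSum_apply hs.hasSum x).tsum_eq
  rw [← this]; simp

theorem norm_le_tsum_torusFourier {f : L2 .torus} (hf : Summable fun n => ‖torusFourier f n‖) :
    ∀ᵐ x : AddCircle (2 * π), ‖f x‖ ≤ ∑' n, ‖torusFourier f n‖ := by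
  filter_upwards [torusFourier_inversion hf] with x hx
  have h : ∀ n, ‖torusFourier f n * fourier n x‖ = ‖torusFourier f n‖ := fun n => by
    rw [norm_mul, fourier_apply, Circle.norm_coe, mul_one]
  rw [hx]
  refine (norm_tsum_le_tsum_norm (by simpa only [h] using hf)).trans ?_
  simp only [h]; rfl

/-! ### The primitive on the torus -/

/-- The sawtooth `1 - y / π` for `0 < y < 2π`, normalised to be odd: the kernel of `2 ∂̃⁻¹` on the
torus. -/
def sawtooth (z : AddCircle (2 * π)) : ℝ :=
  open Classical in if z = 0 then 0 else 1 - (AddCircle.equivIoc (2 * π) 0 z : ℝ) / π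

theorem sawtooth_coe {y : ℝ} (hy : y ∈ Set.Ioo 0 (2 * π)) :
    sawtooth (y : AddCircle (2 * π)) = 1 - y / π := by
  have h1 : (y : AddCircle (2 * π)) ≠ 0 := by
    intro h
    obtain ⟨n, hn⟩ := AddCircle.coe_eq_zero_iff _ |>.1 h
    rw [zsmul_eq_mul] at hn
    have hpos : (0 : ℝ) < 2 * π := by positivity
    have h2 : (0 : ℝ) < n := by
      by_contra hc
      have := mul_nonpos_of_nonpos_of_nonneg (not_lt.1 hc) hpos.le
      linarith [hy.1]
    have h3 : (n : ℝ) < 1 := by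
      by_contra hc
      have := mul_le_mul_of_nonneg_right (not_lt.1 hc) hpos.le
      linarith [hy.2]
    have h4 : 0 < n := by exact_mod_cast h2
    have h5 : n < 1 := by exact_mod_cast h3
    omega
  have h2 : (AddCircle.equivIoc (2 * π) 0 (y : AddCircle (2 * π)) : ℝ) = y :=
    AddCircle.equivIoc_coe_of_mem ⟨hy.1, by linarith [hy.2]⟩
  rw [sawtooth, if_neg h1, h2]

theorem exists_coe_Ioo {z : AddCircle (2 * π)} (hz : z ≠ 0) :
    ∃ y ∈ Set.Ioo 0 (2 * π), (y : AddCircle (2 * π)) = z := by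
  set w := AddCircle.equivIoc (2 * π) 0 z with hw
  have h1 : ((w : ℝ) : AddCircle (2 * π)) = z := (AddCircle.equivIoc (2 * π) 0).symm_apply_apply z
  refine ⟨w, ⟨w.2.1, lt_of_le_of_ne (by simpa using w.2.2) fun h => hz ?_⟩, h1⟩
  rw [← h1, h, AddCircle.coe_period]

theorem sawtooth_neg (z : AddCircle (2 * π)) : sawtooth (-z) = -sawtooth z := by
  by_cases hz : z = 0
  · simp [hz, sawtooth]
  · obtain ⟨y, hy, rfl⟩ := exists_coe_Ioo hz
    have h : (-(y : AddCircle (2 * π))) = ((2 * π - y : ℝ) : AddCircle (2 * π)) := by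
      rw [AddCircle.coe_sub, AddCircle.coe_period, zero_sub]
    rw [h, sawtooth_coe hy, sawtooth_coe ⟨by linarith [hy.2], by linarith [hy.1]⟩]
    have := Real.pi_pos.ne'
    field_simp; ring

theorem abs_sawtooth_le (z : AddCircle (2 * π)) : |sawtooth z| ≤ 1 := by
  by_cases hz : z = 0
  · simp [hz, sawtooth]
  · obtain ⟨y, hy, rfl⟩ := exists_coe_Ioo hz
    rw [sawtooth_coe hy, abs_le]
    have h1 : y / π ≤ 2 := (div_le_iff₀ Real.pi_pos).2 hy.2.le
    have h2 : 0 ≤ y / π := div_nonneg hy.1.le Real.pi_pos.le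
    constructor <;> linarith

theorem measurable_sawtooth : Measurable sawtooth := by
  refine Measurable.ite (measurableSet_singleton 0) measurable_const ?_
  have h := (AddCircle.measurableEquivIoc (2 * π) 0).measurable
  exact ((measurable_subtype_coe.comp h).div_const _).const_sub _

theorem integral_sawtooth_mul {E : Type*} [NormedAddCommGroup E] [NormedSpace ℝ E]
    (F : AddCircle (2 * π) → E) :
    ∫ z, sawtooth z • F z = ∫ y in (0 : ℝ)..(2 * π), (1 - y / π) • F y := by
  have h := AddCircle.intervalIntegral_preimage (2 * π) 0 (fun z => sawtooth z • F z)
  rw [← h, zero_add, intervalIntegral.integral_of_le Real.two_pi_pos.le,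
    intervalIntegral.integral_of_le Real.two_pi_pos.le, integral_Ioc_eq_integral_Ioo,
    integral_Ioc_eq_integral_Ioo]
  refine setIntegral_congr_fun measurableSet_Ioo fun y hy => ?_
  simp only [sawtooth_coe hy]

/-- On the torus, `∂̃⁻¹` is the convolution with half the sawtooth. -/
theorem torus_primitive_eq (F : AddCircle (2 * π) → ℝ) (x : AddCircle (2 * π)) :
    primitive .torus F x = ∫ z, (1 / 2 * sawtooth (x - z)) * F z := by
  have h1 := integral_sawtooth_mul fun z => F (x - z)
  have h2 := integral_sub_left_eq_self (fun z => sawtooth (x - z) • F z)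
    (volume : Measure (AddCircle (2 * π))) x
  simp only [sub_sub_cancel] at h2
  simp only [smul_eq_mul] at h1 h2
  simp only [mul_assoc, integral_const_mul]
  rw [← h2, h1]; rfl

theorem torus_primitive_antisymm {F G : AddCircle (2 * π) → ℝ} (hF : Integrable F)
    (hG : Integrable G) :
    ∫ x, F x * primitive .torus G x = -∫ x, G x * primitive .torus F x := by
  simp only [torus_primitive_eq]
  refine integral_kernel_antisymm (C := 1)
    ((measurable_sawtooth.comp (measurable_fst.sub measurable_snd)).const_mul _)
    (fun x y => ?_) (fun x y => by rw [← neg_sub, sawtooth_neg]; ring) hF hG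
  rw [abs_mul]
  have := abs_sawtooth_le (x - y)
  norm_num; linarith

theorem torus_primitive_bdd {F : AddCircle (2 * π) → ℝ} (hF : Integrable F) :
    ∀ x, |primitive .torus F x| ≤ ∫ y, |F y| := by
  intro x
  rw [torus_primitive_eq, ← Real.norm_eq_abs]
  refine norm_integral_le_of_norm_le hF.abs (Eventually.of_forall fun y => ?_)
  rw [Real.norm_eq_abs, abs_mul, abs_mul]
  have h1 := abs_sawtooth_le (x - y)
  refine mul_le_of_le_one_left (abs_nonneg _) ?_
  norm_num; linarith

theorem torus_primitive_meas {F : AddCircle (2 * π) → ℝ} (hF : Integrable F) :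
    AEStronglyMeasurable (primitive .torus F) volume := by
  have h : AEStronglyMeasurable
      (fun z : AddCircle (2 * π) × AddCircle (2 * π) => (1 / 2 * sawtooth (z.1 - z.2)) * F z.2)
      (volume.prod volume) :=
    ((measurable_sawtooth.comp (measurable_fst.sub measurable_snd)).const_mul
      _).aestronglyMeasurable.mul hF.aestronglyMeasurable.comp_snd
  refine h.integral_prod_right'.congr (Eventually.of_forall fun x => ?_)
  exact (torus_primitive_eq F x).symm

theorem integral_sawtooth_fourier {n : ℤ} (hn : n ≠ 0) :
    ∫ z, sawtooth z • (fourier n z : ℂ) = -2 / (Complex.I * n) := by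
  rw [integral_sawtooth_mul]
  have hn' : (n : ℂ) ≠ 0 := by exact_mod_cast hn
  have hpi : (π : ℂ) ≠ 0 := by exact_mod_cast Real.pi_ne_zero
  have hI := Complex.I_ne_zero
  have hf : ∀ y : ℝ, (fourier n (y : AddCircle (2 * π)) : ℂ) = Complex.exp (Complex.I * n * y) := by
    intro y
    rw [fourier_coe_apply]
    congr 1; push_cast; field_simp
  have hd : ∀ y : ℝ, HasDerivAt (fun y : ℝ => Complex.exp (Complex.I * n * y) *
      ((1 - y / π) / (Complex.I * n) + 1 / (π * (Complex.I * n) ^ 2)))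
      ((1 - y / π : ℝ) • (fourier n (y : AddCircle (2 * π)) : ℂ)) y := by
    intro y
    have h1 : HasDerivAt (fun y : ℝ => Complex.exp (Complex.I * n * y))
        (Complex.exp (Complex.I * n * y) * (Complex.I * n)) y := by
      have h := ((hasDerivAt_id (y : ℂ)).const_mul (Complex.I * n)).cexp.comp_ofReal
      simpa using h
    have h2 : HasDerivAt (fun y : ℝ => (1 - (y : ℂ) / π) / (Complex.I * n) +
        1 / (π * (Complex.I * n) ^ 2)) ((-(1 / π)) / (Complex.I * n)) y := by
      have h := ((((hasDerivAt_id (y : ℂ)).div_const (π : ℂ)).const_sub 1).div_const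
        (Complex.I * n)).add_const (1 / (π * (Complex.I * n) ^ 2))
      exact h.comp_ofReal
    refine (h1.mul h2).congr_deriv ?_
    rw [hf, Complex.real_smul]
    push_cast
    field_simp
    ring
  rw [intervalIntegral.integral_eq_sub_of_hasDerivAt (fun y _ => hd y)]
  · have h3 : Complex.exp (Complex.I * n * (2 * π : ℝ)) = 1 := by
      rw [Complex.exp_eq_one_iff]; exact ⟨n, by push_cast; ring⟩
    rw [h3]
    push_cast
    simp only [mul_zero, Complex.exp_zero]
    field_simp
    ring
  · refine Continuous.intervalIntegrable ?_ _ _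
    simp only [hf]; fun_prop

theorem fourier_sub_eq (n : ℤ) (x z : AddCircle (2 * π)) :
    (fourier n (x - z) : ℂ) = fourier n x * conj (fourier n z : ℂ) := by
  rw [← fourier_neg', fourier_apply, fourier_apply, smul_sub, sub_eq_add_neg,
    AddCircle.toCircle_add, Circle.coe_mul]

/-- On the torus, `∂̃⁻¹` inverts the derivative up to the mean. -/
theorem torus_primitive_momentum {φ p : L2 .torus} (hφp : IsMomentum .torus φ p)
    (hφ : Summable fun n => ‖torusFourier φ n‖) :
    ∀ᵐ x : AddCircle (2 * π), primitive .torus (fun y => (Complex.I * p y).re) x =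
      (φ x).re - (2 * π)⁻¹ * (∫ y, φ y).re := by
  have hp : Integrable (p : AddCircle (2 * π) → ℂ) := (Lp.memLp p).integrable (by norm_num)
  filter_upwards [torusFourier_inversion hφ] with x hx
  have hk : MemLp (fun z => (sawtooth (x - z) : ℂ)) 2 (volume : Measure (AddCircle (2 * π))) :=
    MemLp.of_bound (Complex.measurable_ofReal.comp
      (measurable_sawtooth.comp (measurable_const.sub measurable_id))).aestronglyMeasurable 1
      (Eventually.of_forall fun z => by
        rw [Complex.norm_real]; exact abs_sawtooth_le _)
  have hkf : ∀ n, conj (torusFourier (hk.toLp _) n) =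
      (2 * π : ℝ)⁻¹ * (fourier n x * conj (∫ z, sawtooth z • (fourier n z : ℂ))) := fun n => by
    rw [torusFourier_congr hk.coeFn_toLp, fourierCoeff, AddCircle.integral_haarAddCircle,
      Complex.real_smul, map_mul, Complex.conj_ofReal, Complex.ofReal_inv]
    congr 1
    have h2 := integral_sub_left_eq_self (fun z => fourier (-n) z • (sawtooth (x - z) : ℂ))
      (volume : Measure (AddCircle (2 * π))) x
    rw [← h2, ← integral_conj, ← integral_conj, ← integral_const_mul]
    congr 1; ext z
    simp only [sub_sub_cancel, fourier_neg, map_mul, Complex.conj_conj, Complex.conj_ofReal,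
      smul_eq_mul, Complex.real_smul, fourier_sub_eq]
    ring
  have h1 : ∫ z, ((1 / 2 * sawtooth (x - z) : ℝ) : ℂ) * (Complex.I * p z) =
      1 / 2 * Complex.I * ⟪hk.toLp _, p⟫_ℂ := by
    rw [L2.inner_def, ← integral_const_mul]
    refine integral_congr_ae ?_
    filter_upwards [hk.coeFn_toLp] with z hz
    rw [hz, RCLike.inner_apply, Complex.conj_ofReal]
    push_cast; ring
  have h2 : primitive .torus (fun y => (Complex.I * p y).re) x =
      (1 / 2 * Complex.I * ⟪hk.toLp _, p⟫_ℂ).re := by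
    rw [torus_primitive_eq, ← h1]
    have hi : Integrable fun z : AddCircle (2 * π) =>
        ((1 / 2 * sawtooth (x - z) : ℝ) : ℂ) * (Complex.I * p z) := by
      refine (hp.const_mul Complex.I).bdd_mul (c := 1) (Complex.measurable_ofReal.comp
        ((measurable_sawtooth.comp (measurable_const.sub
          measurable_id)).const_mul _)).aestronglyMeasurable (Eventually.of_forall fun z => ?_)
      rw [Complex.norm_real, Real.norm_eq_abs, abs_mul]
      have := abs_sawtooth_le (x - z)
      norm_num; linarith
    rw [← RCLike.re_eq_complex_re, ← integral_re hi]
    congr 1; ext z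
    simp
  have h3 : (1 / 2 * Complex.I * ⟪hk.toLp _, p⟫_ℂ) =
      ∑' n, if n = 0 then 0 else torusFourier φ n * fourier n x := by
    have hi : Integrable (fun n => conj (torusFourier (hk.toLp _) n) * torusFourier p n)
        torusFreqMeasure :=
      MemLp.integrable_mul (memLp_torusFourier _).star (memLp_torusFourier p)
    rw [torusFourier_inner, integral_torusFreqMeasure (integrable_torusFreqMeasure.1 hi),
      ← mul_assoc, ← tsum_mul_left]
    congr 1; ext n
    rw [hkf, hφp n]
    by_cases hn : n = 0
    · simp [hn]
    · rw [if_neg hn, integral_sawtooth_fourier hn]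
      have hn' : (n : ℂ) ≠ 0 := by exact_mod_cast hn
      have hpi : (π : ℂ) ≠ 0 := by exact_mod_cast Real.pi_ne_zero
      have hI := Complex.I_ne_zero
      simp only [map_div₀, map_mul, map_neg, Complex.conj_I, map_intCast, map_ofNat]
      push_cast
      field_simp
  have hs : Summable fun n => torusFourier φ n * fourier n x := by
    refine Summable.of_norm ?_
    simpa only [norm_mul, fourier_apply, Circle.norm_coe, mul_one] using hφ
  have h4 : torusFourier φ 0 = ((2 * π)⁻¹ : ℝ) * ∫ y, φ y := by
    rw [torusFourier, fourierCoeff, AddCircle.integral_haarAddCircle, Complex.real_smul]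
    simp
  have h5 := hs.tsum_eq_add_tsum_ite 0
  rw [← hx] at h5
  have h6 : (1 / 2 * Complex.I * ⟪hk.toLp _, p⟫_ℂ) = φ x - ((2 * π)⁻¹ : ℝ) * ∫ y, φ y := by
    rw [h3, h5, ← h4]; simp
  rw [h2, h6, Complex.sub_re, Complex.re_ofReal_mul]

/-! ### A common frame for the two Fourier transforms -/

/-- The frequency space: `ℝ` for the line and `ℤ` for the torus. -/
abbrev Geometry.Freq : Geometry → Type
  | .line => ℝ
  | .torus => ℤ

instance instAddCommGroupFreq : (g : Geometry) → AddCommGroup g.Freq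
  | .line => inferInstanceAs (AddCommGroup ℝ)
  | .torus => inferInstanceAs (AddCommGroup ℤ)

instance instMeasurableSpaceFreq : (g : Geometry) → MeasurableSpace g.Freq
  | .line => inferInstanceAs (MeasurableSpace ℝ)
  | .torus => inferInstanceAs (MeasurableSpace ℤ)

instance instMeasurableAdd₂Freq : (g : Geometry) → MeasurableAdd₂ g.Freq
  | .line => inferInstanceAs (MeasurableAdd₂ ℝ)
  | .torus => inferInstanceAs (MeasurableAdd₂ ℤ)

/-- The measure on frequency space for which Plancherel's identity holds without a constant. -/
def freqMeasure : (g : Geometry) → Measure g.Freq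
  | .line => (volume : Measure ℝ)
  | .torus => torusFreqMeasure

/-- The symbol of `-i ∂ₓ`. -/
def sym : (g : Geometry) → g.Freq → ℝ
  | .line, ξ => 2 * π * (show ℝ from ξ)
  | .torus, n => ((show ℤ from n : ℤ) : ℝ)

/-- The Fourier transform of the product of two functions is `convWeight` times the convolution,
with respect to `freqMeasure`, of their Fourier transforms. -/
def convWeight : Geometry → ℝ
  | .line => 1
  | .torus => (2 * π)⁻¹

/-- The mean of a function is `meanWeight` times its integral; on the line, the mean is zero. -/
def meanWeight : Geometry → ℝ
  | .line => 0
  | .torus => (2 * π)⁻¹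

/-- The Fourier transform of a square integrable function. -/
def fhat : (g : Geometry) → L2 g → g.Freq → ℂ
  | .line, f => lineFourier f
  | .torus, f => torusFourier f

instance instSFiniteFreqMeasure : (g : Geometry) → SFinite (freqMeasure g)
  | .line => inferInstanceAs (SFinite (volume : Measure ℝ))
  | .torus => inferInstanceAs (SFinite torusFreqMeasure)

instance instLeftInvariantFreqMeasure : (g : Geometry) → (freqMeasure g).IsAddLeftInvariant
  | .line => inferInstanceAs (volume : Measure ℝ).IsAddLeftInvariant
  | .torus => inferInstanceAs torusFreqMeasure.IsAddLeftInvariant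

theorem ae_freqMeasure_neg : {g : Geometry} → {P : g.Freq → Prop} →
    (∀ᵐ ξ ∂freqMeasure g, P ξ) → ∀ᵐ ξ ∂freqMeasure g, P (-ξ)
  | .line, _, h =>
    (Measure.measurePreserving_neg (volume : Measure ℝ)).quasiMeasurePreserving.ae h
  | .torus, _, h => ae_torusFreqMeasure.2 fun n => ae_torusFreqMeasure.1 h (-n)

theorem convWeight_pos : (g : Geometry) → 0 < convWeight g
  | .line => zero_lt_one
  | .torus => by simp only [convWeight]; positivity

theorem sym_add : {g : Geometry} → (ξ η : g.Freq) → sym g (ξ + η) = sym g ξ + sym g η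
  | .line, ξ, η => mul_add (2 * π) (show ℝ from ξ) (show ℝ from η)
  | .torus, ξ, η => Int.cast_add (show ℤ from ξ) (show ℤ from η)

theorem sym_neg : {g : Geometry} → (ξ : g.Freq) → sym g (-ξ) = -sym g ξ
  | .line, ξ => mul_neg (2 * π) (show ℝ from ξ)
  | .torus, ξ => Int.cast_neg (show ℤ from ξ)

theorem measurable_sym : (g : Geometry) → Measurable (sym g)
  | .line => measurable_const_mul (2 * π)
  | .torus => measurable_of_countable (α := ℤ) _

theorem measurable_fhat : {g : Geometry} → (f : L2 g) → Measurable (fhat g f)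
  | .line, f => (Lp.stronglyMeasurable (Lp.fourierTransformₗᵢ ℝ ℂ f)).measurable
  | .torus, _ => measurable_of_countable (α := ℤ) _

theorem memLp_fhat : {g : Geometry} → (f : L2 g) → MemLp (fhat g f) 2 (freqMeasure g)
  | .line, f => memLp_lineFourier f
  | .torus, f => memLp_torusFourier f

/-- Plancherel's identity. -/
theorem inner_eq_integral_fhat : {g : Geometry} → (f h : L2 g) →
    ⟪f, h⟫_ℂ = ∫ ξ, conj (fhat g f ξ) * fhat g h ξ ∂freqMeasure g
  | .line, f, h => lineFourier_inner f h
  | .torus, f, h => torusFourier_inner f h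

theorem exists_fhat : {g : Geometry} → {φ : g.Freq → ℂ} → MemLp φ 2 (freqMeasure g) →
    ∃ f : L2 g, fhat g f =ᵐ[freqMeasure g] φ
  | .line, _, hφ => exists_lineFourier hφ
  | .torus, _, hφ => (exists_torusFourier hφ).imp fun _ hf => ae_torusFreqMeasure.2 hf

theorem fhat_add : {g : Geometry} → (f h : L2 g) →
    ∀ᵐ ξ ∂freqMeasure g, fhat g (f + h) ξ = fhat g f ξ + fhat g h ξ
  | .line, f, h => by
    have h1 := Lp.coeFn_add (Lp.fourierTransformₗᵢ ℝ ℂ f) (Lp.fourierTransformₗᵢ ℝ ℂ h)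
    rw [← map_add] at h1
    exact h1
  | .torus, f, h => ae_torusFreqMeasure.2 fun n => by
    change torusFourier (f + h) n = torusFourier f n + torusFourier h n
    simp only [torusFourier_eq_inner, inner_add_right, mul_add]

theorem fhat_smul : {g : Geometry} → (c : ℂ) → (f : L2 g) →
    ∀ᵐ ξ ∂freqMeasure g, fhat g (c • f) ξ = c * fhat g f ξ
  | .line, c, f => by
    have h1 := Lp.coeFn_smul c (Lp.fourierTransformₗᵢ ℝ ℂ f)
    rw [← map_smul] at h1
    exact h1
  | .torus, c, f => ae_torusFreqMeasure.2 fun n => by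
    change torusFourier (c • f) n = c * torusFourier f n
    simp only [torusFourier_eq_inner, inner_smul_right]; ring

theorem fhat_sub (f h : L2 g) :
    ∀ᵐ ξ ∂freqMeasure g, fhat g (f - h) ξ = fhat g f ξ - fhat g h ξ := by
  have h1 := fhat_add f (((-1 : ℂ)) • h)
  filter_upwards [h1, fhat_smul (-1 : ℂ) h] with ξ h2 h3
  rw [sub_eq_add_neg, ← neg_one_smul ℂ h, h2, h3]; ring

/-- The Fourier transform of `ā b` is a correlation of the Fourier transforms. -/
theorem fhat_conj_mul : {g : Geometry} → {a b p : L2 g} →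
    (p =ᵐ[volume] fun x => conj (a x) * b x) → ∀ᵐ ξ ∂freqMeasure g,
      fhat g p ξ = convWeight g * ∫ η, conj (fhat g a η) * fhat g b (η + ξ) ∂freqMeasure g
  | .line, a, b, p, hp => by
    filter_upwards [lineFourier_conj_mul hp] with ξ hξ
    simp only [convWeight, Complex.ofReal_one, one_mul]
    exact hξ
  | .torus, _, _, _, hp => ae_torusFreqMeasure.2 fun n => torusFourier_conj_mul hp n

theorem fhat_conj : {g : Geometry} → {a p : L2 g} →
    (p =ᵐ[volume] fun x => conj (a x)) → ∀ᵐ ξ ∂freqMeasure g,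
      fhat g p ξ = conj (fhat g a (-ξ))
  | .line, _, _, hp => lineFourier_conj hp
  | .torus, _, _, hp => ae_torusFreqMeasure.2 fun n => torusFourier_conj hp n

theorem noNegFreq_iff : {g : Geometry} → {f : L2 g} →
    (NoNegFreq g f ↔ ∀ᵐ ξ ∂freqMeasure g, sym g ξ < 0 → fhat g f ξ = 0)
  | .line, f => by
    refine eventually_congr (Eventually.of_forall fun ξ => ?_)
    have h : 2 * π * ξ < 0 ↔ ξ < 0 := by
      rw [mul_neg_iff]; simp [Real.pi_pos, Real.pi_pos.le]
    exact imp_congr h.symm Iff.rfl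
  | .torus, f => by
    refine Iff.trans ?_ ae_torusFreqMeasure.symm
    exact forall_congr' fun n => imp_congr (Int.cast_lt_zero (R := ℝ)).symm Iff.rfl

theorem isMomentum_iff : {g : Geometry} → {f p : L2 g} →
    (IsMomentum g f p ↔ ∀ᵐ ξ ∂freqMeasure g, fhat g p ξ = sym g ξ * fhat g f ξ)
  | .line, _, _ => Iff.rfl
  | .torus, _, _ => Iff.trans (forall_congr' fun n => by
      rw [← Complex.ofReal_intCast]; exact Iff.rfl) ae_torusFreqMeasure.symm

theorem norm_le_integral_fhat : {g : Geometry} → {f : L2 g} →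
    Integrable (fhat g f) (freqMeasure g) →
    ∀ᵐ x : g.Space, ‖f x‖ ≤ convWeight g * ∫ ξ, ‖fhat g f ξ‖ ∂freqMeasure g
  | .line, f, hf => by
    simp only [convWeight, one_mul]
    exact norm_le_integral_lineFourier hf
  | .torus, f, hf => by
    have hs : Summable fun n => ‖torusFourier f n‖ := integrable_torusFreqMeasure.1 hf
    filter_upwards [norm_le_tsum_torusFourier hs] with x hx
    refine hx.trans_eq ?_
    change _ = (2 * π)⁻¹ * ∫ n, ‖torusFourier f n‖ ∂torusFreqMeasure
    have h := integral_torusFreqMeasure (f := fun n => (‖torusFourier f n‖ : ℂ)) (by simpa using hs)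
    rw [integral_complex_ofReal, ← Complex.ofReal_tsum, ← Complex.ofReal_mul] at h
    rw [Complex.ofReal_injective h, inv_mul_cancel_left₀ (by positivity)]

/-- The primitive of `φ' = i p` is `φ` minus its mean. -/
theorem primitive_momentum : {g : Geometry} → {φ p : L2 g} → IsMomentum g φ p →
    Integrable (fhat g φ) (freqMeasure g) → Integrable p volume →
    ∀ᵐ x : g.Space, primitive g (fun y => (Complex.I * p y).re) x =
      (φ x).re - meanWeight g * (∫ y, φ y).re
  | .line, φ, p, h1, h2, h3 => by
    filter_upwards [line_primitive_momentum h1 h2 h3] with x hx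
    rw [meanWeight, zero_mul, sub_zero]; exact hx
  | .torus, _, _, h1, h2, _ =>
    torus_primitive_momentum h1 (integrable_torusFreqMeasure.1 h2)

theorem primitive_antisymm : {g : Geometry} → {F G : g.Space → ℝ} → Integrable F volume →
    Integrable G volume → ∫ x, F x * primitive g G x = -∫ x, G x * primitive g F x
  | .line, _, _, hF, hG => line_primitive_antisymm hF hG
  | .torus, _, _, hF, hG => torus_primitive_antisymm hF hG

theorem abs_primitive_le : {g : Geometry} → {F : g.Space → ℝ} → Integrable F volume →
    ∀ x, |primitive g F x| ≤ ∫ y, |F y|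
  | .line, _, hF => line_primitive_bdd hF
  | .torus, _, hF => torus_primitive_bdd hF

theorem aestronglyMeasurable_primitive : {g : Geometry} → {F : g.Space → ℝ} →
    Integrable F volume → AEStronglyMeasurable (primitive g F) volume
  | .line, _, hF => line_primitive_meas hF
  | .torus, _, hF => torus_primitive_meas hF

theorem primitive_congr : {g : Geometry} → {F G : g.Space → ℝ} → F =ᵐ[volume] G →
    primitive g F = primitive g G
  | .line, F, G, h => by
    funext x
    simp only [primitive]
    congr 1
    refine integral_congr_ae ?_
    filter_upwards [h] with y hy
    rw [hy]
  | .torus, F, G, h => by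
    funext x
    rw [torus_primitive_eq, torus_primitive_eq]
    refine integral_congr_ae ?_
    filter_upwards [h] with y hy
    rw [hy]

/-- A function all of whose frequencies are zero is constant: on the line it vanishes. -/
theorem ae_eq_mean_of_fhat : {g : Geometry} → {f : L2 g} →
    (∀ᵐ ξ ∂freqMeasure g, sym g ξ ≠ 0 → fhat g f ξ = 0) →
    ∀ᵐ x : g.Space, f x = meanWeight g * ∫ y, f y
  | .line, f, h => by
    have h0 : Lp.fourierTransformₗᵢ ℝ ℂ f = 0 := by
      rw [Lp.eq_zero_iff_ae_eq_zero]
      have hne : ∀ᵐ ξ : ℝ, ξ ≠ 0 := by simp [ae_iff]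
      filter_upwards [show ∀ᵐ ξ : ℝ, 2 * π * ξ ≠ 0 → lineFourier f ξ = 0 from h, hne] with ξ h1 h2
      exact h1 (by simp [h2, Real.pi_ne_zero])
    have h1 : f = 0 := by simpa using h0
    filter_upwards [(Lp.eq_zero_iff_ae_eq_zero).1 h1] with x hx
    simp only [meanWeight]
    rw [hx]; simp
  | .torus, f, h => by
    have h0 : ∀ n : ℤ, n ≠ 0 → torusFourier f n = 0 := fun n hn =>
      ae_torusFreqMeasure.1 h n (Int.cast_ne_zero.2 hn)
    have hs : Summable fun n => ‖torusFourier f n‖ :=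
      summable_of_ne_finset_zero (s := {0}) fun n hn => by
        rw [h0 n (by simpa using hn), norm_zero]
    filter_upwards [torusFourier_inversion hs] with x hx
    rw [hx, tsum_eq_single 0 fun n hn => by rw [h0 n hn, zero_mul], torusFourier, fourierCoeff,
      AddCircle.integral_haarAddCircle, Complex.real_smul]
    simp [meanWeight]

/-! ### Counting frequencies -/

/-- The weight `(1 + |σ|)^{1/2}`, where `σ` is the symbol of `-i ∂ₓ`. -/
def wt (g : Geometry) (ξ : g.Freq) : ℝ≥0∞ := ENNReal.ofReal √(1 + |sym g ξ|)

theorem measurable_wt (g : Geometry) : Measurable (wt g) :=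
  ENNReal.measurable_ofReal.comp
    (Real.continuous_sqrt.measurable.comp ((measurable_sym g).norm.const_add 1))

theorem wt_ne_zero (ξ : g.Freq) : wt g ξ ≠ 0 := by
  rw [wt, ne_eq, ENNReal.ofReal_eq_zero, not_le]
  positivity

theorem wt_ne_top (ξ : g.Freq) : wt g ξ ≠ ∞ := ENNReal.ofReal_ne_top

theorem wt_inv (ξ : g.Freq) : (wt g ξ)⁻¹ = ENNReal.ofReal (√(1 + |sym g ξ|))⁻¹ := by
  rw [wt, ENNReal.ofReal_inv_of_pos (by positivity)]

/-- Comparison of `Σ (1 + n)^{-1/2}` with a telescoping sum. -/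
theorem sum_inv_sqrt_le (t : ℝ) (ht : 0 ≤ t) (K : ℕ) :
    ∑ n ∈ Finset.range K, (if (n : ℝ) ≤ t then (√(1 + n))⁻¹ else 0) ≤ 2 * √(min K (t + 1)) := by
  induction K with
  | zero => simp [ht, add_nonneg]
  | succ K ih =>
    rw [Finset.sum_range_succ]
    by_cases hK : (K : ℝ) ≤ t
    · rw [if_pos hK]
      rw [min_eq_left (by linarith)] at ih
      rw [min_eq_left (by push_cast; linarith)]
      have h1 : (√(1 + (K : ℝ)))⁻¹ ≤ 2 * (√(1 + (K : ℝ)) - √K) := by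
        have hp : 0 < √(1 + (K : ℝ)) := by positivity
        have h2 := Real.sq_sqrt (show (0 : ℝ) ≤ 1 + K by positivity)
        have h3 := Real.sq_sqrt (show (0 : ℝ) ≤ K by positivity)
        rw [inv_le_iff_one_le_mul₀ hp]
        nlinarith [sq_nonneg (√(1 + (K : ℝ)) - √K)]
      push_cast
      rw [add_comm (K : ℝ) 1]
      linarith
    · rw [if_neg hK, add_zero]
      refine ih.trans ?_
      gcongr
      simp

/-- Comparison of the tail of `Σ (1 + n)^{-3/2}` with a telescoping sum. -/
theorem sum_inv_sqrt_pow_le (s : ℝ) (hs : 0 ≤ s) (K : ℕ) :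
    ∑ n ∈ Finset.range K, (if s ≤ (n : ℝ) then ((√(1 + n))⁻¹) ^ 3 else 0) ≤
      4 * ((√(1 + s))⁻¹ - (√(1 + max s K))⁻¹) := by
  induction K with
  | zero => simp [hs]
  | succ K ih =>
    rw [Finset.sum_range_succ]
    by_cases hK : s ≤ (K : ℝ)
    · rw [if_pos hK]
      rw [max_eq_right hK] at ih
      rw [max_eq_right (by push_cast; linarith)]
      have h1 : ((√(1 + (K : ℝ)))⁻¹) ^ 3 ≤
          4 * ((√(1 + (K : ℝ)))⁻¹ - (√(1 + ((K + 1 : ℕ) : ℝ)))⁻¹) := by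
        set a := √(1 + (K : ℝ)) with ha
        set b := √(1 + ((K + 1 : ℕ) : ℝ)) with hb
        have hap : 0 < a := by positivity
        have hbp : 0 < b := by positivity
        have h2 : a ^ 2 = 1 + K := Real.sq_sqrt (by positivity)
        have h3 : b ^ 2 = 1 + (K + 1) := by rw [hb, Real.sq_sqrt (by positivity)]; push_cast; ring
        have h4 : b ^ 2 = a ^ 2 + 1 := by rw [h2, h3]; ring
        have h5 : 1 ≤ a ^ 2 := by rw [h2]; linarith [Nat.cast_nonneg (α := ℝ) K]
        have hba : a < b := by nlinarith
        have h6 : a⁻¹ - b⁻¹ = (b - a) / (a * b) := by field_simp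
        have h8 : b ≤ 2 * a := by nlinarith
        have h9 : b * (b + a) ≤ 4 * a ^ 2 := by nlinarith
        have h7 : (b - a) * (b + a) = 1 := by nlinarith
        rw [h6, ← mul_div_assoc, inv_pow, inv_eq_one_div, div_le_div_iff₀ (by positivity)
          (by positivity), one_mul]
        have h10 : a * b * (b + a) ≤ 4 * (b - a) * a ^ 3 * (b + a) := by
          have : 4 * (b - a) * a ^ 3 * (b + a) = 4 * a ^ 3 := by
            rw [show 4 * (b - a) * a ^ 3 * (b + a) = 4 * a ^ 3 * ((b - a) * (b + a)) by ring, h7,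
              mul_one]
          rw [this]
          nlinarith
        exact le_of_mul_le_mul_right h10 (by positivity)
      linarith
    · rw [if_neg hK, add_zero]
      refine ih.trans ?_
      have : max s (K : ℝ) ≤ max s ((K + 1 : ℕ) : ℝ) := by gcongr; simp
      gcongr

theorem setLIntegral_torusFreqMeasure_le {S : Set ℤ} (hS : ∀ n ∈ S, 0 ≤ n) {h : ℕ → ℝ}
    (h0 : ∀ n, 0 ≤ h n) {B : ℝ} [DecidablePred (· ∈ S)]
    (hB : ∀ K, ∑ n ∈ Finset.range K, (if (n : ℤ) ∈ S then h n else 0) ≤ B)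
    {H : ℤ → ℝ≥0∞} (hH : ∀ n : ℕ, H n = ENNReal.ofReal (h n)) :
    ∫⁻ n in S, H n ∂torusFreqMeasure ≤ ENNReal.ofReal (2 * π) * ENNReal.ofReal B := by
  rw [← lintegral_indicator (by measurability), lintegral_smul_measure, lintegral_count,
    smul_eq_mul]
  gcongr
  have hsupp : Function.support (S.indicator H) ⊆ Set.range ((↑) : ℕ → ℤ) := by
    intro n hn
    have hnS : n ∈ S := by
      by_contra hc
      exact hn (Set.indicator_of_notMem hc _)
    exact ⟨n.toNat, Int.toNat_of_nonneg (hS n hnS)⟩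
  rw [← Function.Injective.tsum_eq Nat.cast_injective hsupp]
  refine ENNReal.tsum_le_of_sum_range_le fun K => ?_
  have h1 : ∀ n : ℕ, S.indicator H (n : ℤ) = ENNReal.ofReal (if (n : ℤ) ∈ S then h n else 0) := by
    intro n
    by_cases hn : (n : ℤ) ∈ S <;> simp [hn, hH]
  simp only [h1]
  rw [← ENNReal.ofReal_sum_of_nonneg fun n _ => by split_ifs <;> simp [h0]]
  exact ENNReal.ofReal_le_ofReal (hB K)

theorem abs_sym_torus (n : ℕ) : |sym .torus (n : ℤ)| = n := by
  simp [sym]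

theorem setOf_sym_line (t : ℝ) : {ξ : ℝ | 0 ≤ sym .line ξ ∧ sym .line ξ ≤ t} =
    Set.Icc 0 (t / (2 * π)) := by
  ext ξ
  simp only [Set.mem_ofPred_eq, Set.mem_Icc, sym]
  rw [le_div_iff₀ (by positivity), mul_comm ξ, mul_nonneg_iff_of_pos_left (by positivity)]

/-- The number of frequencies in `[0, t]`. -/
theorem freqMeasure_le : (g : Geometry) → (t : ℝ) → 0 ≤ t →
    freqMeasure g {ξ | 0 ≤ sym g ξ ∧ sym g ξ ≤ t} ≤
      ENNReal.ofReal ((t + 1) / (2 * π) / convWeight g ^ 2)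
  | .line, t, ht => by
    change volume {ξ : ℝ | 0 ≤ sym .line ξ ∧ sym .line ξ ≤ t} ≤ _
    rw [setOf_sym_line, Real.volume_Icc]
    refine ENNReal.ofReal_le_ofReal ?_
    simp only [convWeight, one_pow, div_one, sub_zero]
    gcongr; linarith
  | .torus, t, ht => by
    classical
    change torusFreqMeasure {n : ℤ | 0 ≤ ((n : ℤ) : ℝ) ∧ (n : ℝ) ≤ t} ≤ _
    have h := setLIntegral_torusFreqMeasure_le (S := {n : ℤ | 0 ≤ ((n : ℤ) : ℝ) ∧ (n : ℝ) ≤ t})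
      (fun n hn => by exact_mod_cast hn.1) (h := fun _ => 1) (fun _ => zero_le_one) (B := t + 1)
      (fun K => by
        rw [← Finset.sum_filter, Finset.sum_const, nsmul_eq_mul, mul_one]
        have h1 : (Finset.range K).filter (fun n : ℕ => (n : ℤ) ∈
            {n : ℤ | 0 ≤ ((n : ℤ) : ℝ) ∧ (n : ℝ) ≤ t}) ⊆ Finset.range (⌊t⌋₊ + 1) := by
          intro n hn
          simp only [Finset.mem_filter, Set.mem_ofPred_eq] at hn
          rw [Finset.mem_range, Nat.lt_succ_iff]
          exact Nat.le_floor (by exact_mod_cast hn.2.2)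
        have h2 := Finset.card_le_card h1
        rw [Finset.card_range] at h2
        have h3 : ((⌊t⌋₊ + 1 : ℕ) : ℝ) ≤ t + 1 := by push_cast; linarith [Nat.floor_le ht]
        exact le_trans (by exact_mod_cast h2) h3)
      (H := fun _ => 1) (fun n => by simp)
    rw [setLIntegral_one] at h
    refine h.trans_eq ?_
    rw [← ENNReal.ofReal_mul (by positivity)]
    congr 1
    simp only [convWeight]
    have := Real.pi_pos.ne'
    field_simp

/-- The first of the two sums in Schur's test for Hardy's inequality. -/
theorem setLIntegral_wt_inv_le : (g : Geometry) → ∃ C : ℝ≥0∞, C ≠ ∞ ∧ ∀ t : ℝ, 0 ≤ t →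
    ∫⁻ ξ in {ξ | 0 ≤ sym g ξ ∧ sym g ξ ≤ t}, (wt g ξ)⁻¹ ∂freqMeasure g ≤
      C * ENNReal.ofReal √(1 + t)
  | .line => by
    refine ⟨1, ENNReal.one_ne_top, fun t ht => ?_⟩
    change ∫⁻ ξ : ℝ in {ξ : ℝ | 0 ≤ sym .line ξ ∧ sym .line ξ ≤ t}, (wt .line ξ)⁻¹ ≤ _
    rw [setOf_sym_line, one_mul, ← setLIntegral_congr Ioc_ae_eq_Icc]
    have hT : 0 ≤ t / (2 * π) := by positivity
    have hd : ∀ ξ ∈ Set.uIcc 0 (t / (2 * π)),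
        HasDerivAt (fun ξ : ℝ => π⁻¹ * √(1 + 2 * π * ξ)) (√(1 + 2 * π * ξ))⁻¹ ξ := by
      intro ξ hξ
      rw [Set.uIcc_of_le hT] at hξ
      have hpos : 0 < 1 + 2 * π * ξ := by
        have := mul_nonneg Real.two_pi_pos.le hξ.1; linarith
      have h1 : HasDerivAt (fun ξ : ℝ => 1 + 2 * π * ξ) (2 * π) ξ := by
        simpa using ((hasDerivAt_id ξ).const_mul (2 * π)).const_add 1
      refine ((h1.sqrt hpos.ne').const_mul π⁻¹).congr_deriv ?_
      have := Real.pi_pos.ne'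
      field_simp
    have hc : ContinuousOn (fun ξ : ℝ => (√(1 + 2 * π * ξ))⁻¹) (Set.uIcc 0 (t / (2 * π))) := by
      refine ContinuousOn.inv₀ (by fun_prop) fun ξ hξ => ?_
      rw [Set.uIcc_of_le hT] at hξ
      have := mul_nonneg Real.two_pi_pos.le hξ.1
      positivity
    have hi := hc.intervalIntegrable (μ := volume)
    have h1 := intervalIntegral.integral_eq_sub_of_hasDerivAt hd hi
    rw [intervalIntegral.integral_of_le hT] at h1
    have h2 : ∫⁻ ξ : ℝ in Set.Ioc 0 (t / (2 * π)), (wt .line ξ)⁻¹ =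
        ∫⁻ ξ : ℝ in Set.Ioc 0 (t / (2 * π)), ENNReal.ofReal (√(1 + 2 * π * ξ))⁻¹ := by
      refine setLIntegral_congr_fun measurableSet_Ioc fun ξ hξ => ?_
      simp only [wt_inv, sym]
      rw [abs_of_nonneg (mul_nonneg Real.two_pi_pos.le hξ.1.le)]
    rw [h2, ← ofReal_integral_eq_lintegral_ofReal
      ((intervalIntegrable_iff_integrableOn_Ioc_of_le hT).1 hi)
      (Eventually.of_forall fun ξ => by positivity), h1]
    refine ENNReal.ofReal_le_ofReal ?_
    have h3 : 2 * π * (t / (2 * π)) = t := by field_simp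
    rw [h3]
    have h4 : π⁻¹ ≤ 1 := inv_le_one_of_one_le₀ (by linarith [Real.pi_gt_three])
    have h5 : 0 ≤ √(1 + t) := by positivity
    have h6 : 0 ≤ π⁻¹ * √(1 + 2 * π * 0) := by positivity
    nlinarith
  | .torus => by
    classical
    refine ⟨ENNReal.ofReal (2 * π) * 2, by finiteness, fun t ht => ?_⟩
    refine (setLIntegral_torusFreqMeasure_le
      (S := {n : ℤ | 0 ≤ ((n : ℤ) : ℝ) ∧ (n : ℝ) ≤ t})
      (fun n hn => by exact_mod_cast hn.1) (h := fun n => (√(1 + n))⁻¹) (fun _ => by positivity)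
      (B := 2 * √(1 + t)) (fun K => ?_) (fun n => ?_)).trans_eq ?_
    · refine le_trans ?_ ((sum_inv_sqrt_le t ht K).trans ?_)
      · refine le_of_eq (Finset.sum_congr rfl fun n _ => ?_)
        simp
      · gcongr
        rw [add_comm 1 t]; exact min_le_right _ _
    · rw [wt_inv, abs_sym_torus]
    · rw [ENNReal.ofReal_mul (p := 2) (q := √(1 + t)) (by norm_num), mul_assoc,
        ENNReal.ofReal_ofNat]

/-- The second of the two sums in Schur's test for Hardy's inequality. -/
theorem setLIntegral_wt_inv_pow_le : (g : Geometry) → ∃ C : ℝ≥0∞, C ≠ ∞ ∧ ∀ s : ℝ, 0 ≤ s →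
    ∫⁻ ξ in {ξ | s ≤ sym g ξ}, ((wt g ξ)⁻¹) ^ 3 ∂freqMeasure g ≤
      C * (ENNReal.ofReal √(1 + s))⁻¹
  | .line => by
    refine ⟨1, ENNReal.one_ne_top, fun s hs => ?_⟩
    have hset : {ξ : ℝ | s ≤ sym .line ξ} = Set.Ici (s / (2 * π)) := by
      ext ξ
      simp only [Set.mem_ofPred_eq, Set.mem_Ici, sym]
      rw [div_le_iff₀ (by positivity), mul_comm ξ]
    change ∫⁻ ξ : ℝ in {ξ : ℝ | s ≤ sym .line ξ}, ((wt .line ξ)⁻¹) ^ 3 ≤ _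
    rw [hset, one_mul, ← setLIntegral_congr Ioi_ae_eq_Ici]
    have hT : 0 ≤ s / (2 * π) := by positivity
    have hp : ∀ ξ ∈ Set.Ici (s / (2 * π)), 0 < 1 + 2 * π * ξ := fun ξ hξ => by
      have := mul_nonneg Real.two_pi_pos.le (hT.trans hξ); linarith
    have hd : ∀ ξ ∈ Set.Ici (s / (2 * π)), HasDerivAt (fun ξ : ℝ => -(π⁻¹ * (√(1 + 2 * π * ξ))⁻¹))
        (((√(1 + 2 * π * ξ))⁻¹) ^ 3) ξ := by
      intro ξ hξ
      have hpos := hp ξ hξ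
      have h1 : HasDerivAt (fun ξ : ℝ => 1 + 2 * π * ξ) (2 * π) ξ := by
        simpa using ((hasDerivAt_id ξ).const_mul (2 * π)).const_add 1
      refine (((h1.sqrt hpos.ne').inv (by positivity)).const_mul π⁻¹).neg.congr_deriv ?_
      have := Real.pi_pos.ne'
      have h2 : √(1 + 2 * π * ξ) ≠ 0 := by positivity
      field_simp
    have ht : Tendsto (fun ξ : ℝ => -(π⁻¹ * (√(1 + 2 * π * ξ))⁻¹)) atTop (𝓝 0) := by
      have h1 : Tendsto (fun ξ : ℝ => 1 + 2 * π * ξ) atTop atTop :=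
        tendsto_atTop_add_const_left _ _ (tendsto_id.const_mul_atTop Real.two_pi_pos)
      have h2 := ((tendsto_inv_atTop_zero.comp (Real.tendsto_sqrt_atTop.comp h1)).const_mul
        π⁻¹).neg
      simpa using h2
    have hnn : ∀ ξ ∈ Set.Ioi (s / (2 * π)), 0 ≤ ((√(1 + 2 * π * ξ))⁻¹) ^ 3 := fun ξ _ => by
      positivity
    have hi := integrableOn_Ioi_deriv_of_nonneg' hd hnn ht
    have h1 := integral_Ioi_of_hasDerivAt_of_nonneg' hd hnn ht
    have h2 : ∫⁻ ξ : ℝ in Set.Ioi (s / (2 * π)), ((wt .line ξ)⁻¹) ^ 3 =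
        ∫⁻ ξ : ℝ in Set.Ioi (s / (2 * π)), ENNReal.ofReal (((√(1 + 2 * π * ξ))⁻¹) ^ 3) := by
      refine setLIntegral_congr_fun measurableSet_Ioi fun ξ hξ => ?_
      simp only [wt_inv, sym]
      rw [abs_of_nonneg (mul_nonneg Real.two_pi_pos.le (hT.trans (le_of_lt hξ))),
        ENNReal.ofReal_pow (by positivity)]
    rw [h2, ← ofReal_integral_eq_lintegral_ofReal hi
      (Eventually.of_forall fun ξ => by positivity), h1,
      ← ENNReal.ofReal_inv_of_pos (by positivity)]
    refine ENNReal.ofReal_le_ofReal ?_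
    have h3 : 2 * π * (s / (2 * π)) = s := by field_simp
    rw [h3]
    have h4 : π⁻¹ ≤ 1 := inv_le_one_of_one_le₀ (by linarith [Real.pi_gt_three])
    have h5 : 0 ≤ (√(1 + s))⁻¹ := by positivity
    nlinarith
  | .torus => by
    classical
    refine ⟨ENNReal.ofReal (2 * π) * 4, by finiteness, fun s hs => ?_⟩
    refine (setLIntegral_torusFreqMeasure_le
      (S := {n : ℤ | s ≤ ((n : ℤ) : ℝ)})
      (fun n hn => by
        have : (0 : ℝ) ≤ n := hs.trans hn
        exact_mod_cast this) (h := fun n => ((√(1 + n))⁻¹) ^ 3) (fun _ => by positivity)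
      (B := 4 * (√(1 + s))⁻¹) (fun K => ?_) (fun n => ?_)).trans_eq ?_
    · refine le_trans ?_ ((sum_inv_sqrt_pow_le s hs K).trans ?_)
      · refine le_of_eq (Finset.sum_congr rfl fun n _ => ?_)
        simp
      · have : 0 ≤ (√(1 + max s K))⁻¹ := by positivity
        linarith
    · rw [wt_inv, abs_sym_torus, ENNReal.ofReal_pow (by positivity)]
    · rw [ENNReal.ofReal_mul (p := 4) (by norm_num), mul_assoc, ENNReal.ofReal_ofNat,
        ENNReal.ofReal_inv_of_pos (by positivity)]

theorem lintegral_wt_inv_pow_lt_top : (g : Geometry) →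
    ∫⁻ ξ, ((wt g ξ)⁻¹) ^ 4 ∂freqMeasure g < ∞
  | .line => by
    have h1 : Integrable (fun ξ : ℝ => (1 + ‖ξ‖) ^ (-(2 : ℝ))) :=
      integrable_one_add_norm (by simp)
    refine lt_of_le_of_lt ?_ h1.lintegral_lt_top
    change ∫⁻ ξ : ℝ, ((wt .line ξ)⁻¹) ^ 4 ≤ _
    refine lintegral_mono fun ξ => ?_
    rw [wt_inv, ← ENNReal.ofReal_pow (by positivity)]
    refine ENNReal.ofReal_le_ofReal ?_
    rw [Real.rpow_neg (by positivity), inv_pow, show (4 : ℕ) = 2 * 2 by rfl, pow_mul,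
      Real.sq_sqrt (by positivity), Real.rpow_ofNat]
    gcongr
    simp only [sym]
    rw [abs_mul, Real.norm_eq_abs, abs_of_pos Real.two_pi_pos]
    nlinarith [abs_nonneg ξ, Real.pi_gt_three]
  | .torus => by
    have hs : Summable fun n : ℤ => ((1 + |(n : ℝ)|) ^ 2)⁻¹ := by
      have h1 : Summable fun n : ℕ => ((1 + (n : ℝ)) ^ 2)⁻¹ := by
        have h := (summable_nat_add_iff 1).2 (Real.summable_nat_pow_inv (p := 2) |>.2 (by norm_num))
        refine h.congr fun n => ?_
        push_cast; rw [add_comm]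
      refine Summable.of_nat_of_neg ?_ ?_
      · simpa using h1
      · simpa using h1
    change ∫⁻ n, ((wt .torus n)⁻¹) ^ 4 ∂torusFreqMeasure < ∞
    have h2 : ∀ n : ℤ, ((wt .torus n)⁻¹) ^ 4 = ENNReal.ofReal ((1 + |(n : ℝ)|) ^ 2)⁻¹ := fun n => by
      rw [wt_inv, ← ENNReal.ofReal_pow (by positivity), inv_pow, show (4 : ℕ) = 2 * 2 by rfl,
        pow_mul, Real.sq_sqrt (by positivity)]
      rfl
    simp only [h2]
    rw [lintegral_smul_measure, lintegral_count, smul_eq_mul]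
    exact ENNReal.mul_lt_top ENNReal.ofReal_lt_top hs.tsum_ofReal_lt_top

/-! ### Fourier side of the Hardy space -/

theorem lintegral_mul_sq_le {α : Type*} [MeasurableSpace α] {μ : Measure α} {F G : α → ℝ≥0∞}
    (hF : AEMeasurable F μ) (hG : AEMeasurable G μ) :
    (∫⁻ a, F a * G a ∂μ) ^ 2 ≤ (∫⁻ a, F a ^ 2 ∂μ) * ∫⁻ a, G a ^ 2 ∂μ := by
  have h := ENNReal.lintegral_mul_le_Lp_mul_Lq μ Real.HolderConjugate.two_two hF hG
  simp only [Pi.mul_apply, ENNReal.rpow_ofNat] at h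
  refine (pow_le_pow_left₀ zero_le h 2).trans_eq ?_
  rw [mul_pow, ← ENNReal.rpow_natCast, ← ENNReal.rpow_natCast, ← ENNReal.rpow_mul,
    ← ENNReal.rpow_mul]
  norm_num

theorem lintegral_enorm_fhat_sq (f : L2 g) :
    ∫⁻ ξ, ‖fhat g f ξ‖ₑ ^ 2 ∂freqMeasure g = ENNReal.ofReal (‖f‖ ^ 2) := by
  have h1 := inner_eq_integral_fhat f f
  have h2 : ∀ ξ, conj (fhat g f ξ) * fhat g f ξ = ((‖fhat g f ξ‖ ^ 2 : ℝ) : ℂ) := fun ξ => by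
    rw [Complex.conj_mul']; push_cast; rfl
  simp only [h2] at h1
  rw [integral_complex_ofReal, inner_self_eq_norm_sq_to_K] at h1
  have h3 : ‖f‖ ^ 2 = ∫ ξ, ‖fhat g f ξ‖ ^ 2 ∂freqMeasure g :=
    Complex.ofReal_injective ((Complex.ofReal_pow _ _).trans h1)
  rw [h3, ofReal_integral_eq_lintegral_ofReal
    ((memLp_two_iff_integrable_sq_norm (memLp_fhat f).1).1 (memLp_fhat f))
    (Eventually.of_forall fun ξ => by positivity)]
  refine lintegral_congr fun ξ => ?_
  rw [ENNReal.ofReal_pow (norm_nonneg _), ofReal_norm]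

theorem eq_of_fhat_ae_eq {f h : L2 g} (hfh : fhat g f =ᵐ[freqMeasure g] fhat g h) : f = h := by
  have h1 := lintegral_enorm_fhat_sq (f - h)
  have h2 : ∫⁻ ξ, ‖fhat g (f - h) ξ‖ₑ ^ 2 ∂freqMeasure g = 0 := by
    rw [lintegral_eq_zero_iff ((measurable_fhat _).enorm.pow_const 2)]
    filter_upwards [fhat_sub f h, hfh] with ξ h3 h4
    rw [h3, h4]; simp
  rw [h2] at h1
  have h3 := ENNReal.ofReal_eq_zero.1 h1.symm
  have h4 : ‖f - h‖ = 0 := by nlinarith [norm_nonneg (f - h)]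
  exact sub_eq_zero.1 (norm_eq_zero.1 h4)

theorem mem_hardy_iff {f : L2 g} :
    f ∈ hardy g ↔ ∀ᵐ ξ ∂freqMeasure g, sym g ξ < 0 → fhat g f ξ = 0 :=
  mem_hardy.trans noNegFreq_iff

theorem Hardy.fhat_eq_zero (f : Hardy g) :
    ∀ᵐ ξ ∂freqMeasure g, sym g ξ < 0 → fhat g f ξ = 0 := mem_hardy_iff.1 f.2

theorem inner_szego_left (F : L2 g) (h : Hardy g) : ⟪szego g F, h⟫_ℂ = ⟪F, (h : L2 g)⟫_ℂ := by
  rw [szego]; exact Submodule.inner_orthogonalProjectionOnto_eq_of_mem_right h F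

theorem inner_szego_right (F : L2 g) (h : Hardy g) : ⟪h, szego g F⟫_ℂ = ⟪(h : L2 g), F⟫_ℂ := by
  rw [szego]; exact Submodule.inner_orthogonalProjectionOnto_eq_of_mem_left h F

theorem measurableSet_sym_nonneg (g : Geometry) : MeasurableSet {ξ | 0 ≤ sym g ξ} :=
  measurableSet_le measurable_const (measurable_sym g)

/-- On the Fourier side, `C₊` restricts to the nonnegative frequencies. -/
theorem fhat_szego (F : L2 g) : ∀ᵐ ξ ∂freqMeasure g,
    fhat g (szego g F : L2 g) ξ = {ξ | 0 ≤ sym g ξ}.indicator (fhat g F) ξ := by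
  obtain ⟨P, hP⟩ := exists_fhat ((memLp_fhat F).indicator (measurableSet_sym_nonneg g))
  have hPm : P ∈ hardy g := by
    refine mem_hardy_iff.2 ?_
    filter_upwards [hP] with ξ h1 h2
    rw [h1, Set.indicator_of_notMem (by simpa using h2)]
  have h1 : (szego g F : L2 g) = P := by
    have h2 : szego g F = ⟨P, hPm⟩ := by
      refine ext_inner_left ℂ fun h => ?_
      rw [inner_szego_right, Submodule.coe_inner, inner_eq_integral_fhat, inner_eq_integral_fhat]
      refine integral_congr_ae ?_
      filter_upwards [hP, h.fhat_eq_zero] with ξ h3 h4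
      by_cases h5 : 0 ≤ sym g ξ
      · rw [h3, Set.indicator_of_mem (by exact h5)]
      · rw [h4 (not_le.1 h5)]; simp
    rw [h2]
  rw [h1]; exact hP

theorem coeFn_toL2 {f : g.Space → ℂ} (hf : MemLp f 2 volume) : toL2 g f =ᵐ[volume] f := by
  rw [toL2, dif_pos hf]; exact hf.coeFn_toLp

/-- An essentially bounded function. -/
def EssBdd (u : g.Space → ℂ) : Prop := ∃ C : ℝ, ∀ᵐ x : g.Space, ‖u x‖ ≤ C

theorem memLp_mul_of_bdd {b u : g.Space → ℂ} (hb : MemLp b 2 volume)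
    (hu : AEStronglyMeasurable u volume) (h : EssBdd u) : MemLp (fun x => b x * u x) 2 volume := by
  obtain ⟨C, hC⟩ := h
  have h2 := hb.norm.const_mul C
  refine h2.mono (hb.1.mul hu) ?_
  filter_upwards [hC] with x hx
  rw [norm_mul, norm_mul, norm_norm, mul_comm]
  exact mul_le_mul_of_nonneg_right (hx.trans (le_abs_self C)) (norm_nonneg _)

theorem L2.memLp (f : L2 g) : MemLp (f : g.Space → ℂ) 2 volume := Lp.memLp f

theorem L2.memLp_conj (f : L2 g) : MemLp (fun x => conj ((f : g.Space → ℂ) x)) 2 volume :=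
  (Lp.memLp f).star

theorem L2.meas (f : L2 g) : AEStronglyMeasurable (f : g.Space → ℂ) volume :=
  Lp.aestronglyMeasurable f

theorem memLp_conj_mul_left {b u : L2 g} (h : EssBdd (u : g.Space → ℂ)) :
    MemLp (fun x => conj (b x) * u x) 2 volume :=
  memLp_mul_of_bdd (L2.memLp_conj b) (L2.meas u) h

theorem EssBdd.conj {u : g.Space → ℂ} (h : EssBdd u) : EssBdd (fun x => conj (u x)) :=
  h.imp fun C hC => hC.mono fun x hx => by rwa [RCLike.norm_conj]

theorem memLp_conj_mul_right {b u : L2 g} (h : EssBdd (b : g.Space → ℂ)) :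
    MemLp (fun x => conj (b x) * u x) 2 volume := by
  have h1 := memLp_mul_of_bdd (L2.memLp u) (L2.memLp_conj b).1 h.conj
  simpa only [mul_comm] using h1

/-- The anti-analytic Toeplitz operator `f ↦ C₊(b̄ f)`. -/
def toep (b f : L2 g) : Hardy g := szego g (toL2 g fun x => conj (b x) * f x)

theorem inner_toep_left {b f : L2 g} (hm : MemLp (fun x => conj (b x) * f x) 2 volume)
    (h : Hardy g) : ⟪toep b f, h⟫_ℂ = ∫ x, conj (conj (b x) * f x) * (h : L2 g) x := by
  rw [toep, inner_szego_left, L2.inner_def]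
  refine integral_congr_ae ?_
  filter_upwards [coeFn_toL2 hm] with x hx
  rw [hx, RCLike.inner_apply, mul_comm]

theorem inner_toep_right {b f : L2 g} (hm : MemLp (fun x => conj (b x) * f x) 2 volume)
    (h : Hardy g) : ⟪h, toep b f⟫_ℂ = ∫ x, conj ((h : L2 g) x) * (conj (b x) * f x) := by
  rw [toep, inner_szego_right, L2.inner_def]
  refine integral_congr_ae ?_
  filter_upwards [coeFn_toL2 hm] with x hx
  rw [hx, RCLike.inner_apply, mul_comm]

theorem inner_eq_integral (f h : L2 g) : ⟪f, h⟫_ℂ = ∫ x, conj (f x) * h x := by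
  rw [L2.inner_def]
  refine integral_congr_ae (Eventually.of_forall fun x => ?_)
  simp only [RCLike.inner_apply, mul_comm]

theorem fhat_toep {b f : L2 g} (hm : MemLp (fun x => conj (b x) * f x) 2 volume) :
    ∀ᵐ ξ ∂freqMeasure g, fhat g (toep b f : L2 g) ξ = {ξ | 0 ≤ sym g ξ}.indicator
      (fun ξ => convWeight g * ∫ η, conj (fhat g b η) * fhat g f (η + ξ) ∂freqMeasure g) ξ := by
  filter_upwards [fhat_szego (toL2 g fun x => conj (b x) * f x),
    fhat_conj_mul (coeFn_toL2 hm)] with ξ h1 h2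
  rw [toep, h1]
  by_cases h : 0 ≤ sym g ξ
  · rw [Set.indicator_of_mem (by exact h), Set.indicator_of_mem (by exact h), h2]
  · rw [Set.indicator_of_notMem (by exact h), Set.indicator_of_notMem (by exact h)]

/-! ### Estimates for anti-analytic Toeplitz operators -/

/-- Tonelli's theorem on the region `0 ≤ η ≤ ζ`. -/
theorem lintegral_triangle {b F : g.Freq → ℝ≥0∞} (hb : Measurable b) (hF : Measurable F) :
    ∫⁻ η in {η | 0 ≤ sym g η}, b η * ∫⁻ ζ in {ζ | sym g η ≤ sym g ζ}, F ζ
        ∂freqMeasure g ∂freqMeasure g =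
      ∫⁻ ζ, F ζ * ∫⁻ η in {η | 0 ≤ sym g η ∧ sym g η ≤ sym g ζ}, b η
        ∂freqMeasure g ∂freqMeasure g := by
  have hP := measurableSet_sym_nonneg g
  have hle : MeasurableSet {z : g.Freq × g.Freq | 0 ≤ sym g z.1 ∧ sym g z.1 ≤ sym g z.2} :=
    (measurableSet_le measurable_const ((measurable_sym g).comp measurable_fst)).inter
      (measurableSet_le ((measurable_sym g).comp measurable_fst)
        ((measurable_sym g).comp measurable_snd))
  rw [← lintegral_indicator hP]
  have h2 : ∀ η, {η | 0 ≤ sym g η}.indicator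
      (fun η => b η * ∫⁻ ζ in {ζ | sym g η ≤ sym g ζ}, F ζ ∂freqMeasure g) η =
      ∫⁻ ζ, {z : g.Freq × g.Freq | 0 ≤ sym g z.1 ∧ sym g z.1 ≤ sym g z.2}.indicator
        (fun z => b z.1 * F z.2) (η, ζ) ∂freqMeasure g := by
    intro η
    have hη : MeasurableSet {ζ | sym g η ≤ sym g ζ} :=
      measurableSet_le measurable_const (measurable_sym g)
    by_cases h : 0 ≤ sym g η
    · rw [Set.indicator_of_mem (by exact h), ← lintegral_indicator hη,
        ← lintegral_const_mul _ (hF.indicator hη)]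
      refine lintegral_congr fun ζ => ?_
      by_cases h' : sym g η ≤ sym g ζ
      · rw [Set.indicator_of_mem (by exact h'), Set.indicator_of_mem (by exact ⟨h, h'⟩)]
      · rw [Set.indicator_of_notMem (by exact h'), mul_zero,
          Set.indicator_of_notMem (by exact fun hc => h' hc.2)]
    · rw [Set.indicator_of_notMem (by exact h), ← lintegral_zero]
      refine lintegral_congr fun ζ => ?_
      rw [Set.indicator_of_notMem (by exact fun hc => h hc.1)]
  simp only [h2]
  rw [lintegral_lintegral_swap]
  · refine lintegral_congr fun ζ => ?_
    have hζ : MeasurableSet {η | 0 ≤ sym g η ∧ sym g η ≤ sym g ζ} :=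
      hP.inter (measurableSet_le (measurable_sym g) measurable_const)
    rw [← lintegral_indicator hζ, ← lintegral_const_mul _ (hb.indicator hζ)]
    refine lintegral_congr fun η => ?_
    by_cases h : 0 ≤ sym g η ∧ sym g η ≤ sym g ζ
    · rw [Set.indicator_of_mem (by exact h), Set.indicator_of_mem (by exact h), mul_comm]
    · rw [Set.indicator_of_notMem (by exact h), Set.indicator_of_notMem (by exact h), mul_zero]
  · exact (((hb.comp measurable_fst).mul (hF.comp measurable_snd)).indicator hle).aemeasurable

/-- Tonelli's theorem, in the form used to bound correlations of functions on the positive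
frequencies. -/
theorem lintegral_correlation {b F : g.Freq → ℝ≥0∞} (hb : Measurable b) (hF : Measurable F) :
    ∫⁻ ξ in {ξ | 0 ≤ sym g ξ}, ∫⁻ η in {η | 0 ≤ sym g η}, b η * F (η + ξ)
        ∂freqMeasure g ∂freqMeasure g =
      ∫⁻ ζ, F ζ * ∫⁻ η in {η | 0 ≤ sym g η ∧ sym g η ≤ sym g ζ}, b η
        ∂freqMeasure g ∂freqMeasure g := by
  have hP := measurableSet_sym_nonneg g
  rw [lintegral_lintegral_swap ((hb.comp measurable_snd).mul
    (hF.comp (measurable_snd.add measurable_fst))).aemeasurable, ← lintegral_triangle hb hF]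
  refine setLIntegral_congr_fun hP fun η hη => ?_
  have hη' : MeasurableSet {ζ | sym g η ≤ sym g ζ} :=
    measurableSet_le measurable_const (measurable_sym g)
  have hFη : Measurable fun ξ => F (η + ξ) := hF.comp (measurable_const_add η)
  rw [lintegral_const_mul _ hFη, ← lintegral_indicator hP,
    ← lintegral_indicator hη', ← lintegral_add_left_eq_self
      ({ζ | sym g η ≤ sym g ζ}.indicator F) η]
  congr 1
  refine lintegral_congr fun ξ => ?_
  by_cases h : 0 ≤ sym g ξ
  · rw [Set.indicator_of_mem (by exact h), Set.indicator_of_mem (by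
      rw [Set.mem_ofPred_eq, sym_add]; linarith)]
  · rw [Set.indicator_of_notMem (by exact h), Set.indicator_of_notMem (by
      rw [Set.mem_ofPred_eq, sym_add]; linarith)]

theorem wt_of_nonneg {ξ : g.Freq} (h : 0 ≤ sym g ξ) : wt g ξ = ENNReal.ofReal √(1 + sym g ξ) := by
  rw [wt, abs_of_nonneg h]

/-- Hardy's inequality on the positive frequencies, by Schur's test. -/
theorem exists_hardy_inequality (g : Geometry) : ∃ C : ℝ≥0∞, C ≠ ∞ ∧
    ∀ b : g.Freq → ℝ≥0∞, Measurable b →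
      ∫⁻ ζ in {ζ | 0 ≤ sym g ζ}, ((wt g ζ)⁻¹) ^ 4 *
        (∫⁻ η in {η | 0 ≤ sym g η ∧ sym g η ≤ sym g ζ}, b η ∂freqMeasure g) ^ 2 ∂freqMeasure g ≤
      C * ∫⁻ η, b η ^ 2 ∂freqMeasure g := by
  obtain ⟨C₁, hC₁, h₁⟩ := setLIntegral_wt_inv_le g
  obtain ⟨C₂, hC₂, h₂⟩ := setLIntegral_wt_inv_pow_le g
  refine ⟨C₁ * C₂, by finiteness, fun b hb => ?_⟩
  have hP := measurableSet_sym_nonneg g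
  have hw := measurable_wt g
  set V : g.Freq → ℝ≥0∞ := fun ξ => wt g ξ ^ (1 / 2 : ℝ) with hV
  have hVm : Measurable V := hw.pow_const _
  have hV2 : ∀ ξ, V ξ ^ 2 = wt g ξ := fun ξ => by
    rw [hV, ← ENNReal.rpow_natCast, ← ENNReal.rpow_mul]; norm_num
  have hV0 : ∀ ξ, V ξ ≠ 0 := fun ξ h => wt_ne_zero ξ (by rw [← hV2, h]; simp)
  have hVt : ∀ ξ, V ξ ≠ ∞ := fun ξ h => wt_ne_top ξ (by rw [← hV2, h]; simp)
  have hcs : ∀ ζ ∈ {ζ | 0 ≤ sym g ζ},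
      (∫⁻ η in {η | 0 ≤ sym g η ∧ sym g η ≤ sym g ζ}, b η ∂freqMeasure g) ^ 2 ≤
      C₁ * wt g ζ * ∫⁻ η in {η | 0 ≤ sym g η ∧ sym g η ≤ sym g ζ}, b η ^ 2 * wt g η
        ∂freqMeasure g := by
    intro ζ hζ
    have h := lintegral_mul_sq_le (μ := (freqMeasure g).restrict
      {η | 0 ≤ sym g η ∧ sym g η ≤ sym g ζ}) (hb.mul hVm).aemeasurable hVm.inv.aemeasurable
    simp only [Pi.mul_apply, Pi.inv_apply, mul_assoc, ENNReal.mul_inv_cancel (hV0 _) (hVt _),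
      mul_one, mul_pow, hV2] at h
    refine h.trans ?_
    rw [mul_comm]
    gcongr
    simp only [← ENNReal.inv_pow, hV2]
    rw [wt_of_nonneg hζ]
    exact h₁ _ hζ
  have hb2 : Measurable fun η => b η ^ 2 * wt g η := (hb.pow_const 2).mul hw
  calc _ ≤ ∫⁻ ζ in {ζ | 0 ≤ sym g ζ}, C₁ * (((wt g ζ)⁻¹) ^ 3 *
        ∫⁻ η in {η | 0 ≤ sym g η ∧ sym g η ≤ sym g ζ}, b η ^ 2 * wt g η
          ∂freqMeasure g) ∂freqMeasure g := by
        refine setLIntegral_mono' hP fun ζ hζ => ?_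
        refine (mul_le_mul_right (hcs ζ hζ) _).trans_eq ?_
        rw [pow_succ, mul_comm C₁ (wt g ζ)]
        simp only [mul_assoc]
        rw [← mul_assoc (wt g ζ)⁻¹ (wt g ζ), ENNReal.inv_mul_cancel (wt_ne_zero ζ) (wt_ne_top ζ),
          one_mul, mul_left_comm]
    _ ≤ C₁ * ∫⁻ ζ, ((wt g ζ)⁻¹) ^ 3 *
        ∫⁻ η in {η | 0 ≤ sym g η ∧ sym g η ≤ sym g ζ}, b η ^ 2 * wt g η
          ∂freqMeasure g ∂freqMeasure g := by
        rw [lintegral_const_mul' _ _ hC₁]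
        gcongr
        exact Measure.restrict_le_self
    _ = C₁ * ∫⁻ η in {η | 0 ≤ sym g η}, (b η ^ 2 * wt g η) *
        ∫⁻ ζ in {ζ | sym g η ≤ sym g ζ}, ((wt g ζ)⁻¹) ^ 3 ∂freqMeasure g ∂freqMeasure g := by
        rw [lintegral_triangle (F := fun ζ => (wt g ζ)⁻¹ ^ 3) hb2 (hw.inv.pow_const 3)]
    _ ≤ C₁ * ∫⁻ η in {η | 0 ≤ sym g η}, C₂ * b η ^ 2 ∂freqMeasure g := by
        gcongr C₁ * ?_
        refine setLIntegral_mono' hP fun η hη => ?_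
        refine (mul_le_mul_right (h₂ _ hη) _).trans_eq ?_
        rw [← wt_of_nonneg hη, mul_left_comm, mul_assoc, ENNReal.mul_inv_cancel (wt_ne_zero η)
          (wt_ne_top η), mul_one]
    _ ≤ C₁ * C₂ * ∫⁻ η, b η ^ 2 ∂freqMeasure g := by
        rw [lintegral_const_mul' _ _ hC₂, ← mul_assoc]
        gcongr
        exact Measure.restrict_le_self

/-- The Fourier transform of an `H¹` function is weighted square integrable. -/
theorem lintegral_wt_fhat_le {u p : L2 g} (hup : IsMomentum g u p) :
    ∫⁻ ξ, (wt g ξ ^ 2 * ‖fhat g u ξ‖ₑ) ^ 2 ∂freqMeasure g ≤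
      ENNReal.ofReal (2 * (‖u‖ ^ 2 + ‖p‖ ^ 2)) := by
  have h1 : ∀ᵐ ξ ∂freqMeasure g, (wt g ξ ^ 2 * ‖fhat g u ξ‖ₑ) ^ 2 ≤
      2 * ‖fhat g u ξ‖ₑ ^ 2 + 2 * ‖fhat g p ξ‖ₑ ^ 2 := by
    filter_upwards [isMomentum_iff.1 hup] with ξ h2
    rw [h2, wt, ← ENNReal.ofReal_pow (by positivity), Real.sq_sqrt (by positivity)]
    simp only [← ofReal_norm]
    rw [← ENNReal.ofReal_mul (by positivity), ← ENNReal.ofReal_pow (by positivity),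
      ← ENNReal.ofReal_pow (by positivity), ← ENNReal.ofReal_pow (by positivity),
      ← ENNReal.ofReal_ofNat 2, ← ENNReal.ofReal_mul (by positivity),
      ← ENNReal.ofReal_mul (by positivity), ← ENNReal.ofReal_add (by positivity) (by positivity)]
    refine ENNReal.ofReal_le_ofReal ?_
    rw [norm_mul, Complex.norm_real, Real.norm_eq_abs]
    nlinarith [sq_nonneg (‖fhat g u ξ‖ - |sym g ξ| * ‖fhat g u ξ‖)]
  refine (lintegral_mono_ae h1).trans_eq ?_
  have hm : ∀ f : L2 g, Measurable fun ξ => ‖fhat g f ξ‖ₑ ^ 2 := fun f =>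
    (measurable_fhat f).enorm.pow_const 2
  rw [lintegral_add_left ((hm u).const_mul 2), lintegral_const_mul _ (hm u),
    lintegral_const_mul _ (hm p), lintegral_enorm_fhat_sq, lintegral_enorm_fhat_sq,
    ENNReal.ofReal_mul (p := 2) (by positivity), ENNReal.ofReal_add (by positivity) (by positivity),
    mul_add, ENNReal.ofReal_ofNat]

/-- An `H¹` function has an integrable Fourier transform. -/
theorem exists_lintegral_fhat_le (g : Geometry) : ∃ C : ℝ, 0 ≤ C ∧ ∀ u p : L2 g,
    IsMomentum g u p →
      ∫⁻ ξ, ‖fhat g u ξ‖ₑ ∂freqMeasure g ≤ ENNReal.ofReal (C * (‖u‖ + ‖p‖)) := by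
  set A := ∫⁻ ξ, ((wt g ξ)⁻¹) ^ 4 ∂freqMeasure g with hA
  have hAt : A ≠ ∞ := (lintegral_wt_inv_pow_lt_top g).ne
  refine ⟨√(2 * A.toReal), by positivity, fun u p hup => ?_⟩
  have hw := measurable_wt g
  have h := lintegral_mul_sq_le (μ := freqMeasure g) (hw.inv.pow_const 2).aemeasurable
    ((hw.pow_const 2).mul (measurable_fhat u).enorm).aemeasurable
  have h1 : ∀ ξ, ((wt g)⁻¹ ξ) ^ 2 * ((fun x => wt g x ^ 2) * fun a => ‖fhat g u a‖ₑ) ξ =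
      ‖fhat g u ξ‖ₑ := fun ξ => by
    simp only [Pi.mul_apply, Pi.inv_apply]
    rw [← mul_assoc, ← mul_pow, ENNReal.inv_mul_cancel (wt_ne_zero ξ) (wt_ne_top ξ), one_pow,
      one_mul]
  simp only [h1] at h
  have h2 : ∫⁻ a, (((wt g)⁻¹ a) ^ 2) ^ 2 ∂freqMeasure g = A := by
    rw [hA]; refine lintegral_congr fun ξ => ?_
    rw [← pow_mul]; rfl
  rw [h2] at h
  have h3 : (∫⁻ ξ, ‖fhat g u ξ‖ₑ ∂freqMeasure g) ^ 2 ≤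
      (ENNReal.ofReal (√(2 * A.toReal) * (‖u‖ + ‖p‖))) ^ 2 := by
    refine (h.trans (mul_le_mul_right (lintegral_wt_fhat_le hup) _)).trans ?_
    rw [← ENNReal.ofReal_toReal hAt, ← ENNReal.ofReal_mul (by positivity),
      ← ENNReal.ofReal_pow (by positivity), ENNReal.toReal_ofReal (by positivity)]
    refine ENNReal.ofReal_le_ofReal ?_
    rw [mul_pow, Real.sq_sqrt (by positivity)]
    have : 0 ≤ A.toReal * (‖u‖ * ‖p‖) := by positivity
    nlinarith
  exact (ENNReal.pow_le_pow_left_iff two_ne_zero).1 h3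

theorem integrable_fhat {u p : L2 g} (hup : IsMomentum g u p) :
    Integrable (fhat g u) (freqMeasure g) := by
  obtain ⟨C, -, h⟩ := exists_lintegral_fhat_le g
  exact ⟨(measurable_fhat u).aestronglyMeasurable, (h u p hup).trans_lt ENNReal.ofReal_lt_top⟩

theorem norm_le_of_lintegral_fhat_le {f : L2 g} {B : ℝ} (hB : 0 ≤ B)
    (h : ∫⁻ ξ, ‖fhat g f ξ‖ₑ ∂freqMeasure g ≤ ENNReal.ofReal B) :
    ∀ᵐ x : g.Space, ‖f x‖ ≤ convWeight g * B := by
  have hi : Integrable (fhat g f) (freqMeasure g) :=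
    ⟨(measurable_fhat f).aestronglyMeasurable, h.trans_lt ENNReal.ofReal_lt_top⟩
  filter_upwards [norm_le_integral_fhat hi] with x hx
  refine hx.trans (mul_le_mul_of_nonneg_left ?_ (convWeight_pos g).le)
  rw [integral_norm_eq_lintegral_enorm hi.1]
  exact ENNReal.toReal_le_of_le_ofReal hB h

/-- `H¹` functions are bounded. -/
theorem exists_norm_le_of_isMomentum (g : Geometry) : ∃ C : ℝ, 0 ≤ C ∧ ∀ u p : L2 g,
    IsMomentum g u p → ∀ᵐ x : g.Space, ‖u x‖ ≤ C * (‖u‖ + ‖p‖) := by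
  obtain ⟨C, hC, h⟩ := exists_lintegral_fhat_le g
  have hc := (convWeight_pos g).le
  refine ⟨convWeight g * C, by positivity, fun u p hup => ?_⟩
  rw [mul_assoc]
  exact norm_le_of_lintegral_fhat_le (by positivity) (h u p hup)

theorem essBdd_of_isMomentum {u p : L2 g} (hup : IsMomentum g u p) :
    EssBdd (u : g.Space → ℂ) := by
  obtain ⟨C, -, h⟩ := exists_norm_le_of_isMomentum g
  exact ⟨_, h u p hup⟩

theorem enorm_fhat_toep_le {b f : Hardy g}
    (hm : MemLp (fun x => conj ((b : L2 g) x) * (f : L2 g) x) 2 volume) :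
    ∀ᵐ ξ ∂freqMeasure g, ‖fhat g (toep (g := g) b f : L2 g) ξ‖ₑ ≤ {ξ | 0 ≤ sym g ξ}.indicator
      (fun ξ => ENNReal.ofReal (convWeight g) * ∫⁻ η in {η | 0 ≤ sym g η},
        ‖fhat g b η‖ₑ * ‖fhat g f (η + ξ)‖ₑ ∂freqMeasure g) ξ := by
  filter_upwards [fhat_toep hm] with ξ h1
  rw [h1]
  by_cases h : 0 ≤ sym g ξ
  · rw [Set.indicator_of_mem (by exact h), Set.indicator_of_mem (by exact h), enorm_mul,
      ← ofReal_norm, Complex.norm_real, Real.norm_eq_abs, abs_of_pos (convWeight_pos g)]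
    gcongr
    refine (enorm_integral_le_lintegral_enorm _).trans ?_
    rw [← lintegral_indicator (measurableSet_sym_nonneg g)]
    refine lintegral_mono_ae ?_
    filter_upwards [b.fhat_eq_zero] with η hη
    by_cases h' : 0 ≤ sym g η
    · rw [Set.indicator_of_mem (by exact h'), enorm_mul, RCLike.enorm_conj]
    · rw [hη (not_le.1 h')]; simp
  · rw [Set.indicator_of_notMem (by exact h)]; simp

/-- `C₊(b̄ u)` is bounded when `b` lies in the Hardy space and `u` in `H¹₊`: the failing endpoint
Sobolev embedding is rescued by Hardy's inequality. -/
theorem exists_norm_toep_le (g : Geometry) : ∃ C : ℝ, 0 ≤ C ∧ ∀ b u : Hardy g, ∀ p : L2 g,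
    IsMomentum g u p →
      ∀ᵐ x : g.Space, ‖(toep (g := g) b u : L2 g) x‖ ≤ C * (‖b‖ * (‖u‖ + ‖p‖)) := by
  obtain ⟨A, hA, hardyIneq⟩ := exists_hardy_inequality g
  have hc := (convWeight_pos g).le
  refine ⟨convWeight g * (convWeight g * √(2 * A.toReal)), by positivity, fun b u p hup => ?_⟩
  have hw := measurable_wt g
  have hP := measurableSet_sym_nonneg g
  have hm := memLp_conj_mul_left (b := (b : L2 g)) (essBdd_of_isMomentum hup)
  set B : g.Freq → ℝ≥0∞ := fun ζ => ∫⁻ η in {η | 0 ≤ sym g η ∧ sym g η ≤ sym g ζ},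
    ‖fhat g b η‖ₑ ∂freqMeasure g with hB
  have hle : MeasurableSet {z : g.Freq × g.Freq | 0 ≤ sym g z.2 ∧ sym g z.2 ≤ sym g z.1} :=
    (measurableSet_le measurable_const ((measurable_sym g).comp measurable_snd)).inter
      (measurableSet_le ((measurable_sym g).comp measurable_snd)
        ((measurable_sym g).comp measurable_fst))
  have hBm : Measurable B := by
    have h := (((measurable_fhat (b : L2 g)).enorm.comp measurable_snd).indicator
      hle).lintegral_prod_right' (ν := freqMeasure g)
    convert h using 2 with ζ
    have hζ : MeasurableSet {η | 0 ≤ sym g η ∧ sym g η ≤ sym g ζ} :=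
      hP.inter (measurableSet_le (measurable_sym g) measurable_const)
    exact (lintegral_indicator hζ _).symm
  have h1 : ∫⁻ ξ, ‖fhat g (toep (g := g) b u : L2 g) ξ‖ₑ ∂freqMeasure g ≤
      ENNReal.ofReal (convWeight g) * ∫⁻ ζ in {ζ | 0 ≤ sym g ζ}, ‖fhat g u ζ‖ₑ * B ζ
        ∂freqMeasure g := by
    refine (lintegral_mono_ae (enorm_fhat_toep_le hm)).trans_eq ?_
    rw [lintegral_indicator hP, lintegral_const_mul' _ _ ENNReal.ofReal_ne_top,
      lintegral_correlation (measurable_fhat _).enorm (measurable_fhat _).enorm,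
      ← lintegral_indicator hP]
    congr 1
    refine lintegral_congr_ae ?_
    filter_upwards [u.fhat_eq_zero] with ζ hζ
    by_cases h : 0 ≤ sym g ζ
    · rw [Set.indicator_of_mem (by exact h)]
    · rw [Set.indicator_of_notMem (by exact h), hζ (not_le.1 h)]; simp
  have h2 : (∫⁻ ζ in {ζ | 0 ≤ sym g ζ}, ‖fhat g u ζ‖ₑ * B ζ ∂freqMeasure g) ^ 2 ≤
      (ENNReal.ofReal (√(2 * A.toReal) * (‖b‖ * (‖u‖ + ‖p‖)))) ^ 2 := by
    have h := lintegral_mul_sq_le (μ := (freqMeasure g).restrict {ζ | 0 ≤ sym g ζ})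
      ((hw.pow_const 2).mul (measurable_fhat (u : L2 g)).enorm).aemeasurable
      ((hw.inv.pow_const 2).mul hBm).aemeasurable
    have h3 : ∀ ζ, ((fun x => wt g x ^ 2) * fun a => ‖fhat g u a‖ₑ) ζ *
        ((fun x => (wt g)⁻¹ x ^ 2) * B) ζ = ‖fhat g u ζ‖ₑ * B ζ := fun ζ => by
      simp only [Pi.mul_apply, Pi.inv_apply]
      rw [mul_mul_mul_comm, ← mul_pow, ENNReal.mul_inv_cancel (wt_ne_zero ζ) (wt_ne_top ζ),
        one_pow, one_mul]
    simp only [h3] at h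
    refine h.trans ?_
    have h4 : ∫⁻ ζ in {ζ | 0 ≤ sym g ζ}, ((fun x => wt g x ^ 2) * fun a => ‖fhat g u a‖ₑ) ζ ^ 2
        ∂freqMeasure g ≤ ENNReal.ofReal (2 * (‖u‖ ^ 2 + ‖p‖ ^ 2)) :=
      (lintegral_mono' Measure.restrict_le_self le_rfl).trans (lintegral_wt_fhat_le hup)
    have h5 : ∫⁻ ζ in {ζ | 0 ≤ sym g ζ}, ((fun x => (wt g)⁻¹ x ^ 2) * B) ζ ^ 2 ∂freqMeasure g ≤
        A * ENNReal.ofReal (‖b‖ ^ 2) := by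
      have h6 := hardyIneq _ (measurable_fhat (b : L2 g)).enorm
      rw [lintegral_enorm_fhat_sq] at h6
      refine le_trans (le_of_eq ?_) h6
      refine lintegral_congr fun ζ => ?_
      simp only [Pi.mul_apply, Pi.inv_apply]
      rw [mul_pow, ← pow_mul]
    refine (mul_le_mul' h4 h5).trans ?_
    rw [← ENNReal.ofReal_toReal hA, ← ENNReal.ofReal_mul (by positivity),
      ← ENNReal.ofReal_mul (by positivity), ← ENNReal.ofReal_pow (by positivity),
      ENNReal.toReal_ofReal (by positivity)]
    refine ENNReal.ofReal_le_ofReal ?_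
    rw [mul_pow, Real.sq_sqrt (by positivity), mul_pow]
    have : 0 ≤ A.toReal * ‖b‖ ^ 2 * (‖u‖ * ‖p‖) := by positivity
    nlinarith
  have h3 := (ENNReal.pow_le_pow_left_iff two_ne_zero).1 h2
  have h4 := norm_le_of_lintegral_fhat_le (f := (toep (g := g) b u : L2 g))
    (B := convWeight g * (√(2 * A.toReal) * (‖b‖ * (‖u‖ + ‖p‖)))) (by positivity)
    (h1.trans (by
      rw [ENNReal.ofReal_mul hc]
      gcongr))
  filter_upwards [h4] with x hx
  refine hx.trans_eq ?_
  ring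

/-- The sharp bound of the quadratic form of `q C₊ q̄` by the kinetic energy. -/
theorem norm_toep_sq_le (q f : Hardy g) (p : L2 g) (hfp : IsMomentum g f p) :
    ‖toep (g := g) q f‖ ^ 2 ≤ ‖q‖ ^ 2 / (2 * π) * ((⟪(f : L2 g), p⟫_ℂ).re + ‖f‖ ^ 2) := by
  have hP := measurableSet_sym_nonneg g
  have hm := memLp_conj_mul_left (b := (q : L2 g)) (essBdd_of_isMomentum hfp)
  have hc := (convWeight_pos g)
  have hfm : Measurable fun ζ => ‖fhat g f ζ‖ₑ ^ 2 := (measurable_fhat _).enorm.pow_const 2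
  -- the right-hand side on the Fourier side
  have hi1 : Integrable (fun ξ => conj (fhat g f ξ) * fhat g p ξ) (freqMeasure g) :=
    MemLp.integrable_mul (memLp_fhat _).star (memLp_fhat _)
  have hi2 : Integrable (fun ξ => conj (fhat g f ξ) * fhat g f ξ) (freqMeasure g) :=
    MemLp.integrable_mul (memLp_fhat _).star (memLp_fhat _)
  have e0 : (fun ξ => conj (fhat g f ξ) * fhat g p ξ + conj (fhat g f ξ) * fhat g f ξ)
      =ᵐ[freqMeasure g] fun ξ => (((sym g ξ + 1) * ‖fhat g f ξ‖ ^ 2 : ℝ) : ℂ) := by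
    filter_upwards [isMomentum_iff.1 hfp] with ξ hξ
    rw [hξ]
    push_cast; rw [← Complex.conj_mul']; ring
  have hi3 : Integrable (fun ξ => (sym g ξ + 1) * ‖fhat g f ξ‖ ^ 2) (freqMeasure g) :=
    ((hi1.add hi2).congr e0).re
  have e1 : ((⟪(f : L2 g), p⟫_ℂ).re + ‖f‖ ^ 2) =
      ∫ ξ, (sym g ξ + 1) * ‖fhat g f ξ‖ ^ 2 ∂freqMeasure g := by
    have h2 : ‖f‖ ^ 2 = (⟪(f : L2 g), (f : L2 g)⟫_ℂ).re := by
      rw [inner_self_eq_norm_sq_to_K]; norm_cast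
    rw [h2, ← Complex.add_re, inner_eq_integral_fhat, inner_eq_integral_fhat,
      ← integral_add hi1 hi2, integral_congr_ae e0, integral_complex_ofReal, Complex.ofReal_re]
  have hnn : 0 ≤ᵐ[freqMeasure g] fun ξ => (sym g ξ + 1) * ‖fhat g f ξ‖ ^ 2 := by
    filter_upwards [f.fhat_eq_zero] with ξ hξ
    by_cases h : 0 ≤ sym g ξ
    · simp only [Pi.zero_apply]; positivity
    · simp [hξ (not_le.1 h)]
  have e2 : ENNReal.ofReal ((⟪(f : L2 g), p⟫_ℂ).re + ‖f‖ ^ 2) =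
      ∫⁻ ξ, ENNReal.ofReal ((sym g ξ + 1) * ‖fhat g f ξ‖ ^ 2) ∂freqMeasure g := by
    rw [e1, ofReal_integral_eq_lintegral_ofReal hi3 hnn]
  -- the left-hand side on the Fourier side
  have h1 : ENNReal.ofReal (‖toep (g := g) q f‖ ^ 2) ≤ ENNReal.ofReal (convWeight g) ^ 2 *
      (ENNReal.ofReal (‖q‖ ^ 2) * ∫⁻ ζ, ‖fhat g f ζ‖ₑ ^ 2 *
        freqMeasure g {η | 0 ≤ sym g η ∧ sym g η ≤ sym g ζ} ∂freqMeasure g) := by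
    have e3 := lintegral_enorm_fhat_sq (toep (g := g) q f : L2 g)
    rw [Submodule.coe_norm (toep (g := g) q f), Submodule.coe_norm q, ← e3]
    have h2 : ∀ᵐ ξ ∂freqMeasure g, ‖fhat g (toep (g := g) q f : L2 g) ξ‖ₑ ^ 2 ≤
        {ξ | 0 ≤ sym g ξ}.indicator (fun ξ => ENNReal.ofReal (convWeight g) ^ 2 *
          (ENNReal.ofReal (‖(q : L2 g)‖ ^ 2) * ∫⁻ η in {η | 0 ≤ sym g η},
          1 * ‖fhat g f (η + ξ)‖ₑ ^ 2 ∂freqMeasure g)) ξ := by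
      filter_upwards [enorm_fhat_toep_le hm] with ξ hξ
      refine (pow_le_pow_left₀ zero_le hξ 2).trans ?_
      by_cases h : 0 ≤ sym g ξ
      · rw [Set.indicator_of_mem (by exact h), Set.indicator_of_mem (by exact h), mul_pow]
        gcongr
        refine (lintegral_mul_sq_le (measurable_fhat _).enorm.aemeasurable
          ((measurable_fhat _).enorm.comp (measurable_add_const ξ)).aemeasurable).trans ?_
        rw [← lintegral_enorm_fhat_sq]
        simp only [one_mul, Function.comp_apply]
        gcongr
        exact Measure.restrict_le_self
      · rw [Set.indicator_of_notMem (by exact h), Set.indicator_of_notMem (by exact h)]; simp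
    refine (lintegral_mono_ae h2).trans_eq ?_
    rw [lintegral_indicator hP, lintegral_const_mul' _ _ (by finiteness),
      lintegral_const_mul' _ _ (by finiteness),
      lintegral_correlation (b := fun _ => 1) measurable_const hfm]
    simp only [setLIntegral_one]
  have h2 : ∀ᵐ ζ ∂freqMeasure g, ‖fhat g f ζ‖ₑ ^ 2 *
      freqMeasure g {η | 0 ≤ sym g η ∧ sym g η ≤ sym g ζ} ≤
      ENNReal.ofReal ((2 * π * convWeight g ^ 2)⁻¹) *
        ENNReal.ofReal ((sym g ζ + 1) * ‖fhat g f ζ‖ ^ 2) := by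
    filter_upwards [f.fhat_eq_zero] with ζ hζ
    by_cases h : 0 ≤ sym g ζ
    · refine (mul_le_mul_right (freqMeasure_le g _ h) _).trans_eq ?_
      rw [← ofReal_norm, ← ENNReal.ofReal_pow (norm_nonneg _), ← ENNReal.ofReal_mul (by positivity),
        ← ENNReal.ofReal_mul (by positivity)]
      congr 1
      have := hc.ne'
      field_simp
    · rw [hζ (not_le.1 h)]; simp
  have h3 : ENNReal.ofReal (‖toep (g := g) q f‖ ^ 2) ≤ ENNReal.ofReal (convWeight g ^ 2 * (‖q‖ ^ 2 *
      ((2 * π * convWeight g ^ 2)⁻¹ * ((⟪(f : L2 g), p⟫_ℂ).re + ‖f‖ ^ 2)))) := by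
    refine h1.trans ?_
    rw [ENNReal.ofReal_mul (by positivity), ENNReal.ofReal_mul (by positivity),
      ENNReal.ofReal_mul (p := (2 * π * convWeight g ^ 2)⁻¹) (by positivity), e2,
      ENNReal.ofReal_pow hc.le,
      ← lintegral_const_mul' (ENNReal.ofReal (2 * π * convWeight g ^ 2)⁻¹) _ ENNReal.ofReal_ne_top]
    exact mul_le_mul' le_rfl (mul_le_mul' le_rfl (lintegral_mono_ae h2))
  have h4 : 0 ≤ (⟪(f : L2 g), p⟫_ℂ).re + ‖f‖ ^ 2 := by
    rw [e1]; exact integral_nonneg_of_ae hnn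
  rw [ENNReal.ofReal_le_ofReal_iff (by positivity)] at h3
  refine h3.trans_eq ?_
  have := hc.ne'
  field_simp

/-! ### Products and the momentum operator -/

theorem IsMomentum.add {u p v r : L2 g} (h1 : IsMomentum g u p) (h2 : IsMomentum g v r) :
    IsMomentum g (u + v) (p + r) := by
  rw [isMomentum_iff] at *
  filter_upwards [h1, h2, fhat_add u v, fhat_add p r] with ξ a b c d
  rw [c, d, a, b]; ring

theorem IsMomentum.smul {u p : L2 g} (c : ℂ) (h1 : IsMomentum g u p) :
    IsMomentum g (c • u) (c • p) := by
  rw [isMomentum_iff] at *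
  filter_upwards [h1, fhat_smul c u, fhat_smul c p] with ξ a b d
  rw [b, d, a]; ring

theorem IsMomentum.zero : IsMomentum g (0 : L2 g) 0 := by
  rw [isMomentum_iff]
  filter_upwards [fhat_smul 0 (0 : L2 g)] with ξ h
  rw [zero_smul, zero_mul] at h
  rw [h, mul_zero]

theorem IsMomentum.sum {ι : Type*} (t : Finset ι) {u p : ι → L2 g}
    (h : ∀ i ∈ t, IsMomentum g (u i) (p i)) : IsMomentum g (∑ i ∈ t, u i) (∑ i ∈ t, p i) := by
  classical
  induction t using Finset.induction_on with
  | empty => exact IsMomentum.zero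
  | insert i t hi ih =>
    rw [Finset.sum_insert hi, Finset.sum_insert hi]
    exact (h i (Finset.mem_insert_self i t)).add
      (ih fun j hj => h j (Finset.mem_insert_of_mem hj))

theorem IsMomentum.unique {u p r : L2 g} (h1 : IsMomentum g u p) (h2 : IsMomentum g u r) :
    p = r := by
  rw [isMomentum_iff] at *
  refine eq_of_fhat_ae_eq ?_
  filter_upwards [h1, h2] with ξ a b
  rw [a, b]

theorem IsMomentum.mem_hardy {u p : L2 g} (h : IsMomentum g u p) (hu : u ∈ hardy g) :
    p ∈ hardy g := by
  rw [mem_hardy_iff] at *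
  filter_upwards [isMomentum_iff.1 h, hu] with ξ a b c
  rw [a, b c, mul_zero]

theorem IsMomentum.szego {u p : L2 g} (h : IsMomentum g u p) :
    IsMomentum g (szego g u : L2 g) (szego g p : L2 g) := by
  rw [isMomentum_iff] at *
  filter_upwards [h, fhat_szego u, fhat_szego p] with ξ a b c
  rw [b, c]
  by_cases hξ : 0 ≤ sym g ξ
  · rw [Set.indicator_of_mem (by exact hξ), Set.indicator_of_mem (by exact hξ), a]
  · rw [Set.indicator_of_notMem (by exact hξ), Set.indicator_of_notMem (by exact hξ), mul_zero]

theorem IsMomentum.conj {u p u' p' : L2 g} (h : IsMomentum g u p)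
    (hu : u' =ᵐ[volume] fun x => conj (u x)) (hp : p' =ᵐ[volume] fun x => -conj (p x)) :
    IsMomentum g u' p' := by
  have h0 := isMomentum_iff.1 h
  rw [isMomentum_iff]
  have hp' : (-1 : ℂ) • p' =ᵐ[volume] fun x => conj (p x) := by
    filter_upwards [Lp.coeFn_smul (-1 : ℂ) p', hp] with x h1 h2
    rw [h1, Pi.smul_apply, h2, smul_eq_mul, neg_one_mul, neg_neg]
  filter_upwards [ae_freqMeasure_neg h0, fhat_conj hu, fhat_conj hp', fhat_smul (-1 : ℂ) p']
    with ξ h1 h2 h3 h4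
  rw [h4, h1, sym_neg] at h3
  rw [h2]
  simp only [map_mul, Complex.conj_ofReal, Complex.ofReal_neg, map_neg] at h3
  linear_combination -h3

theorem IsMomentum.inner_eq {u p v r : L2 g} (h1 : IsMomentum g u p) (h2 : IsMomentum g v r) :
    ⟪u, r⟫_ℂ = ⟪p, v⟫_ℂ := by
  rw [inner_eq_integral_fhat, inner_eq_integral_fhat]
  refine integral_congr_ae ?_
  filter_upwards [isMomentum_iff.1 h1, isMomentum_iff.1 h2] with ξ a b
  rw [a, b, map_mul, Complex.conj_ofReal]; ring

theorem ae_freqMeasure_add (ξ : g.Freq) {P : g.Freq → Prop} (h : ∀ᵐ η ∂freqMeasure g, P η) :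
    ∀ᵐ η ∂freqMeasure g, P (η + ξ) :=
  (measurePreserving_add_right (freqMeasure g) ξ).quasiMeasurePreserving.ae h

theorem integrable_fhat_conj_mul (a b : L2 g) (ξ : g.Freq) :
    Integrable (fun η => conj (fhat g a η) * fhat g b (η + ξ)) (freqMeasure g) :=
  MemLp.integrable_mul (memLp_fhat a).star
    ((memLp_fhat b).comp_measurePreserving (measurePreserving_add_right (freqMeasure g) ξ))

/-- The Leibniz rule for `ā b`. -/
theorem IsMomentum.conj_mul {a a' b b' P Q R : L2 g} (ha : IsMomentum g a a')
    (hb : IsMomentum g b b') (hP : P =ᵐ[volume] fun x => conj (a x) * b x)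
    (hQ : Q =ᵐ[volume] fun x => conj (a x) * b' x)
    (hR : R =ᵐ[volume] fun x => conj (a' x) * b x) : IsMomentum g P (Q - R) := by
  rw [isMomentum_iff] at *
  filter_upwards [fhat_conj_mul hP, fhat_conj_mul hQ, fhat_conj_mul hR, fhat_sub Q R]
    with ξ h1 h2 h3 h4
  rw [h4, h1, h2, h3, ← mul_sub, ← integral_sub (integrable_fhat_conj_mul _ _ _)
    (integrable_fhat_conj_mul _ _ _), mul_left_comm, ← integral_const_mul (sym g ξ : ℂ)]
  congr 1
  refine integral_congr_ae ?_
  filter_upwards [ha, ae_freqMeasure_add ξ hb] with η h5 h6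
  rw [h5, h6, sym_add]
  simp only [map_mul, Complex.conj_ofReal, Complex.ofReal_add]
  ring

theorem exists_conj (a : L2 g) : ∃ a' : L2 g, a' =ᵐ[volume] fun x => conj (a x) :=
  ⟨_, coeFn_toL2 (L2.memLp_conj a)⟩

/-- The Leibniz rule. -/
theorem IsMomentum.mul {a a' b b' P Q R : L2 g} (ha : IsMomentum g a a')
    (hb : IsMomentum g b b') (hP : P =ᵐ[volume] fun x => a x * b x)
    (hQ : Q =ᵐ[volume] fun x => a x * b' x)
    (hR : R =ᵐ[volume] fun x => a' x * b x) : IsMomentum g P (Q + R) := by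
  obtain ⟨c, hc⟩ := exists_conj a
  obtain ⟨d, hd⟩ := exists_conj a'
  have hd' : -d =ᵐ[volume] fun x => -conj (a' x) := by
    filter_upwards [Lp.coeFn_neg d, hd] with x h1 h2
    rw [h1, Pi.neg_apply, h2]
  have h : IsMomentum g P (Q - -R) := by
    refine (ha.conj hc hd').conj_mul hb ?_ ?_ ?_
    · filter_upwards [hP, hc] with x h1 h2
      rw [h1, h2, Complex.conj_conj]
    · filter_upwards [hQ, hc] with x h1 h2
      rw [h1, h2, Complex.conj_conj]
    · filter_upwards [Lp.coeFn_neg R, hR, hd'] with x h1 h2 h3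
      rw [h1, Pi.neg_apply, h2, h3, map_neg, Complex.conj_conj, neg_mul]
  rwa [sub_neg_eq_add] at h

/-- The product of two functions without negative frequencies has no negative frequencies. -/
theorem mem_hardy_of_mul {a b : Hardy g} {P : L2 g}
    (hP : P =ᵐ[volume] fun x => (a : L2 g) x * (b : L2 g) x) : P ∈ hardy g := by
  obtain ⟨c, hc⟩ := exists_conj (a : L2 g)
  have hP' : P =ᵐ[volume] fun x => conj (c x) * (b : L2 g) x := by
    filter_upwards [hP, hc] with x h1 h2
    rw [h1, h2, Complex.conj_conj]
  rw [mem_hardy_iff]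
  filter_upwards [fhat_conj_mul hP'] with ξ h1 hξ
  rw [h1, integral_eq_zero_of_ae, mul_zero]
  filter_upwards [fhat_conj hc, ae_freqMeasure_neg a.fhat_eq_zero,
    ae_freqMeasure_add ξ b.fhat_eq_zero] with η h2 h3 h4
  rw [h2]
  by_cases hη : sym g η ≤ 0
  · rw [h4 (by rw [sym_add]; linarith), mul_zero]; rfl
  · rw [h3 (by rw [sym_neg]; linarith)]; simp

/-- The product of two elements of the Hardy space, provided that it is square integrable. -/
def hmul (a b : Hardy g) : Hardy g := szego g (toL2 g fun x => (a : L2 g) x * (b : L2 g) x)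

theorem szego_of_mem {F : L2 g} (hF : F ∈ hardy g) : (szego g F : L2 g) = F := by
  rw [szego]
  exact congrArg Subtype.val (Submodule.orthogonalProjectionOnto_mem_subspace_eq_self ⟨F, hF⟩)

theorem coeFn_hmul {a b : Hardy g}
    (hm : MemLp (fun x => (a : L2 g) x * (b : L2 g) x) 2 volume) :
    (hmul a b : L2 g) =ᵐ[volume] fun x => (a : L2 g) x * (b : L2 g) x := by
  have h := coeFn_toL2 hm
  rw [hmul, szego_of_mem (mem_hardy_of_mul h)]
  exact h

theorem coeFn_hmul_right {a b : Hardy g} (hb : EssBdd ((b : L2 g) : g.Space → ℂ)) :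
    (hmul a b : L2 g) =ᵐ[volume] fun x => (a : L2 g) x * (b : L2 g) x :=
  coeFn_hmul (memLp_mul_of_bdd (L2.memLp _) (L2.meas _) hb)

theorem coeFn_hmul_left {a b : Hardy g} (ha : EssBdd ((a : L2 g) : g.Space → ℂ)) :
    (hmul a b : L2 g) =ᵐ[volume] fun x => (a : L2 g) x * (b : L2 g) x :=
  coeFn_hmul ((memLp_mul_of_bdd (L2.memLp (b : L2 g)) (L2.meas (a : L2 g)) ha).ae_eq
    (Eventually.of_forall fun _ => mul_comm _ _))

/-- Toeplitz operators are adjoint to multiplication operators. -/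
theorem inner_toep_eq {b f h : Hardy g}
    (hm : MemLp (fun x => conj ((b : L2 g) x) * (f : L2 g) x) 2 volume)
    (hp : (hmul (g := g) b h : L2 g) =ᵐ[volume] fun x => (b : L2 g) x * (h : L2 g) x) :
    ⟪toep (g := g) b f, h⟫_ℂ = ⟪f, hmul b h⟫_ℂ := by
  rw [inner_toep_left hm, Submodule.coe_inner, inner_eq_integral]
  refine integral_congr_ae ?_
  filter_upwards [hp] with x hx
  rw [hx, map_mul, Complex.conj_conj]; ring

/-- The part `r` of `b̄ f = C₊(b̄ f) + r̄` with strictly negative frequencies, conjugated. -/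
def rem (b f : Hardy g) : Hardy g :=
  szego g (toL2 g fun x => conj (conj ((b : L2 g) x) * (f : L2 g) x -
    (toep (g := g) b f : L2 g) x))

theorem fhat_sub_szego (F : L2 g) : ∀ᵐ ξ ∂freqMeasure g, 0 ≤ sym g ξ →
    fhat g (F - (szego g F : L2 g)) ξ = 0 := by
  filter_upwards [fhat_sub F (szego g F : L2 g), fhat_szego F] with ξ h1 h2 h3
  rw [h1, h2, Set.indicator_of_mem (by exact h3), sub_self]

theorem coeFn_rem_aux {b f : Hardy g}
    (hm : MemLp (fun x => conj ((b : L2 g) x) * (f : L2 g) x) 2 volume) :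
    (rem b f : L2 g) =ᵐ[volume] (fun x => conj (((toL2 g fun x => conj ((b : L2 g) x) *
      (f : L2 g) x) - (toep (g := g) b f : L2 g) : L2 g) x)) := by
  set F := toL2 g fun x => conj ((b : L2 g) x) * (f : L2 g) x with hF
  have h0 : (toep (g := g) b f : L2 g) = szego g F := rfl
  have hm2 : MemLp (fun x => conj (conj ((b : L2 g) x) * (f : L2 g) x -
    (toep (g := g) b f : L2 g) x)) 2 volume := (hm.sub (L2.memLp _)).star
  have h1 : toL2 g (fun x => conj (conj ((b : L2 g) x) * (f : L2 g) x -
    (toep (g := g) b f : L2 g) x)) =ᵐ[volume]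
      fun x => conj ((F - (szego g F : L2 g) : L2 g) x) := by
    filter_upwards [coeFn_toL2 hm2, coeFn_toL2 hm, Lp.coeFn_sub F (szego g F : L2 g)]
      with x h2 h3 h4
    rw [h2, h4, Pi.sub_apply, hF, h3, h0]
  rw [rem, szego_of_mem, h0]
  · exact h1
  · rw [mem_hardy_iff]
    filter_upwards [fhat_conj h1, ae_freqMeasure_neg (fhat_sub_szego F)] with ξ h2 h3 h4
    rw [h2, h3 (by rw [sym_neg]; linarith), map_zero]

/-- The splitting `b̄ f = C₊(b̄ f) + r̄` into nonnegative and negative frequencies. -/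
theorem conj_mul_eq_toep_add_rem {b f : Hardy g}
    (hm : MemLp (fun x => conj ((b : L2 g) x) * (f : L2 g) x) 2 volume) :
    ∀ᵐ x : g.Space, conj ((b : L2 g) x) * (f : L2 g) x =
      (toep (g := g) b f : L2 g) x + conj ((rem b f : L2 g) x) := by
  filter_upwards [coeFn_rem_aux hm, coeFn_toL2 hm, Lp.coeFn_sub
    (toL2 g fun x => conj ((b : L2 g) x) * (f : L2 g) x) (toep (g := g) b f : L2 g)] with x h1 h2 h3
  rw [h1, h3, Pi.sub_apply, h2, Complex.conj_conj]; ring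

theorem meanWeight_mul_integral_congr : {g : Geometry} → {f h : L2 g} →
    (∀ᵐ ξ ∂freqMeasure g, sym g ξ = 0 → fhat g f ξ = fhat g h ξ) →
    (meanWeight g : ℂ) * ∫ x, f x = meanWeight g * ∫ x, h x
  | .line, _, _, _ => by simp [meanWeight]
  | .torus, f, h, hfh => by
    have h0 : torusFourier f 0 = torusFourier h 0 := ae_torusFreqMeasure.1 hfh 0 Int.cast_zero
    have h1 : ∀ k : L2 .torus, torusFourier k 0 = (meanWeight .torus : ℂ) * ∫ x, k x := by
      intro k
      rw [torusFourier, fourierCoeff, AddCircle.integral_haarAddCircle, meanWeight,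
        Complex.real_smul]
      simp
    rw [← h1, ← h1, h0]

/-- Up to conjugation, `C₊(f̄ b)` and the strictly negative part of `b̄ f` differ by a mean. -/
theorem toep_swap_eq {b f : Hardy g}
    (hm : MemLp (fun x => conj ((b : L2 g) x) * (f : L2 g) x) 2 volume) :
    ∀ᵐ x : g.Space, (toep (g := g) f b : L2 g) x =
      (rem b f : L2 g) x + meanWeight g * ⟪f, b⟫_ℂ := by
  have hm' : MemLp (fun x => conj ((f : L2 g) x) * (b : L2 g) x) 2 volume :=
    hm.star.ae_eq (Eventually.of_forall fun x => by simp [mul_comm])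
  set F := toL2 g fun x => conj ((b : L2 g) x) * (f : L2 g) x with hF
  set F' := toL2 g fun x => conj ((f : L2 g) x) * (b : L2 g) x with hF'
  have h1 : F' =ᵐ[volume] fun x => conj (F x) := by
    filter_upwards [coeFn_toL2 hm, coeFn_toL2 hm'] with x h1 h2
    rw [hF, hF', h1, h2, map_mul, Complex.conj_conj, mul_comm]
  have h2 : ∀ᵐ ξ ∂freqMeasure g, (sym g ξ ≠ 0 →
      fhat g ((toep (g := g) f b : L2 g) - rem b f) ξ = 0) ∧ (sym g ξ = 0 →
      fhat g ((toep (g := g) f b : L2 g) - rem b f) ξ = fhat g F' ξ) := by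
    filter_upwards [fhat_conj h1, fhat_szego F', fhat_conj (coeFn_rem_aux hm),
      fhat_sub (toep (g := g) f b : L2 g) (rem b f : L2 g), (rem b f).fhat_eq_zero,
      ae_freqMeasure_neg (fhat_sub F (szego g F : L2 g)), ae_freqMeasure_neg (fhat_sub_szego F),
      ae_freqMeasure_neg (szego g F).fhat_eq_zero] with ξ h2 h3 h4 h5 h6 h7 h8 h9
    have e1 : fhat g (toep (g := g) f b : L2 g) ξ = _ := h3
    have e2 : fhat g (rem b f : L2 g) ξ = conj (fhat g (F - (szego g F : L2 g)) (-ξ)) := h4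
    rw [sym_neg] at h8 h9
    rw [h5, e1]
    refine ⟨fun h => ?_, fun h => ?_⟩
    · rcases h.lt_or_gt with h | h
      · rw [Set.indicator_of_notMem (by simpa using h), h6 h, sub_zero]
      · rw [Set.indicator_of_mem (by exact h.le), e2, h7, h9 (by linarith), h2, sub_zero, sub_self]
    · rw [Set.indicator_of_mem (by exact h.ge), e2, h8 (by linarith), map_zero, sub_zero]
  have h3 := ae_eq_mean_of_fhat (h2.mono fun ξ h => h.1)
  have h4 : ∫ x, F' x = ⟪f, b⟫_ℂ := by
    rw [Submodule.coe_inner, inner_eq_integral]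
    exact integral_congr_ae (coeFn_toL2 hm')
  rw [meanWeight_mul_integral_congr (h2.mono fun ξ h => h.2), h4] at h3
  filter_upwards [h3, Lp.coeFn_sub (toep (g := g) f b : L2 g) (rem b f : L2 g)] with x h5 h6
  rw [← h5, h6, Pi.sub_apply]; ring

/-! ### Shortcut instances

They agree by definition with the instances that are found without them, which takes long in the
subspace of an `Lᵖ` space. -/

local instance instNormedAddCommGroupL2 (g : Geometry) : NormedAddCommGroup (L2 g) :=
  Lp.instNormedAddCommGroup

local instance instSeminormedAddCommGroupL2 (g : Geometry) : SeminormedAddCommGroup (L2 g) :=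
  (Lp.instNormedAddCommGroup (E := ℂ) (p := 2)
    (μ := (volume : Measure g.Space))).toSeminormedAddCommGroup

local instance instNormedAddCommGroupHardy (g : Geometry) : NormedAddCommGroup (Hardy g) :=
  Submodule.normedAddCommGroup (hardy g)

local instance instSeminormedAddCommGroupHardy (g : Geometry) : SeminormedAddCommGroup (Hardy g) :=
  Submodule.seminormedAddCommGroup (hardy g)

local instance instInnerProductSpaceHardy (g : Geometry) : InnerProductSpace ℂ (Hardy g) :=
  Submodule.innerProductSpace (hardy g)

local instance instNormedSpaceHardy (g : Geometry) : NormedSpace ℂ (Hardy g) :=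
  Submodule.normedSpace (hardy g)

/-! ### The space `H¹₊` and the free resolvent -/

/-- The equation `-i u' + κ u = h` is solvable in the Hardy space. -/
theorem exists_isMomentum_sub {κ : ℝ} (hκ : 0 < κ) (h : Hardy g) :
    ∃ u : Hardy g, IsMomentum g u ((h - (κ : ℂ) • u : Hardy g) : L2 g) := by
  have hP := measurableSet_sym_nonneg g
  set φ : g.Freq → ℂ := {ξ | 0 ≤ sym g ξ}.indicator
    (fun ξ => ((sym g ξ + κ : ℝ) : ℂ)⁻¹ * fhat g h ξ) with hφ
  have hm : MemLp φ 2 (freqMeasure g) := by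
    refine ((memLp_fhat (h : L2 g)).norm.const_mul κ⁻¹).mono ?_ (Eventually.of_forall fun ξ => ?_)
    · exact ((((Complex.measurable_ofReal.comp ((measurable_sym g).add_const κ)).inv).mul
        (measurable_fhat _)).indicator hP).aestronglyMeasurable
    · by_cases hξ : 0 ≤ sym g ξ
      · rw [hφ, Set.indicator_of_mem (by exact hξ), norm_mul, norm_inv, Complex.norm_real,
          norm_mul, norm_inv, norm_norm, Real.norm_eq_abs, Real.norm_eq_abs,
          abs_of_pos hκ, abs_of_pos (by positivity)]
        gcongr
        linarith
      · rw [hφ, Set.indicator_of_notMem (by exact hξ), norm_zero]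
        positivity
  obtain ⟨u, hu⟩ := exists_fhat hm
  have hu' : u ∈ hardy g := by
    rw [mem_hardy_iff]
    filter_upwards [hu] with ξ h1 h2
    rw [h1, hφ, Set.indicator_of_notMem (by simpa using h2)]
  refine ⟨⟨u, hu'⟩, isMomentum_iff.2 ?_⟩
  filter_upwards [hu, fhat_sub (h : L2 g) ((κ : ℂ) • u), fhat_smul (κ : ℂ) u, h.fhat_eq_zero]
    with ξ h1 h2 h3 h4
  have h5 : fhat g ((h - (κ : ℂ) • (⟨u, hu'⟩ : Hardy g) : Hardy g) : L2 g) ξ =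
    fhat g ((h : L2 g) - (κ : ℂ) • u) ξ := rfl
  rw [h5, h2, h3]
  by_cases hξ : 0 ≤ sym g ξ
  · rw [h1, hφ, Set.indicator_of_mem (by exact hξ)]
    have : ((sym g ξ + κ : ℝ) : ℂ) ≠ 0 := Complex.ofReal_ne_zero.2 (by positivity)
    push_cast at this ⊢
    field_simp
    ring
  · rw [h1, hφ, Set.indicator_of_notMem (by exact hξ), h4 (not_le.1 hξ)]; simp

/-- The kinetic energy is nonnegative on the Hardy space. -/
theorem IsMomentum.re_inner_nonneg {u : Hardy g} {p : L2 g} (h : IsMomentum g u p) :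
    0 ≤ (⟪(u : L2 g), p⟫_ℂ).re := by
  have h1 : ⟪(u : L2 g), p⟫_ℂ =
      ((∫ ξ, sym g ξ * ‖fhat g u ξ‖ ^ 2 ∂freqMeasure g : ℝ) : ℂ) := by
    rw [inner_eq_integral_fhat, ← integral_complex_ofReal]
    refine integral_congr_ae ?_
    filter_upwards [isMomentum_iff.1 h] with ξ h1
    rw [h1]; push_cast; rw [← Complex.conj_mul']; ring
  rw [h1, Complex.ofReal_re]
  refine integral_nonneg_of_ae ?_
  filter_upwards [u.fhat_eq_zero] with ξ h2
  by_cases hξ : 0 ≤ sym g ξ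
  · simp only [Pi.zero_apply]; positivity
  · simp [h2 (not_le.1 hξ)]

/-- The graph of `-i ∂ₓ` in the Hardy space. With the norm of the product, it is the space
`H¹₊`. -/
def sobolev (g : Geometry) : Submodule ℂ (Hardy g × Hardy g) where
  carrier := {z | IsMomentum g z.1 z.2}
  add_mem' := fun h1 h2 => h1.add h2
  zero_mem' := IsMomentum.zero
  smul_mem' := fun c _ h => h.smul c

/-- The space `H¹₊`, as the graph of `-i ∂ₓ`. -/
def Sobolev (g : Geometry) : Type := sobolev g

instance instNormedAddCommGroupSobolev (g : Geometry) : NormedAddCommGroup (Sobolev g) :=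
  inferInstanceAs (NormedAddCommGroup (sobolev g))

instance instNormedSpaceSobolev (g : Geometry) : NormedSpace ℂ (Sobolev g) :=
  inferInstanceAs (NormedSpace ℂ (sobolev g))

/-- The operator `-i ∂ₓ` is closed, being the adjoint of itself. -/
theorem isClosed_sobolev (g : Geometry) : IsClosed (sobolev g : Set (Hardy g × Hardy g)) := by
  have h : (sobolev g : Set (Hardy g × Hardy g)) =
      ⋂ w : sobolev g, {z | ⟪z.2, w.1.1⟫_ℂ = ⟪z.1, w.1.2⟫_ℂ} := by
    ext z
    simp only [Set.mem_iInter, Set.mem_ofPred_eq]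
    refine ⟨fun hz w => (IsMomentum.inner_eq hz w.2).symm, fun hz => ?_⟩
    obtain ⟨u, hu⟩ := exists_isMomentum_sub zero_lt_one (z.1 + z.2)
    set p : Hardy g := z.1 + z.2 - ((1 : ℝ) : ℂ) • u with hp
    -- the difference of the two pairs is orthogonal to the range of `-i ∂ₓ + 1`
    have h1 : z.1 - u = 0 := by
      obtain ⟨v, hv⟩ := exists_isMomentum_sub zero_lt_one (z.1 - u)
      set r : Hardy g := z.1 - u - ((1 : ℝ) : ℂ) • v with hr
      have h2 := hz ⟨(v, r), hv⟩
      have h3 : ⟪u, r⟫_ℂ = ⟪p, v⟫_ℂ := IsMomentum.inner_eq hu hv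
      have h4 : z.2 = p - (z.1 - u) := by rw [hp, Complex.ofReal_one, one_smul]; abel
      have h5 : r = z.1 - u - v := by rw [hr, Complex.ofReal_one, one_smul]
      have h6 : ⟪z.1 - u, z.1 - u⟫_ℂ = 0 := by
        have e : z.1 - u = r + v := by rw [h5]; abel
        calc ⟪z.1 - u, z.1 - u⟫_ℂ = ⟪z.1 - u, r + v⟫_ℂ := by rw [← e]
          _ = 0 := by
            have h2' : ⟪z.2, v⟫_ℂ = ⟪z.1, r⟫_ℂ := h2
            rw [h4] at h2'
            simp only [inner_sub_left, inner_add_right] at h2' ⊢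
            linear_combination -h2' - h3
      exact inner_self_eq_zero.1 h6
    have h2 : u = z.1 := (sub_eq_zero.1 h1).symm
    have h3 : p = z.2 := by rw [hp, h2, Complex.ofReal_one, one_smul]; abel
    have h4 : IsMomentum g u p := hu
    rw [h2, h3] at h4
    exact h4
  rw [h]
  exact isClosed_iInter fun w => isClosed_eq
    (Continuous.inner (𝕜 := ℂ) (E := Hardy g) continuous_snd continuous_const)
    (Continuous.inner (𝕜 := ℂ) (E := Hardy g) continuous_fst continuous_const)

instance instCompleteSpaceSobolevGraph (g : Geometry) : CompleteSpace (sobolev g) :=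
  (isClosed_sobolev g).completeSpace_coe

instance instCompleteSpaceSobolev (g : Geometry) : CompleteSpace (Sobolev g) :=
  inferInstanceAs (CompleteSpace (sobolev g))

/-- The inclusion of `H¹₊` in the Hardy space. -/
def incl : Sobolev g →L[ℂ] Hardy g :=
  (ContinuousLinearMap.fst ℂ (Hardy g) (Hardy g)).comp (sobolev g).subtypeL

/-- The operator `-i ∂ₓ` on `H¹₊`. -/
def mom : Sobolev g →L[ℂ] Hardy g :=
  (ContinuousLinearMap.snd ℂ (Hardy g) (Hardy g)).comp (sobolev g).subtypeL

theorem isMomentum_mom (u : Sobolev g) : IsMomentum g (incl u : L2 g) (mom u : L2 g) := u.2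

theorem exists_sobolev {f : Hardy g} {p : L2 g} (h : IsMomentum g f p) :
    ∃ u : Sobolev g, incl u = f ∧ (mom u : L2 g) = p :=
  ⟨⟨(f, ⟨p, h.mem_hardy f.2⟩), h⟩, rfl, rfl⟩

theorem incl_injective : Function.Injective (incl (g := g)) := fun u v h => by
  have h1 : IsMomentum g (incl u : L2 g) (mom v : L2 g) := by rw [h]; exact isMomentum_mom v
  exact Subtype.ext (Prod.ext h (Subtype.ext ((isMomentum_mom u).unique h1)))

theorem norm_incl_le (u : Sobolev g) : ‖incl u‖ ≤ ‖u‖ := norm_fst_le u.1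

theorem norm_mom_le (u : Sobolev g) : ‖mom u‖ ≤ ‖u‖ := norm_snd_le u.1

theorem norm_sobolev_le {u : Sobolev g} {C : ℝ} (h1 : ‖incl u‖ ≤ C) (h2 : ‖mom u‖ ≤ C) :
    ‖u‖ ≤ C := max_le h1 h2

theorem essBdd_incl (u : Sobolev g) : EssBdd ((incl u : L2 g) : g.Space → ℂ) :=
  essBdd_of_isMomentum (isMomentum_mom u)

theorem inner_mom (u v : Sobolev g) : ⟪incl u, mom v⟫_ℂ = ⟪mom u, incl v⟫_ℂ :=
  (isMomentum_mom u).inner_eq (isMomentum_mom v)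

theorem re_inner_mom_nonneg (u : Sobolev g) : 0 ≤ (⟪incl u, mom u⟫_ℂ).re :=
  (isMomentum_mom u).re_inner_nonneg

/-! ### The cubic terms -/

theorem toL2_eq {F : L2 g} {f : g.Space → ℂ} (h : F =ᵐ[volume] f) : toL2 g f = F :=
  Lp.ext ((coeFn_toL2 ((L2.memLp F).ae_eq h)).trans h.symm)

theorem toep_eq {b f F : L2 g} (h : F =ᵐ[volume] fun x => conj (b x) * f x) :
    toep b f = szego g F := by rw [toep, toL2_eq h]

theorem memLp_conj_mul_incl (b : Hardy g) (u : Sobolev g) :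
    MemLp (fun x => conj ((b : L2 g) x) * (incl u : L2 g) x) 2 volume :=
  memLp_conj_mul_left (essBdd_incl u)

theorem memLp_conj_incl_mul (b : Hardy g) (u : Sobolev g) :
    MemLp (fun x => conj ((incl u : L2 g) x) * (b : L2 g) x) 2 volume :=
  memLp_conj_mul_right (essBdd_incl u)

theorem toep_add_left {b c f : L2 g} (hb : MemLp (fun x => conj (b x) * f x) 2 volume)
    (hc : MemLp (fun x => conj (c x) * f x) 2 volume) :
    toep (b + c) f = toep b f + toep c f := by
  rw [toep_eq (coeFn_toL2 hb), toep_eq (coeFn_toL2 hc), ← map_add]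
  refine toep_eq ?_
  filter_upwards [Lp.coeFn_add (toL2 g fun x => conj (b x) * f x)
    (toL2 g fun x => conj (c x) * f x), coeFn_toL2 hb, coeFn_toL2 hc, Lp.coeFn_add b c]
    with x h1 h2 h3 h4
  rw [h1, Pi.add_apply, h2, h3, h4, Pi.add_apply, map_add]; ring

theorem toep_add_right {b f h : L2 g} (hf : MemLp (fun x => conj (b x) * f x) 2 volume)
    (hh : MemLp (fun x => conj (b x) * h x) 2 volume) :
    toep b (f + h) = toep b f + toep b h := by
  rw [toep_eq (coeFn_toL2 hf), toep_eq (coeFn_toL2 hh), ← map_add]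
  refine toep_eq ?_
  filter_upwards [Lp.coeFn_add (toL2 g fun x => conj (b x) * f x)
    (toL2 g fun x => conj (b x) * h x), coeFn_toL2 hf, coeFn_toL2 hh, Lp.coeFn_add f h]
    with x h1 h2 h3 h4
  rw [h1, Pi.add_apply, h2, h3, h4, Pi.add_apply]; ring

theorem toep_smul_left {b f : L2 g} (c : ℂ)
    (hb : MemLp (fun x => conj (b x) * f x) 2 volume) :
    toep (c • b) f = conj c • toep b f := by
  rw [toep_eq (coeFn_toL2 hb), ← map_smul]
  refine toep_eq ?_
  filter_upwards [Lp.coeFn_smul (conj c) (toL2 g fun x => conj (b x) * f x), coeFn_toL2 hb,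
    Lp.coeFn_smul c b] with x h1 h2 h3
  rw [h1, Pi.smul_apply, h2, h3, Pi.smul_apply, smul_eq_mul, smul_eq_mul, map_mul]; ring

theorem toep_smul_right {b f : L2 g} (c : ℂ)
    (hb : MemLp (fun x => conj (b x) * f x) 2 volume) :
    toep b (c • f) = c • toep b f := by
  rw [toep_eq (coeFn_toL2 hb), ← map_smul]
  refine toep_eq ?_
  filter_upwards [Lp.coeFn_smul c (toL2 g fun x => conj (b x) * f x), coeFn_toL2 hb,
    Lp.coeFn_smul c f] with x h1 h2 h3
  rw [h1, Pi.smul_apply, h2, h3, Pi.smul_apply, smul_eq_mul, smul_eq_mul]; ring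

theorem hmul_eq {a b F : Hardy g} (h : (F : L2 g) =ᵐ[volume] fun x => (a : L2 g) x * (b : L2 g) x) :
    hmul a b = F := by
  rw [hmul, toL2_eq h]
  exact Subtype.ext (szego_of_mem F.2)

theorem hmul_add_left {a b c : Hardy g} (hc : EssBdd ((c : L2 g) : g.Space → ℂ)) :
    hmul (a + b) c = hmul a c + hmul b c := by
  refine hmul_eq ?_
  filter_upwards [Lp.coeFn_add (hmul a c : L2 g) (hmul b c : L2 g), coeFn_hmul_right (a := a) hc,
    coeFn_hmul_right (a := b) hc, Lp.coeFn_add (a : L2 g) (b : L2 g)] with x h1 h2 h3 h4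
  rw [Submodule.coe_add, Submodule.coe_add, h1, Pi.add_apply, h2, h3, h4, Pi.add_apply]; ring

theorem hmul_smul_left {a c : Hardy g} (t : ℂ) (hc : EssBdd ((c : L2 g) : g.Space → ℂ)) :
    hmul (t • a) c = t • hmul a c := by
  refine hmul_eq ?_
  filter_upwards [Lp.coeFn_smul t (hmul a c : L2 g), coeFn_hmul_right (a := a) hc,
    Lp.coeFn_smul t (a : L2 g)] with x h1 h2 h3
  rw [Submodule.coe_smul, Submodule.coe_smul, h1, Pi.smul_apply, h2, h3, Pi.smul_apply,
    smul_eq_mul, smul_eq_mul]; ring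

theorem hmul_add_right {a b c : Hardy g} (hb : EssBdd ((b : L2 g) : g.Space → ℂ))
    (hc : EssBdd ((c : L2 g) : g.Space → ℂ)) : hmul a (b + c) = hmul a b + hmul a c := by
  refine hmul_eq ?_
  filter_upwards [Lp.coeFn_add (hmul a b : L2 g) (hmul a c : L2 g), coeFn_hmul_right (a := a) hb,
    coeFn_hmul_right (a := a) hc, Lp.coeFn_add (b : L2 g) (c : L2 g)] with x h1 h2 h3 h4
  rw [Submodule.coe_add, Submodule.coe_add, h1, Pi.add_apply, h2, h3, h4, Pi.add_apply]; ring

theorem hmul_smul_right {a c : Hardy g} (t : ℂ) (hc : EssBdd ((c : L2 g) : g.Space → ℂ)) :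
    hmul a (t • c) = t • hmul a c := by
  refine hmul_eq ?_
  filter_upwards [Lp.coeFn_smul t (hmul a c : L2 g), coeFn_hmul_right (a := a) hc,
    Lp.coeFn_smul t (c : L2 g)] with x h1 h2 h3
  rw [Submodule.coe_smul, Submodule.coe_smul, h1, Pi.smul_apply, h2, h3, Pi.smul_apply,
    smul_eq_mul, smul_eq_mul]; ring

theorem hmul_comm (a b : Hardy g) : hmul a b = hmul b a := by
  simp only [hmul, mul_comm]

theorem norm_hmul_le {a b : Hardy g} {C : ℝ} (h : ∀ᵐ x : g.Space, ‖(b : L2 g) x‖ ≤ C) :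
    ‖hmul a b‖ ≤ C * ‖a‖ := by
  refine Lp.norm_le_mul_norm_of_ae_le_mul (f := (hmul a b : L2 g)) (g := (a : L2 g)) ?_
  filter_upwards [h, coeFn_hmul_right (a := a) ⟨C, h⟩] with x h1 h2
  rw [h2, norm_mul, mul_comm]
  exact mul_le_mul_of_nonneg_right h1 (norm_nonneg _)

/-- The constant in the uniform bound of `C₊(b̄ u)`. -/
def cubicConst (g : Geometry) : ℝ := 2 * (exists_norm_toep_le g).choose

theorem cubicConst_nonneg (g : Geometry) : 0 ≤ cubicConst g :=
  mul_nonneg zero_le_two (exists_norm_toep_le g).choose_spec.1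

theorem norm_toep_incl_le (b : Hardy g) (u : Sobolev g) :
    ∀ᵐ x : g.Space, ‖(toep (g := g) b (incl u) : L2 g) x‖ ≤ cubicConst g * (‖b‖ * ‖u‖) := by
  have h := (exists_norm_toep_le g).choose_spec
  filter_upwards [h.2 b (incl u) (mom u) (isMomentum_mom u)] with x hx
  refine hx.trans ?_
  rw [cubicConst, mul_comm (2 : ℝ), mul_assoc]
  refine mul_le_mul_of_nonneg_left ?_ h.1
  have h1 := norm_incl_le u
  have h2 : ‖(mom u : L2 g)‖ ≤ ‖u‖ := norm_mom_le u
  have h3 := norm_nonneg b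
  nlinarith

theorem essBdd_toep (b : Hardy g) (u : Sobolev g) :
    EssBdd ((toep (g := g) b (incl u) : L2 g) : g.Space → ℂ) := ⟨_, norm_toep_incl_le b u⟩

/-- The operator `u ↦ a C₊(b̄ u)` from `H¹₊` to the Hardy space. -/
def cubic (a b : Hardy g) : Sobolev g →L[ℂ] Hardy g :=
  LinearMap.mkContinuous
    { toFun := fun u => hmul a (toep (g := g) b (incl u))
      map_add' := fun u v => by
        rw [map_add, Submodule.coe_add, toep_add_right (memLp_conj_mul_incl b u)
          (memLp_conj_mul_incl b v), hmul_add_right (essBdd_toep b u) (essBdd_toep b v)]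
      map_smul' := fun c u => by
        rw [map_smul, Submodule.coe_smul, toep_smul_right c (memLp_conj_mul_incl b u),
          hmul_smul_right c (essBdd_toep b u), RingHom.id_apply] }
    (cubicConst g * (‖a‖ * ‖b‖)) fun u => by
      refine (norm_hmul_le (norm_toep_incl_le b u)).trans_eq ?_
      rw [mul_assoc, mul_right_comm, mul_comm ‖b‖, ← mul_assoc]

theorem cubic_apply (a b : Hardy g) (u : Sobolev g) :
    cubic a b u = hmul a (toep (g := g) b (incl u)) := rfl

theorem norm_cubic_le (a b : Hardy g) : ‖cubic a b‖ ≤ cubicConst g * (‖a‖ * ‖b‖) :=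
  LinearMap.mkContinuous_norm_le _
    (mul_nonneg (cubicConst_nonneg g) (mul_nonneg (norm_nonneg _) (norm_nonneg _))) _

theorem coeFn_cubic (a b : Hardy g) (u : Sobolev g) : (cubic a b u : L2 g) =ᵐ[volume]
    fun x => (a : L2 g) x * (toep (g := g) b (incl u) : L2 g) x :=
  coeFn_hmul_right (essBdd_toep b u)

theorem cubic_add_left (a b c : Hardy g) : cubic (a + b) c = cubic a c + cubic b c :=
  ContinuousLinearMap.ext fun u => hmul_add_left (essBdd_toep c u)

theorem cubic_smul_left (t : ℂ) (a b : Hardy g) : cubic (t • a) b = t • cubic a b :=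
  ContinuousLinearMap.ext fun u => hmul_smul_left t (essBdd_toep b u)

theorem cubic_add_right (a b c : Hardy g) : cubic a (b + c) = cubic a b + cubic a c := by
  refine ContinuousLinearMap.ext fun u => ?_
  rw [add_apply, cubic_apply, cubic_apply, cubic_apply, Submodule.coe_add,
    toep_add_left (memLp_conj_mul_incl b u) (memLp_conj_mul_incl c u),
    hmul_add_right (essBdd_toep b u) (essBdd_toep c u)]

theorem cubic_smul_right (t : ℂ) (a b : Hardy g) : cubic a (t • b) = conj t • cubic a b := by
  refine ContinuousLinearMap.ext fun u => ?_
  rw [smul_apply, cubic_apply, cubic_apply, Submodule.coe_smul,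
    toep_smul_left t (memLp_conj_mul_incl b u), hmul_smul_right _ (essBdd_toep b u)]

theorem inner_cubic (a b : Hardy g) (u v : Sobolev g) :
    ⟪incl v, cubic a b u⟫_ℂ = ⟪toep (g := g) a (incl v), toep (g := g) b (incl u)⟫_ℂ :=
  (inner_toep_eq (memLp_conj_mul_incl a v) (coeFn_cubic a b u)).symm

/-! ### The Lax operator -/

/-- The Lax operator, as a bounded operator from `H¹₊` to the Hardy space. -/
def laxL (s : Interaction) (q : Hardy g) : Sobolev g →L[ℂ] Hardy g :=
  mom - (s.sign : ℂ) • cubic q q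

theorem laxL_apply (s : Interaction) (q : Hardy g) (u : Sobolev g) :
    laxL s q u = mom u - (s.sign : ℂ) • cubic q q u := rfl

/-- The graph of the Lax operator is that of `laxL` on `H¹₊`. -/
theorem isLax_iff {s : Interaction} {q f h : Hardy g} :
    IsLax s q f h ↔ ∃ u : Sobolev g, incl u = f ∧ laxL s q u = h := by
  have key : ∀ u : Sobolev g, (laxL s q u : L2 g) =ᵐ[volume] fun x => (mom u : L2 g) x -
      s.sign * ((q : L2 g) x * (toep (g := g) q (incl u) : L2 g) x) := by
    intro u
    filter_upwards [Lp.coeFn_sub (mom u : L2 g) ((s.sign : ℂ) • cubic q q u : Hardy g),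
      Lp.coeFn_smul (s.sign : ℂ) (cubic q q u : L2 g), coeFn_cubic q q u] with x h1 h2 h3
    rw [laxL_apply, Submodule.coe_sub, h1, Pi.sub_apply, Submodule.coe_smul, h2, Pi.smul_apply, h3,
      smul_eq_mul]
  constructor
  · rintro ⟨p, hp, hh⟩
    obtain ⟨u, rfl, rfl⟩ := exists_sobolev hp
    exact ⟨u, rfl, Subtype.ext (Lp.ext ((key u).trans (EventuallyEq.symm hh)))⟩
  · rintro ⟨u, rfl, rfl⟩
    exact ⟨mom u, isMomentum_mom u, key u⟩

theorem isLax_incl (s : Interaction) (q : Hardy g) (u : Sobolev g) :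
    IsLax s q (incl u) (laxL s q u) := isLax_iff.2 ⟨u, rfl, rfl⟩

theorem IsLax.unique {s : Interaction} {q f h k : Hardy g} (h1 : IsLax s q f h)
    (h2 : IsLax s q f k) : h = k := by
  obtain ⟨u, rfl, rfl⟩ := isLax_iff.1 h1
  obtain ⟨v, hv, rfl⟩ := isLax_iff.1 h2
  rw [incl_injective hv]

theorem lax_incl (s : Interaction) (q : Hardy g) (u : Sobolev g) :
    lax s q (incl u) = laxL s q u := by
  have h : ∃ k, IsLax s q (incl u) k := ⟨_, isLax_incl s q u⟩
  rw [lax, dif_pos h]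
  exact h.choose_spec.unique (isLax_incl s q u)

theorem Hardy.inner_smul_right (c : ℂ) (f h : Hardy g) : ⟪f, c • h⟫_ℂ = c * ⟪f, h⟫_ℂ :=
  _root_.inner_smul_right f h c

theorem Hardy.inner_smul_left (c : ℂ) (f h : Hardy g) : ⟪c • f, h⟫_ℂ = conj c * ⟪f, h⟫_ℂ :=
  _root_.inner_smul_left f h c

theorem Hardy.inner_conj_symm (f h : Hardy g) : conj ⟪f, h⟫_ℂ = ⟪h, f⟫_ℂ :=
  _root_.inner_conj_symm h f

/-- The Lax operator is symmetric. -/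
theorem inner_laxL (s : Interaction) (q : Hardy g) (u v : Sobolev g) :
    ⟪incl u, laxL s q v⟫_ℂ = ⟪laxL s q u, incl v⟫_ℂ := by
  rw [laxL_apply, laxL_apply, inner_sub_right, inner_sub_left, inner_mom, Hardy.inner_smul_right,
    Hardy.inner_smul_left, Complex.conj_ofReal, inner_cubic,
    ← Hardy.inner_conj_symm _ (cubic q q u), inner_cubic, Hardy.inner_conj_symm]

/-! ### Invertibility of the Lax operator -/

/-- A relatively small perturbation of a bijective bounded operator is bijective. -/
theorem bijective_sub_of_norm_le {E F : Type*} [NormedAddCommGroup E] [NormedSpace ℂ E]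
    [CompleteSpace E] [NormedAddCommGroup F] [NormedSpace ℂ F] [CompleteSpace F]
    {A B : E →L[ℂ] F} (hA : Function.Bijective A) {θ : ℝ} (h0 : 0 ≤ θ) (h1 : θ < 1)
    (h : ∀ u, ‖B u‖ ≤ θ * ‖A u‖) : Function.Bijective (A - B) := by
  set e := ContinuousLinearEquiv.ofBijective A (LinearMap.ker_eq_bot.2 hA.1)
    (LinearMap.range_eq_top.2 hA.2) with he
  have heA : ∀ u, e u = A u := fun u => rfl
  set N : F →L[ℂ] F := B.comp (e.symm : F →L[ℂ] E) with hN
  have hNn : ‖N‖ < 1 := by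
    refine lt_of_le_of_lt (ContinuousLinearMap.opNorm_le_bound _ h0 fun f => ?_) h1
    refine (h (e.symm f)).trans_eq ?_
    rw [← heA, e.apply_symm_apply]
  have hu : Function.Bijective (1 - N : F →L[ℂ] F) := by
    obtain ⟨U, hU⟩ := isUnit_one_sub_of_norm_lt_one hNn
    rw [← hU]
    exact (ContinuousLinearEquiv.unitsEquiv ℂ F U).bijective
  have hc : ⇑(A - B) = ⇑(1 - N : F →L[ℂ] F) ∘ A := by
    funext u
    have : N (A u) = B u := by
      rw [hN, ContinuousLinearMap.comp_apply, ← heA]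
      exact congrArg B (e.symm_apply_apply u)
    rw [Function.comp_apply, sub_apply, sub_apply, this]
    rfl
  rw [hc]
  exact hu.comp hA

theorem norm_sq_eq_re_inner (f : Hardy g) : (⟪f, f⟫_ℂ).re = ‖f‖ ^ 2 := by
  have h : ⟪f, f⟫_ℂ = ((‖f‖ : ℝ) : ℂ) ^ 2 := inner_self_eq_norm_sq_to_K f
  rw [h, ← Complex.ofReal_pow, Complex.ofReal_re]

/-- An operator with `⟪u, A u⟫ ≥ c ‖u‖²` is bounded below by `c`. -/
theorem norm_le_of_re_inner {f h : Hardy g} {c : ℝ} (hc : c * ‖f‖ ^ 2 ≤ (⟪f, h⟫_ℂ).re) :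
    c * ‖f‖ ≤ ‖h‖ := by
  rcases (norm_nonneg f).eq_or_lt with h0 | h0
  · rw [← h0, mul_zero]; exact norm_nonneg h
  · have h1 : (⟪f, h⟫_ℂ).re ≤ ‖f‖ * ‖h‖ := (Complex.re_le_norm _).trans (norm_inner_le_norm f h)
    have h2 : (c * ‖f‖) * ‖f‖ ≤ ‖h‖ * ‖f‖ := by nlinarith
    exact le_of_mul_le_mul_right h2 h0

/-- The operator `-i ∂ₓ + κ`. -/
def freeL (κ : ℝ) : Sobolev g →L[ℂ] Hardy g := mom + (κ : ℂ) • incl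

theorem freeL_apply (κ : ℝ) (u : Sobolev g) : freeL κ u = mom u + (κ : ℂ) • incl u := rfl

theorem norm_incl_le_freeL (κ : ℝ) (u : Sobolev g) : κ * ‖incl u‖ ≤ ‖freeL κ u‖ := by
  refine norm_le_of_re_inner ?_
  rw [freeL_apply, inner_add_right, Hardy.inner_smul_right, Complex.add_re, Complex.re_ofReal_mul,
    norm_sq_eq_re_inner]
  linarith [re_inner_mom_nonneg u]

theorem norm_mom_le_freeL {κ : ℝ} (hκ : 0 ≤ κ) (u : Sobolev g) : ‖mom u‖ ≤ ‖freeL κ u‖ := by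
  have h1 : (⟪mom u, incl u⟫_ℂ).re = (⟪incl u, mom u⟫_ℂ).re := by rw [inner_mom]
  have h2 : ‖freeL κ u‖ ^ 2 = ‖mom u‖ ^ 2 + 2 * κ * (⟪incl u, mom u⟫_ℂ).re
      + κ ^ 2 * ‖incl u‖ ^ 2 := by
    rw [← norm_sq_eq_re_inner, ← norm_sq_eq_re_inner, ← norm_sq_eq_re_inner, freeL_apply]
    simp only [inner_add_left, inner_add_right, Hardy.inner_smul_left, Hardy.inner_smul_right,
      Complex.conj_ofReal, Complex.add_re, Complex.re_ofReal_mul, h1]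
    ring
  have h3 := mul_nonneg (mul_nonneg zero_le_two hκ) (re_inner_mom_nonneg u)
  have h4 : 0 ≤ κ ^ 2 * ‖incl u‖ ^ 2 := by positivity
  exact (sq_le_sq₀ (norm_nonneg _) (norm_nonneg _)).1 (by linarith)

theorem freeL_bijective {κ : ℝ} (hκ : 0 < κ) : Function.Bijective (freeL (g := g) κ) := by
  refine ⟨fun u v huv => ?_, fun h => ?_⟩
  · have h1 := norm_incl_le_freeL κ (u - v)
    rw [map_sub (incl (g := g)), map_sub (freeL κ), huv, sub_self, norm_zero] at h1
    have h2 : ‖incl u - incl v‖ ≤ 0 := nonpos_of_mul_nonpos_right h1 hκ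
    exact incl_injective (sub_eq_zero.1 (norm_le_zero_iff.1 h2))
  · obtain ⟨u, hu⟩ := exists_isMomentum_sub hκ h
    obtain ⟨v, hv, hv'⟩ := exists_sobolev hu
    refine ⟨v, ?_⟩
    rw [freeL_apply, hv, Subtype.ext hv']
    abel

/-- A vector orthogonal to `H¹₊` vanishes. -/
theorem eq_zero_of_inner_incl {f : Hardy g} (h : ∀ u : Sobolev g, ⟪incl u, f⟫_ℂ = 0) : f = 0 := by
  obtain ⟨u, rfl⟩ := (freeL_bijective zero_lt_one).2 f
  have h1 := congrArg Complex.re (h u)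
  rw [freeL_apply, inner_add_right, Hardy.inner_smul_right, Complex.add_re, Complex.re_ofReal_mul,
    norm_sq_eq_re_inner, Complex.zero_re] at h1
  have h3 := re_inner_mom_nonneg u
  have h4 : ‖incl u‖ ^ 2 = 0 := le_antisymm (by linarith) (sq_nonneg _)
  have h5 : u = 0 := incl_injective
    ((norm_eq_zero.1 (pow_eq_zero_iff two_ne_zero |>.1 h4)).trans (map_zero (incl (g := g))).symm)
  rw [h5, map_zero]

theorem denseRange_incl : DenseRange (incl (g := g)) := by
  have h : (LinearMap.range (incl (g := g)).toLinearMap).topologicalClosure = ⊤ := by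
    rw [Submodule.topologicalClosure_eq_top_iff, Submodule.eq_bot_iff]
    intro f hf
    refine eq_zero_of_inner_incl fun u => ?_
    exact hf (incl u) (LinearMap.mem_range_self (incl (g := g)).toLinearMap u)
  intro f
  have h2 : f ∈ (LinearMap.range (incl (g := g)).toLinearMap).topologicalClosure := by
    rw [h]; trivial
  exact h2

theorem mass_eq (q : Hardy g) : mass q = ‖q‖ ^ 2 := by
  rw [mass, ← norm_sq_eq_re_inner, Submodule.coe_inner, inner_eq_integral]
  have h : ∀ x, conj ((q : L2 g) x) * (q : L2 g) x = ((‖(q : L2 g) x‖ ^ 2 : ℝ) : ℂ) := fun x => by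
    rw [Complex.conj_mul']; push_cast; rfl
  simp only [h]
  rw [integral_complex_ofReal, Complex.ofReal_re]

/-- The sharp Toeplitz bound on `H¹₊`. -/
theorem norm_toep_incl_sq_le (q : Hardy g) (u : Sobolev g) : ‖toep (g := g) q (incl u)‖ ^ 2 ≤
    ‖q‖ ^ 2 / (2 * π) * ((⟪incl u, mom u⟫_ℂ).re + ‖incl u‖ ^ 2) :=
  norm_toep_sq_le q (incl u) (mom u) (isMomentum_mom u)

/-- Below the critical mass, the kinetic energy controls the interaction. -/
theorem exists_coercive {s : Interaction} {q : Hardy g} (hq : q ∈ massBall g s.criticalMass) :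
    ∃ c : ℝ, 0 < c ∧ ∀ u : Sobolev g,
      c * ‖incl u‖ ^ 2 ≤ (⟪incl u, laxL s q u⟫_ℂ).re + ‖incl u‖ ^ 2 := by
  have key : ∀ u : Sobolev g, (⟪incl u, laxL s q u⟫_ℂ).re =
      (⟪incl u, mom u⟫_ℂ).re - s.sign * ‖toep (g := g) q (incl u)‖ ^ 2 := fun u => by
    rw [laxL_apply, inner_sub_right, Hardy.inner_smul_right, inner_cubic, Complex.sub_re,
      Complex.re_ofReal_mul, norm_sq_eq_re_inner]
  cases s with
  | focusing =>
    have hm : ‖q‖ ^ 2 < 2 * π := by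
      rw [← mass_eq]; exact EReal.coe_lt_coe_iff.1 hq
    refine ⟨1 - ‖q‖ ^ 2 / (2 * π), sub_pos.2 ((div_lt_one Real.two_pi_pos).2 hm), fun u => ?_⟩
    rw [key]
    have h1 := norm_toep_incl_sq_le q u
    have h2 := re_inner_mom_nonneg u
    have h3 : ‖q‖ ^ 2 / (2 * π) ≤ 1 := ((div_lt_one Real.two_pi_pos).2 hm).le
    simp only [Interaction.sign]
    nlinarith [mul_nonneg (sub_nonneg.2 h3) h2]
  | defocusing =>
    refine ⟨1, zero_lt_one, fun u => ?_⟩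
    rw [key]
    have h2 := re_inner_mom_nonneg u
    simp only [Interaction.sign]
    nlinarith [sq_nonneg ‖toep (g := g) q (incl u)‖]

theorem norm_incl_le_div {κ : ℝ} (hκ : 1 ≤ κ) (u : Sobolev g) :
    ‖incl u‖ ≤ ‖freeL κ u‖ / κ := by
  rw [le_div_iff₀ (by linarith), mul_comm]; exact norm_incl_le_freeL κ u

theorem norm_sobolev_le_freeL {κ : ℝ} (hκ : 1 ≤ κ) (u : Sobolev g) : ‖u‖ ≤ ‖freeL κ u‖ :=
  norm_sobolev_le ((norm_incl_le_div hκ u).trans (div_le_self (norm_nonneg _) hκ))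
    (norm_mom_le_freeL (by linarith) u)

theorem norm_toep_sq_le_freeL {κ : ℝ} (hκ : 1 ≤ κ) (q : Hardy g) (u : Sobolev g) :
    ‖toep (g := g) q (incl u)‖ ^ 2 ≤ ‖q‖ ^ 2 * (‖freeL κ u‖ ^ 2 / κ) := by
  refine (norm_toep_incl_sq_le q u).trans ?_
  have h1 := norm_incl_le_div hκ u
  have h2 := norm_mom_le_freeL (by linarith : 0 ≤ κ) u
  have h8 : (⟪incl u, mom u⟫_ℂ).re ≤ ‖incl u‖ * ‖mom u‖ :=
    (Complex.re_le_norm _).trans (norm_inner_le_norm _ _)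
  have h0 := norm_nonneg (incl u)
  have h0' := norm_nonneg (mom u)
  generalize ‖freeL κ u‖ = F at *
  generalize ‖incl u‖ = a at *
  generalize ‖mom u‖ = b at *
  generalize (⟪incl u, mom u⟫_ℂ).re = t at *
  generalize ‖q‖ = r at *
  have hF : 0 ≤ F := h0'.trans h2
  have hFκ : F / κ ≤ F := div_le_self hF hκ
  have h3 : t + a ^ 2 ≤ 2 * (F ^ 2 / κ) := by
    have e1 : a * b ≤ F / κ * F := mul_le_mul h1 h2 h0' (h0.trans h1)
    have e2 : a * a ≤ F / κ * F := mul_le_mul h1 (h1.trans hFκ) h0 (h0.trans h1)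
    have e3 : F / κ * F = F ^ 2 / κ := by ring
    rw [e3] at e1 e2
    nlinarith
  have h4 : 0 ≤ r ^ 2 * (F ^ 2 / κ) := by positivity
  have h5 : r ^ 2 / (2 * π) * (2 * (F ^ 2 / κ)) = r ^ 2 * (F ^ 2 / κ) / π := by
    field_simp
  refine (mul_le_mul_of_nonneg_left h3 (by positivity)).trans ?_
  rw [h5]
  exact div_le_self h4 (by linarith [Real.pi_gt_three])

theorem norm_hmul_toep_le {κ B : ℝ} (hκ : 1 ≤ κ) (q v : Hardy g) (u : Sobolev g)
    (hB : ∀ᵐ x : g.Space, ‖(v : L2 g) x‖ ≤ B) (hBκ : 16 * (B * ‖q‖) ^ 2 ≤ κ) :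
    ‖hmul (toep (g := g) q (incl u)) v‖ ≤ 1 / 4 * ‖freeL κ u‖ := by
  refine (norm_hmul_le hB).trans ?_
  have h7 := norm_toep_sq_le_freeL hκ q u
  have hF := norm_nonneg (freeL κ u)
  generalize ‖freeL κ u‖ = F at *
  generalize ‖q‖ = r at *
  generalize ‖toep (g := g) q (incl u)‖ = a at *
  refine abs_le_of_sq_le_sq' ?_ (by positivity) |>.2
  have h8 : (B * r) ^ 2 * (F ^ 2 / κ) ≤ F ^ 2 / 16 := by
    rw [mul_div_assoc', div_le_div_iff₀ (by linarith) (by norm_num)]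
    nlinarith [sq_nonneg F]
  calc (B * a) ^ 2 = B ^ 2 * a ^ 2 := by ring
    _ ≤ B ^ 2 * (r ^ 2 * (F ^ 2 / κ)) := by gcongr
    _ = (B * r) ^ 2 * (F ^ 2 / κ) := by ring
    _ ≤ F ^ 2 / 16 := h8
    _ = (1 / 4 * F) ^ 2 := by ring

theorem norm_cubic_le_freeL {κ : ℝ} (hκ : 1 ≤ κ) (a q : Hardy g) (u : Sobolev g)
    (h : cubicConst g * (‖a‖ * ‖q‖) ≤ 1 / 4) : ‖cubic a q u‖ ≤ 1 / 4 * ‖freeL κ u‖ :=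
  ((cubic a q).le_of_opNorm_le ((norm_cubic_le _ _).trans h) u).trans
    (mul_le_mul_of_nonneg_left (norm_sobolev_le_freeL hκ u) (by norm_num))

/-- The cubic term is a small perturbation of `-i ∂ₓ + κ` when `κ` is large: this is clear for
a bounded symbol, by the bound of the quadratic form, and `H¹₊` is dense. -/
theorem exists_norm_cubic_le (q : Hardy g) : ∃ κ₀ : ℝ, ∀ κ, κ₀ ≤ κ → ∀ u : Sobolev g,
    ‖cubic q q u‖ ≤ 1 / 2 * ‖freeL κ u‖ := by
  have hK := cubicConst_nonneg g
  have hε0 : 0 < (4 * (cubicConst g * ‖q‖ + 1))⁻¹ := by positivity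
  obtain ⟨v, hv⟩ := Metric.denseRange_iff.1 denseRange_incl q _ hε0
  rw [dist_eq_norm] at hv
  obtain ⟨B, hB⟩ := essBdd_incl v
  have hB' : ∀ᵐ x : g.Space, ‖(incl v : L2 g) x‖ ≤ max B 0 :=
    hB.mono fun x h => h.trans (le_max_left _ _)
  refine ⟨16 * (max B 0 * ‖q‖) ^ 2 + 1, fun κ hκ u => ?_⟩
  have h0 : 0 ≤ (max B 0 * ‖q‖) ^ 2 := sq_nonneg _
  have hκ1 : 1 ≤ κ := by linarith
  have h4 : cubic q q u = cubic (q - incl v) q u + hmul (toep (g := g) q (incl u)) (incl v) := by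
    rw [hmul_comm, ← cubic_apply, ← add_apply, ← cubic_add_left, sub_add_cancel]
  have h5 : cubicConst g * (‖q - incl v‖ * ‖q‖) ≤ 1 / 4 := by
    have hq := norm_nonneg q
    generalize ‖q - incl v‖ = d at *
    generalize ‖q‖ = r at *
    generalize cubicConst g = K at *
    have h7 : K * (d * r) ≤ K * r * (4 * (K * r + 1))⁻¹ := by
      have := mul_le_mul_of_nonneg_left hv.le (mul_nonneg hK hq)
      linarith
    refine h7.trans ?_
    rw [← div_eq_mul_inv, div_le_div_iff₀ (by positivity) (by norm_num)]
    linarith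
  rw [h4]
  refine (norm_add_le _ _).trans ?_
  have h6 := norm_cubic_le_freeL hκ1 (q - incl v) q u h5
  have h7 := norm_hmul_toep_le hκ1 q (incl v) u hB' (by linarith)
  linarith

theorem Interaction.abs_sign (s : Interaction) : |s.sign| = 1 := by
  cases s <;> simp [Interaction.sign]

/-- The operator `L_q + κ`. -/
def shiftL (s : Interaction) (q : Hardy g) (κ : ℝ) : Sobolev g →L[ℂ] Hardy g :=
  laxL s q + (κ : ℂ) • incl

theorem shiftL_apply (s : Interaction) (q : Hardy g) (κ : ℝ) (u : Sobolev g) :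
    shiftL s q κ u = laxL s q u + (κ : ℂ) • incl u := rfl

/-- The operator `L_q + κ` is invertible: for large `κ` by the smallness of the cubic term, and
then down to `κ = 1` because `L_q + 1` is bounded below by a positive constant. -/
theorem shiftL_bijective {s : Interaction} {q : Hardy g} (hq : q ∈ massBall g s.criticalMass)
    {κ : ℝ} (hκ : 1 ≤ κ) : Function.Bijective (shiftL s q κ) := by
  obtain ⟨c, hc, hcoer⟩ := exists_coercive hq
  obtain ⟨κ₀, h0⟩ := exists_norm_cubic_le q
  set κ₁ := max κ₀ κ with hκ₁
  have hκκ : κ ≤ κ₁ := le_max_right _ _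
  have h1 : Function.Bijective (shiftL s q κ₁) := by
    have h2 : shiftL s q κ₁ = freeL κ₁ - (s.sign : ℂ) • cubic q q := by
      rw [shiftL, laxL, freeL]; abel
    rw [h2]
    refine bijective_sub_of_norm_le (θ := 1 / 2) (freeL_bijective (by linarith)) (by norm_num)
      (by norm_num) fun u => ?_
    have h3 : ‖((s.sign : ℂ) • cubic q q) u‖ = ‖cubic q q u‖ := by
      rw [smul_apply, norm_smul, Complex.norm_real, Real.norm_eq_abs, s.abs_sign, one_mul]
    rw [h3]
    exact h0 κ₁ (le_max_left _ _) u
  have h2 : shiftL s q κ = shiftL s q κ₁ - ((κ₁ - κ : ℝ) : ℂ) • incl := by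
    refine ContinuousLinearMap.ext fun u => ?_
    rw [sub_apply, smul_apply, shiftL_apply, shiftL_apply, Complex.ofReal_sub,
      sub_smul (κ₁ : ℂ) (κ : ℂ) (incl u)]
    abel
  rw [h2]
  have hd : 0 < c + κ₁ - 1 := by linarith
  refine bijective_sub_of_norm_le (θ := (κ₁ - κ) / (c + κ₁ - 1)) h1
    (div_nonneg (by linarith) hd.le) ((div_lt_one hd).2 (by linarith)) fun u => ?_
  have h3 : (c + κ₁ - 1) * ‖incl u‖ ≤ ‖shiftL s q κ₁ u‖ := by
    refine norm_le_of_re_inner ?_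
    rw [shiftL_apply, inner_add_right, Hardy.inner_smul_right, Complex.add_re,
      Complex.re_ofReal_mul, norm_sq_eq_re_inner]
    linarith [hcoer u]
  rw [smul_apply, norm_smul, Complex.norm_real, Real.norm_eq_abs,
    abs_of_nonneg (sub_nonneg.2 hκκ), div_mul_eq_mul_div, le_div_iff₀ hd, mul_assoc,
    mul_comm ‖incl u‖]
  exact mul_le_mul_of_nonneg_left h3 (sub_nonneg.2 hκκ)

theorem isLax_sub_iff {s : Interaction} {q f m : Hardy g} {κ : ℝ} :
    IsLax s q m (f - (κ : ℂ) • m) ↔ ∃ u : Sobolev g, incl u = m ∧ shiftL s q κ u = f := by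
  rw [isLax_iff]
  refine exists_congr fun u => and_congr_right fun h => ?_
  rw [shiftL_apply, h, eq_sub_iff_add_eq]

theorem existsUnique_isLax {s : Interaction} {q : Hardy g} {κ : ℝ}
    (h : Function.Bijective (shiftL s q κ)) (f : Hardy g) :
    ∃! m : Hardy g, IsLax s q m (f - (κ : ℂ) • m) := by
  obtain ⟨u, hu⟩ := h.2 f
  refine ⟨incl u, isLax_sub_iff.2 ⟨u, rfl, hu⟩, fun m hm => ?_⟩
  obtain ⟨v, rfl, hv⟩ := isLax_sub_iff.1 hm
  rw [h.1 (hv.trans hu.symm)]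

theorem resolventVector_eq {s : Interaction} {q : Hardy g} {κ : ℝ}
    (h : Function.Bijective (shiftL s q κ)) {u : Sobolev g} (hu : shiftL s q κ u = q) :
    resolventVector s κ q = incl u := by
  have h1 := existsUnique_isLax h q
  rw [resolventVector, dif_pos h1.exists]
  exact h1.unique h1.exists.choose_spec (isLax_sub_iff.2 ⟨u, rfl, hu⟩)

/-! ### Derivatives of the observables -/

/-- The first variation of the cubic term `q C₊(q̄ ·)` in the direction `f`, with its quadratic
correction for a step of length `ε`. -/
def variation (q f : Hardy g) (ε : ℝ) : Sobolev g →L[ℂ] Hardy g :=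
  cubic f q + cubic q f + (ε : ℂ) • cubic f f

theorem continuous_variation (q f : Hardy g) : Continuous (variation q f) :=
  continuous_const.add (Complex.continuous_ofReal.smul continuous_const)

theorem cubic_perturb (q f : Hardy g) (ε : ℝ) :
    cubic (q + (ε : ℂ) • f) (q + (ε : ℂ) • f) = cubic q q + (ε : ℂ) • variation q f ε := by
  rw [cubic_add_left, cubic_add_right, cubic_add_right, cubic_smul_left, cubic_smul_left,
    cubic_smul_right, cubic_smul_right, Complex.conj_ofReal, variation]
  refine ContinuousLinearMap.ext fun u => ?_
  simp only [add_apply, smul_apply, smul_add]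
  abel

theorem laxL_perturb (s : Interaction) (q f : Hardy g) (ε : ℝ) :
    laxL s (q + (ε : ℂ) • f) = laxL s q - ((s.sign * ε : ℝ) : ℂ) • variation q f ε := by
  rw [laxL, laxL, cubic_perturb, smul_add, smul_smul, Complex.ofReal_mul]
  abel

theorem inner_laxL_perturb (s : Interaction) (q f : Hardy g) (ε : ℝ) (u v : Sobolev g) :
    ⟪incl u, laxL s (q + (ε : ℂ) • f) v⟫_ℂ = ⟪laxL s q u, incl v⟫_ℂ -
      ((s.sign * ε : ℝ) : ℂ) * ⟪incl u, variation q f ε v⟫_ℂ := by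
  rw [laxL_perturb, sub_apply, smul_apply, inner_sub_right, Hardy.inner_smul_right, inner_laxL]

theorem hasDerivAt_of_eventually_eq {F φ : ℝ → ℝ} (h : ∀ᶠ ε in 𝓝 0, F ε = F 0 + ε * φ ε)
    (hφ : ContinuousAt φ 0) : HasDerivAt F (φ 0) 0 := by
  rw [hasDerivAt_iff_tendsto_slope_zero]
  refine (hφ.tendsto.mono_left nhdsWithin_le_nhds).congr' ?_
  filter_upwards [nhdsWithin_le_nhds h, self_mem_nhdsWithin] with ε h1 h2
  have h3 : ε ≠ 0 := h2
  rw [zero_add, h1, smul_eq_mul]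
  field_simp
  ring

theorem inner_toep_swap {f m k : Hardy g} (hm : EssBdd ((m : L2 g) : g.Space → ℂ)) :
    ⟪toep (g := g) f m, k⟫_ℂ = ⟪toep (g := g) k m, f⟫_ℂ := by
  rw [inner_toep_left (memLp_conj_mul_left hm), inner_toep_left (memLp_conj_mul_left hm)]
  refine integral_congr_ae (Eventually.of_forall fun x => ?_)
  simp only [map_mul, Complex.conj_conj]
  ring

theorem inner_variation_zero (q f : Hardy g) (u v : Sobolev g) :
    ⟪incl u, variation q f 0 v⟫_ℂ = ⟪toep (g := g) (toep (g := g) q (incl v)) (incl u), f⟫_ℂ +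
      ⟪f, toep (g := g) (toep (g := g) q (incl u)) (incl v)⟫_ℂ := by
  rw [variation, Complex.ofReal_zero, zero_smul ℂ (cubic f f), add_zero, add_apply,
    inner_add_right, inner_cubic, inner_cubic, inner_toep_swap (essBdd_incl u)]
  congr 1
  rw [← Hardy.inner_conj_symm, inner_toep_swap (essBdd_incl v), Hardy.inner_conj_symm]

/-- The exact increment of `β(κ, ·)` for a step of length `ε`, by the symmetry of `L_q`. -/
theorem inner_self_resolvent {s : Interaction} {q f : Hardy g} {κ ε : ℝ} {m v : Sobolev g}
    (hm : shiftL s q κ m = q) (hv : shiftL s (q + (ε : ℂ) • f) κ v = q + (ε : ℂ) • f) :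
    (⟪q + (ε : ℂ) • f, incl v⟫_ℂ).re = (⟪q, incl m⟫_ℂ).re + ε * (⟪f, incl v⟫_ℂ + ⟪incl m, f⟫_ℂ +
      (s.sign : ℂ) * ⟪incl m, variation q f ε v⟫_ℂ).re := by
  have h1 : ⟪q, incl v⟫_ℂ = ⟪incl m, q⟫_ℂ + ε * ⟪incl m, f⟫_ℂ +
      ((s.sign * ε : ℝ) : ℂ) * ⟪incl m, variation q f ε v⟫_ℂ := by
    rw [shiftL_apply] at hm hv
    have h2 := congrArg (fun z : Hardy g => ⟪z, incl v⟫_ℂ) hm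
    have h3 := congrArg (fun z : Hardy g => ⟪incl m, z⟫_ℂ) hv
    simp only [inner_add_left, inner_add_right, Hardy.inner_smul_left, Hardy.inner_smul_right,
      Complex.conj_ofReal] at h2 h3
    rw [inner_laxL_perturb] at h3
    linear_combination -h2 + h3
  have h2 : (⟪incl m, q⟫_ℂ).re = (⟪q, incl m⟫_ℂ).re := by
    rw [← Hardy.inner_conj_symm, Complex.conj_re]
  rw [inner_add_left, Hardy.inner_smul_left, Complex.conj_ofReal, h1]
  simp only [Complex.add_re, Complex.re_ofReal_mul, h2]
  ring

/-- The derivative of `β(κ, ·)`. The resolvent depends continuously on the step, and the difference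
quotient is computed exactly by `inner_self_resolvent`. -/
theorem hasDerivAt_beta {s : Interaction} {q : Hardy g} {κ : ℝ}
    (h : Function.Bijective (shiftL s q κ)) {m : Sobolev g} (hm : shiftL s q κ m = q)
    (f : Hardy g) : HasDerivAt (fun ε : ℝ => (beta s g κ).val (q + (ε : ℂ) • f))
      (⟪f, (2 : ℂ) • (incl m + (s.sign : ℂ) •
        toep (g := g) (toep (g := g) q (incl m)) (incl m))⟫_ℂ).re 0 := by
  set e := ContinuousLinearEquiv.ofBijective (shiftL s q κ) (LinearMap.ker_eq_bot.2 h.1)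
    (LinearMap.range_eq_top.2 h.2) with he
  have hec : (e : Sobolev g →L[ℂ] Hardy g) = shiftL s q κ := rfl
  set A : ℝ → Sobolev g →L[ℂ] Hardy g := fun ε => shiftL s (q + (ε : ℂ) • f) κ with hA
  have hAc : Continuous A := by
    have : A = fun ε => laxL s q - ((s.sign * ε : ℝ) : ℂ) • variation q f ε + (κ : ℂ) • incl := by
      funext ε
      change laxL s (q + (ε : ℂ) • f) + (κ : ℂ) • incl = _
      rw [laxL_perturb]
    rw [this]
    exact (continuous_const.sub ((Complex.continuous_ofReal.comp
      (continuous_const.mul continuous_id)).smul (continuous_variation q f))).add continuous_const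
  have hA0 : A 0 = e := by
    change shiftL s (q + ((0 : ℝ) : ℂ) • f) κ = shiftL s q κ
    rw [Complex.ofReal_zero, zero_smul, add_zero]
  set v : ℝ → Sobolev g := fun ε => (A ε).inverse (q + (ε : ℂ) • f) with hv
  have hvc : ContinuousAt v 0 := by
    have h1 : ContinuousAt (fun ε => (A ε).inverse) 0 := by
      have h2 : ContinuousAt (ContinuousLinearMap.inverse : (Sobolev g →L[ℂ] Hardy g) → _)
          (A 0) := by
        rw [hA0]; exact (contDiffAt_map_inverse (n := 0) e).continuousAt
      exact h2.comp hAc.continuousAt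
    exact h1.clm_apply (continuous_const.add
      (Complex.continuous_ofReal.smul continuous_const)).continuousAt
  have hev : ∀ᶠ ε : ℝ in 𝓝 0, Function.Bijective (A ε) ∧ A ε (v ε) = q + (ε : ℂ) • f := by
    have h1 : ∀ᶠ ε in 𝓝 (0 : ℝ), A ε ∈ Set.range
        ((↑) : (Sobolev g ≃L[ℂ] Hardy g) → Sobolev g →L[ℂ] Hardy g) := by
      refine hAc.continuousAt.eventually ?_
      rw [hA0]
      exact ContinuousLinearEquiv.nhds e
    filter_upwards [h1] with ε h2
    obtain ⟨e', he'⟩ := h2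
    change _ ∧ A ε ((A ε).inverse (q + (ε : ℂ) • f)) = _
    rw [← he', ContinuousLinearMap.inverse_equiv]
    exact ⟨e'.bijective, e'.apply_symm_apply _⟩
  have hv0 : v 0 = m := by
    obtain ⟨h1, h2⟩ := hev.self_of_nhds
    refine h1.1 (h2.trans ?_)
    rw [hA0, hec, hm, Complex.ofReal_zero, zero_smul, add_zero]
  have hval : ∀ᶠ ε : ℝ in 𝓝 0, (beta s g κ).val (q + (ε : ℂ) • f) =
      (⟪q + (ε : ℂ) • f, incl (v ε)⟫_ℂ).re := by
    filter_upwards [hev] with ε h1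
    change (⟪_, resolventVector s κ (q + (ε : ℂ) • f)⟫_ℂ).re = _
    rw [resolventVector_eq h1.1 h1.2]
  have key := hasDerivAt_of_eventually_eq
    (F := fun ε : ℝ => (beta s g κ).val (q + (ε : ℂ) • f))
    (φ := fun ε : ℝ => (⟪f, incl (v ε)⟫_ℂ + ⟪incl m, f⟫_ℂ +
      (s.sign : ℂ) * ⟪incl m, variation q f ε (v ε)⟫_ℂ).re) ?_ ?_
  · convert key using 1
    rw [hv0, inner_variation_zero, Hardy.inner_smul_right, inner_add_right, Hardy.inner_smul_right,
      ← Hardy.inner_conj_symm f (incl m),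
      ← Hardy.inner_conj_symm f (toep (g := g) (toep (g := g) q (incl m)) (incl m))]
    simp only [Complex.add_re, Complex.re_ofReal_mul, Complex.conj_re]
    rw [← Complex.ofReal_ofNat 2, Complex.re_ofReal_mul, Complex.add_re, Complex.re_ofReal_mul]
    ring
  · have h0 := hval.self_of_nhds
    filter_upwards [hev, hval] with ε h1 h2
    rw [h2, h0, hv0, inner_self_resolvent hm h1.2, Complex.ofReal_zero, zero_smul, add_zero]
  · have h1 : ContinuousAt (fun ε : ℝ => incl (v ε)) 0 :=
      incl.continuous.continuousAt.comp hvc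
    have h2 : ContinuousAt (fun ε : ℝ => variation q f ε (v ε)) 0 :=
      (continuous_variation q f).continuousAt.clm_apply hvc
    exact Complex.continuous_re.continuousAt.comp
      (((continuousAt_const.inner h1).add continuousAt_const).add
        (continuousAt_const.mul (continuousAt_const.inner h2)))

/-! ### Iterates of the Lax operator along a line -/

/-- A continuous curve in `Hᵏ₊`. -/
def SobolevCurve (g : Geometry) : ℕ → (ℝ → Hardy g) → Prop
  | 0, v => Continuous v
  | k + 1, v => Continuous v ∧ ∃ p : ℝ → Hardy g, SobolevCurve g k p ∧
      ∀ ε, IsMomentum g (v ε) (p ε : L2 g)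

theorem SobolevCurve.continuous : ∀ {k : ℕ} {v : ℝ → Hardy g}, SobolevCurve g k v → Continuous v
  | 0, _, h => h
  | _ + 1, _, h => h.1

theorem SobolevCurve.of_succ : ∀ {k : ℕ} {v : ℝ → Hardy g}, SobolevCurve g (k + 1) v →
    SobolevCurve g k v
  | 0, _, h => h.1
  | _ + 1, _, ⟨h, p, hp, hv⟩ => ⟨h, p, hp.of_succ, hv⟩

theorem SobolevCurve.mono {k l : ℕ} (hkl : k ≤ l) {v : ℝ → Hardy g} (h : SobolevCurve g l v) :
    SobolevCurve g k v := by
  induction hkl with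
  | refl => exact h
  | step _ ih => exact ih h.of_succ

theorem SobolevCurve.add : ∀ {k : ℕ} {v w : ℝ → Hardy g}, SobolevCurve g k v →
    SobolevCurve g k w → SobolevCurve g k (fun ε => v ε + w ε)
  | 0, _, _, h1, h2 => Continuous.add h1 h2
  | _ + 1, _, _, ⟨h1, p, hp, hv⟩, ⟨h2, r, hr, hw⟩ =>
    ⟨h1.add h2, fun ε => p ε + r ε, hp.add hr, fun ε => (hv ε).add (hw ε)⟩

theorem SobolevCurve.smul {c : ℝ → ℂ} (hc : Continuous c) : ∀ {k : ℕ} {v : ℝ → Hardy g},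
    SobolevCurve g k v → SobolevCurve g k (fun ε => c ε • v ε)
  | 0, _, h1 => hc.smul h1
  | _ + 1, _, ⟨h1, p, hp, hv⟩ =>
    ⟨hc.smul h1, fun ε => c ε • p ε, hp.smul hc, fun ε => (hv ε).smul (c ε)⟩

theorem SobolevCurve.sub {k : ℕ} {v w : ℝ → Hardy g} (hv : SobolevCurve g k v)
    (hw : SobolevCurve g k w) : SobolevCurve g k (fun ε => v ε - w ε) := by
  have h := hv.add (hw.smul (c := fun _ => -1) continuous_const)
  simpa only [neg_one_smul, ← sub_eq_add_neg] using h

theorem sobolevCurve_const : ∀ {k : ℕ} {f : Hardy g}, f ∈ HardySobolev g k →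
    SobolevCurve g k (fun _ => f)
  | 0, _, _ => continuous_const
  | _ + 1, _, ⟨p, hp, hfp⟩ => ⟨continuous_const, fun _ => p, sobolevCurve_const hp, fun _ => hfp⟩

/-- A continuous curve in `Hᵏ⁺¹₊` is a continuous curve in `H¹₊` whose derivative is a continuous
curve in `Hᵏ₊`. -/
theorem SobolevCurve.exists_lift {k : ℕ} {v : ℝ → Hardy g} (h : SobolevCurve g (k + 1) v) :
    ∃ u : ℝ → Sobolev g, Continuous u ∧ (∀ ε, incl (u ε) = v ε) ∧
      SobolevCurve g k (fun ε => mom (u ε)) := by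
  obtain ⟨h1, p, hp, hv⟩ := h
  refine ⟨fun ε => (⟨(v ε, p ε), hv ε⟩ : sobolev g), ?_, fun ε => rfl, hp⟩
  exact Continuous.subtype_mk (h1.prodMk hp.continuous) _

theorem cubic_sub_left (a b c : Hardy g) : cubic (a - b) c = cubic a c - cubic b c := by
  rw [eq_sub_iff_add_eq, ← cubic_add_left, sub_add_cancel]

theorem cubic_sub_right (a b c : Hardy g) : cubic a (b - c) = cubic a b - cubic a c := by
  rw [eq_sub_iff_add_eq, ← cubic_add_right, sub_add_cancel]

theorem continuous_cubic : Continuous fun z : Hardy g × Hardy g => cubic z.1 z.2 := by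
  rw [continuous_iff_continuousAt]
  rintro ⟨a, b⟩
  have hK := cubicConst_nonneg g
  refine tendsto_iff_norm_sub_tendsto_zero.2 ?_
  have h1 : Tendsto (fun z : Hardy g × Hardy g => cubicConst g * (‖z.1 - a‖ * ‖z.2‖) +
      cubicConst g * (‖a‖ * ‖z.2 - b‖)) (𝓝 (a, b)) (𝓝 0) := by
    have h2 : Continuous fun z : Hardy g × Hardy g => cubicConst g * (‖z.1 - a‖ * ‖z.2‖) +
      cubicConst g * (‖a‖ * ‖z.2 - b‖) := by fun_prop
    have h3 := h2.tendsto (a, b)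
    simpa using h3
  refine squeeze_zero (fun _ => norm_nonneg _) (fun z => ?_) h1
  have h2 : cubic z.1 z.2 - cubic a b = cubic (z.1 - a) z.2 + cubic a (z.2 - b) := by
    rw [cubic_sub_left, cubic_sub_right]; abel
  rw [h2]
  exact (norm_add_le _ _).trans (add_le_add (norm_cubic_le _ _) (norm_cubic_le _ _))

theorem Continuous.cubic {X : Type*} [TopologicalSpace X] {a b : X → Hardy g} {u : X → Sobolev g}
    (ha : Continuous a) (hb : Continuous b) (hu : Continuous u) :
    Continuous fun x => cubic (a x) (b x) (u x) :=
  (continuous_cubic.comp (ha.prodMk hb)).clm_apply hu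

theorem essBdd_sub {u v : L2 g} (hu : EssBdd (u : g.Space → ℂ)) (hv : EssBdd (v : g.Space → ℂ)) :
    EssBdd ((u - v : L2 g) : g.Space → ℂ) := by
  obtain ⟨C, hC⟩ := hu
  obtain ⟨D, hD⟩ := hv
  refine ⟨C + D, ?_⟩
  filter_upwards [hC, hD, Lp.coeFn_sub u v] with x h1 h2 h3
  rw [h3, Pi.sub_apply]
  exact (norm_sub_le _ _).trans (add_le_add h1 h2)

/-- The Leibniz rule for `C₊(b̄ u)`. -/
theorem isMomentum_toep {b b' f p : Hardy g} (hb : IsMomentum g b (b' : L2 g))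
    (hf : IsMomentum g f (p : L2 g)) :
    IsMomentum g (toep (g := g) b f : L2 g)
      ((toep (g := g) b p - toep (g := g) b' f : Hardy g) : L2 g) := by
  have hb0 := essBdd_of_isMomentum hb
  have hf0 := essBdd_of_isMomentum hf
  have h := (hb.conj_mul hf (coeFn_toL2 (memLp_conj_mul_right hb0))
    (coeFn_toL2 (memLp_conj_mul_right hb0)) (coeFn_toL2 (memLp_conj_mul_left hf0))).szego
  rw [map_sub] at h
  exact h

/-- The Leibniz rule for the cubic term. -/
theorem isMomentum_cubic {a a' b b' : Hardy g} {u u' : Sobolev g} (ha : IsMomentum g a (a' : L2 g))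
    (hb : IsMomentum g b (b' : L2 g)) (hu : incl u' = mom u) :
    IsMomentum g (cubic a b u : L2 g)
      ((cubic a b u' - cubic a b' u + cubic a' b u : Hardy g) : L2 g) := by
  have h1 := isMomentum_toep hb (isMomentum_mom u)
  rw [← hu] at h1
  set T : Hardy g := toep (g := g) b (incl u') - toep (g := g) b' (incl u) with hTdef
  have hT : EssBdd ((T : L2 g) : g.Space → ℂ) := by
    rw [hTdef, Submodule.coe_sub]; exact essBdd_sub (essBdd_toep b u') (essBdd_toep b' u)
  have h2 : hmul a T = cubic a b u' - cubic a b' u := by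
    rw [eq_sub_iff_add_eq, cubic_apply, cubic_apply, ← hmul_add_right hT (essBdd_toep b' u),
      hTdef, sub_add_cancel]
  have h3 : IsMomentum g (cubic a b u : L2 g) ((hmul a T : L2 g) + (cubic a' b u : L2 g)) :=
    ha.mul h1 (coeFn_cubic a b u) (coeFn_hmul_right hT) (coeFn_cubic a' b u)
  rw [Submodule.coe_add, ← h2]
  exact h3

theorem SobolevCurve.cubic : ∀ {k : ℕ} {a b : ℝ → Hardy g} {u : ℝ → Sobolev g},
    SobolevCurve g k a → SobolevCurve g k b → Continuous u →
      SobolevCurve g k (fun ε => mom (u ε)) →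
      SobolevCurve g k (fun ε => CCM.cubic (a ε) (b ε) (u ε))
  | 0, _, _, _, ha, hb, hu, _ => Continuous.cubic ha hb hu
  | k + 1, a, b, u, ⟨ha, a', ha', haa⟩, ⟨hb, b', hb', hbb⟩, hu, hm => by
    have ha1 : SobolevCurve g (k + 1) a := ⟨ha, a', ha', haa⟩
    have hb1 : SobolevCurve g (k + 1) b := ⟨hb, b', hb', hbb⟩
    obtain ⟨u', hu', huu, hm'⟩ := hm.exists_lift
    refine ⟨Continuous.cubic ha hb hu, _, ?_, fun ε => isMomentum_cubic (haa ε) (hbb ε) (huu ε)⟩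
    exact ((SobolevCurve.cubic ha1.of_succ hb1.of_succ hu' hm').sub
      (SobolevCurve.cubic ha1.of_succ hb' hu hm.of_succ)).add
      (SobolevCurve.cubic ha' hb1.of_succ hu hm.of_succ)

/-- Along a curve of symbols in `Hⁿ₊`, the iterates of the Lax operator form curves in
`Hⁿ⁻ᵏ₊`. -/
theorem sobolevCurve_iterate (s : Interaction) {n : ℕ} {q : ℝ → Hardy g} (hq : SobolevCurve g n q)
    {k : ℕ} (hk : k ≤ n) : SobolevCurve g (n - k) (fun ε => (lax s (q ε))^[k] (q ε)) := by
  induction k with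
  | zero => exact hq
  | succ k ih =>
    have h1 := ih (by omega)
    rw [show n - k = n - (k + 1) + 1 by omega] at h1
    obtain ⟨u, hu, huv, hm⟩ := h1.exists_lift
    have h2 : (fun ε => (lax s (q ε))^[k + 1] (q ε)) = fun ε => mom (u ε) -
        (s.sign : ℂ) • CCM.cubic (q ε) (q ε) (u ε) := by
      funext ε
      rw [Function.iterate_succ_apply', ← huv, lax_incl, laxL_apply]
    rw [h2]
    have h3 := hq.mono (show n - (k + 1) ≤ n by omega)
    exact hm.sub ((h3.cubic h3 hu hm).smul continuous_const)

/-- The iterates of the Lax operator of order less than `n` along a curve of symbols in `Hⁿ₊`,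
as curves in `H¹₊`. -/
theorem exists_iterate_lift (s : Interaction) {n : ℕ} {q : ℝ → Hardy g} (hq : SobolevCurve g n q) :
    ∃ u : ℕ → ℝ → Sobolev g, ∀ k < n, Continuous (u k) ∧
      ∀ ε, incl (u k ε) = (lax s (q ε))^[k] (q ε) ∧
        laxL s (q ε) (u k ε) = (lax s (q ε))^[k + 1] (q ε) := by
  have h : ∀ k, ∃ u : ℝ → Sobolev g, k < n → Continuous u ∧
      ∀ ε, incl (u ε) = (lax s (q ε))^[k] (q ε) ∧
        laxL s (q ε) (u ε) = (lax s (q ε))^[k + 1] (q ε) := by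
    intro k
    by_cases hk : k < n
    · have h1 := sobolevCurve_iterate s hq hk.le
      rw [show n - k = n - (k + 1) + 1 by omega] at h1
      obtain ⟨u, hu, huv, -⟩ := h1.exists_lift
      refine ⟨u, fun _ => ⟨hu, fun ε => ⟨huv ε, ?_⟩⟩⟩
      rw [Function.iterate_succ_apply', ← huv, lax_incl]
    · exact ⟨fun _ => 0, fun h => absurd h hk⟩
  choose u hu using h
  exact ⟨u, hu⟩

/-- Moving the Lax operators from one side of the inner product to the other, one by one, replaces
the perturbed operator by the unperturbed one at the cost of a variation term each time. -/
theorem inner_iterate_perturb (s : Interaction) (q f : Hardy g) (n : ℕ) (ε : ℝ)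
    {u v : ℕ → Sobolev g} {y z : ℕ → Hardy g} (hu : ∀ k < n, incl (u k) = y k)
    (hu' : ∀ k < n, laxL s q (u k) = y (k + 1)) (hv : ∀ k < n, incl (v k) = z k)
    (hv' : ∀ k < n, laxL s (q + (ε : ℂ) • f) (v k) = z (k + 1)) {j : ℕ} (hj : j ≤ n) :
    ⟪y 0, z n⟫_ℂ = ⟪y j, z (n - j)⟫_ℂ - ((s.sign * ε : ℝ) : ℂ) *
      ∑ a ∈ Finset.range j, ⟪incl (u a), variation q f ε (v (n - 1 - a))⟫_ℂ := by
  induction j with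
  | zero => simp
  | succ j ih =>
    have h1 : ⟪y j, z (n - j)⟫_ℂ = ⟪y (j + 1), z (n - (j + 1))⟫_ℂ - ((s.sign * ε : ℝ) : ℂ) *
        ⟪incl (u j), variation q f ε (v (n - 1 - j))⟫_ℂ := by
      rw [← hu j (by omega), show n - j = n - 1 - j + 1 by omega, ← hv' _ (by omega),
        inner_laxL_perturb, hu' j (by omega), hv _ (by omega),
        show n - 1 - j = n - (j + 1) by omega]
    rw [ih (by omega), h1, Finset.sum_range_succ]
    ring

/-- The derivative of `E_n` in the directions of `Hⁿ₊`. -/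
theorem hasDerivAt_energy (s : Interaction) {q f : Hardy g} {n : ℕ} (hq : q ∈ HardySobolev g n)
    (hf : f ∈ HardySobolev g n) {u : ℕ → Sobolev g}
    (hu : ∀ k < n, incl (u k) = (lax s q)^[k] q) :
    HasDerivAt (fun ε : ℝ => (energy s g n).val (q + (ε : ℂ) • f))
      (⟪f, (2 : ℂ) • ((lax s q)^[n] q - (s.sign : ℂ) • ∑ a ∈ Finset.range n,
        toep (g := g) (toep (g := g) q (incl (u (n - 1 - a)))) (incl (u a)))⟫_ℂ).re 0 := by
  have hc : SobolevCurve g n fun ε : ℝ => q + (ε : ℂ) • f :=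
    (sobolevCurve_const hq).add ((sobolevCurve_const hf).smul Complex.continuous_ofReal)
  obtain ⟨v, hv⟩ := exists_iterate_lift s hc
  set z : ℕ → ℝ → Hardy g := fun k ε => (lax s (q + (ε : ℂ) • f))^[k] (q + (ε : ℂ) • f) with hz
  have hz0 : ∀ k, z k 0 = (lax s q)^[k] q := fun k => by
    rw [hz]; simp only [Complex.ofReal_zero, zero_smul, add_zero]
  have hzn : Continuous (z n) := (sobolevCurve_iterate s hc le_rfl).continuous
  have huv : ∀ k < n, v k 0 = u k := fun k hk => by
    refine incl_injective ?_
    rw [hu k hk, ← hz0]; exact ((hv k hk).2 0).1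
  have hu' : ∀ k < n, laxL s q (u k) = (lax s q)^[k + 1] q := fun k hk => by
    rw [← lax_incl, hu k hk, Function.iterate_succ_apply']
  have key := hasDerivAt_of_eventually_eq
    (F := fun ε : ℝ => (energy s g n).val (q + (ε : ℂ) • f))
    (φ := fun ε : ℝ => (⟪f, z n ε⟫_ℂ + ⟪(lax s q)^[n] q, f⟫_ℂ - (s.sign : ℂ) *
      ∑ a ∈ Finset.range n, ⟪incl (u a), variation q f ε (v (n - 1 - a) ε)⟫_ℂ).re) ?_ ?_
  · convert key using 1
    have h1 : ∀ a ∈ Finset.range n, ⟪incl (u a), variation q f 0 (v (n - 1 - a) 0)⟫_ℂ =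
        conj ⟪f, toep (g := g) (toep (g := g) q (incl (u (n - 1 - a)))) (incl (u a))⟫_ℂ +
        ⟪f, toep (g := g) (toep (g := g) q (incl (u a))) (incl (u (n - 1 - a)))⟫_ℂ := by
      intro a ha
      have ha' := Finset.mem_range.1 ha
      rw [huv _ (by omega), inner_variation_zero, Hardy.inner_conj_symm]
    have h2 : ∑ a ∈ Finset.range n,
        ⟪f, toep (g := g) (toep (g := g) q (incl (u a))) (incl (u (n - 1 - a)))⟫_ℂ =
        ∑ a ∈ Finset.range n,
        ⟪f, toep (g := g) (toep (g := g) q (incl (u (n - 1 - a)))) (incl (u a))⟫_ℂ := by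
      rw [← Finset.sum_range_reflect]
      refine Finset.sum_congr rfl fun a ha => ?_
      have ha' := Finset.mem_range.1 ha
      rw [show n - 1 - (n - 1 - a) = a by omega]
    rw [Finset.sum_congr rfl h1, Finset.sum_add_distrib, h2, ← map_sum, hz0,
      Hardy.inner_smul_right, inner_sub_right, Hardy.inner_smul_right, inner_sum,
      ← Hardy.inner_conj_symm f ((lax s q)^[n] q), ← Complex.ofReal_ofNat 2]
    simp only [Complex.add_re, Complex.sub_re, Complex.re_ofReal_mul, Complex.conj_re]
    ring
  · refine Eventually.of_forall fun ε => ?_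
    have h1 := inner_iterate_perturb s q f n ε (y := fun k => (lax s q)^[k] q)
      (v := fun k => v k ε) (z := fun k => z k ε) hu hu' (fun k hk => ((hv k hk).2 ε).1)
      (fun k hk => ((hv k hk).2 ε).2) le_rfl
    change (⟪q + (ε : ℂ) • f, z n ε⟫_ℂ).re = (⟪q + ((0 : ℝ) : ℂ) • f, z n 0⟫_ℂ).re + _
    have h2 : ⟪q, z n ε⟫_ℂ = _ := h1
    have h3 : z (n - n) ε = q + (ε : ℂ) • f := by rw [Nat.sub_self]; rfl
    have h4 : (⟪(lax s q)^[n] q, q⟫_ℂ).re = (⟪q, (lax s q)^[n] q⟫_ℂ).re := by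
      rw [← Hardy.inner_conj_symm, Complex.conj_re]
    rw [hz0, Complex.ofReal_zero, zero_smul, add_zero, inner_add_left, Hardy.inner_smul_left,
      Complex.conj_ofReal, h2, h3, inner_add_right, Hardy.inner_smul_right, mul_comm s.sign,
      Complex.ofReal_mul, mul_assoc]
    simp only [Complex.add_re, Complex.sub_re, Complex.re_ofReal_mul, h4]
    ring
  · refine Complex.continuous_re.continuousAt.comp
      (((continuousAt_const.inner hzn.continuousAt).add continuousAt_const).sub
        (continuousAt_const.mul (Continuous.continuousAt ?_)))
    refine continuous_finsetSum _ fun a ha => ?_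
    have ha' := Finset.mem_range.1 ha
    exact continuous_const.inner
      ((continuous_variation q f).clm_apply (hv (n - 1 - a) (by omega)).1)

/-! ### Chains of the Lax operator and their symplectic gradients -/

/-- A finite chain `(L_q + κ) z_a = z_{a+1}`, `a < N`, that starts at `q` (with sign `e = 1`) or
ends at `q` (with sign `e = -1`); its other end is the vector `w`. For the energy `E_n`, the chain
is `q, L_q q, …, L_qⁿ q`; for `β(κ, ·)`, it is `(L_q + κ)⁻¹ q, q`. -/
structure LaxChain (s : Interaction) (q : Hardy g) where
  length : ℕ
  shift : ℝ
  lift : ℕ → Sobolev g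
  vec : ℕ → Hardy g
  incl_lift : ∀ a < length, incl (lift a) = vec a
  lax_lift : ∀ a < length, laxL s q (lift a) = vec (a + 1) - (shift : ℂ) • vec a
  orient : ℝ
  free : Hardy g
  boundary : (orient = 1 ∧ vec 0 = q ∧ vec length = free) ∨
    (orient = -1 ∧ vec 0 = free ∧ vec length = q)

theorem sum_range_telescope (f : ℕ → ℕ → ℂ) (N : ℕ) :
    ∑ a ∈ Finset.range N, (f (N - 1 - a) (a + 1) - f (N - 1 - a + 1) a) = f 0 N - f N 0 := by
  have h : ∀ a ∈ Finset.range N, f (N - 1 - a) (a + 1) - f (N - 1 - a + 1) a =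
      f (N - (a + 1)) (a + 1) - f (N - a) a := fun a ha => by
    have := Finset.mem_range.1 ha
    rw [show N - 1 - a + 1 = N - a by omega, show N - (a + 1) = N - 1 - a by omega]
  rw [Finset.sum_congr rfl h, Finset.sum_range_sub (fun a => f (N - a) a), Nat.sub_self,
    Nat.sub_zero]

theorem sum_range_reflect_swap {M : Type*} [AddCommMonoid M] (f : ℕ → ℕ → M) (N : ℕ) :
    ∑ a ∈ Finset.range N, f (N - 1 - a) a = ∑ a ∈ Finset.range N, f a (N - 1 - a) := by
  rw [← Finset.sum_range_reflect]
  refine Finset.sum_congr rfl fun a ha => ?_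
  have := Finset.mem_range.1 ha
  rw [show N - 1 - (N - 1 - a) = a by omega]

/-- The pointwise identity `Re(q̄ X) = -e φ'` for `φ = Σ z_a z̄_{N-1-a}`. -/
theorem chain_pointwise (N : ℕ) (κ σ e c : ℝ) (Q W X : ℂ) (Z D G R : ℕ → ℂ)
    (hG : ∀ a < N, conj Q * Z a = G a + conj (R a))
    (hD : ∀ a < N, D a = Z (a + 1) - κ * Z a + σ * (Q * G a))
    (hX : X = -2 * Complex.I * (W + (σ * e : ℝ) * ∑ a ∈ Finset.range N, Z a * R (N - 1 - a)) +
      Complex.I * c * Q)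
    (hb : (e = 1 ∧ Z 0 = Q ∧ Z N = W) ∨ (e = -1 ∧ Z 0 = W ∧ Z N = Q)) :
    (conj Q * X).re = (Complex.I * (((-e : ℝ) : ℂ) * ∑ a ∈ Finset.range N,
      (conj (Z (N - 1 - a)) * D a - conj (D (N - 1 - a)) * Z a))).re := by
  have hG' : ∀ a < N, conj (Z a) * Q = conj (G a) + R a := fun a ha => by
    have h := congrArg conj (hG a ha)
    simpa only [map_mul, map_add, Complex.conj_conj, mul_comm] using h
  set S := ∑ a ∈ Finset.range N, G a * R (N - 1 - a) with hS
  have h1 : ∑ a ∈ Finset.range N, (conj (Z (N - 1 - a)) * D a - conj (D (N - 1 - a)) * Z a) =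
      conj (Z 0) * Z N - conj (Z N) * Z 0 + σ * (S - conj S) := by
    rw [← sum_range_telescope (fun a b => conj (Z a) * Z b), hS, map_sum]
    have h2 : ∑ a ∈ Finset.range N, conj (G a * R (N - 1 - a)) =
        ∑ a ∈ Finset.range N, conj (G (N - 1 - a) * R a) :=
      (sum_range_reflect_swap (fun a b => conj (G a * R b)) N).symm
    rw [h2, ← Finset.sum_sub_distrib, Finset.mul_sum, ← Finset.sum_add_distrib]
    refine Finset.sum_congr rfl fun a ha => ?_
    have ha' := Finset.mem_range.1 ha
    rw [hD a ha', hD (N - 1 - a) (by omega)]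
    simp only [map_sub, map_add, map_mul, Complex.conj_ofReal]
    have e1 := hG a ha'
    have e2 := hG' (N - 1 - a) (by omega)
    linear_combination (σ : ℂ) * G a * e2 - (σ : ℂ) * conj (G (N - 1 - a)) * e1
  set T := ∑ a ∈ Finset.range N, conj (R a) * R (N - 1 - a) with hT
  have h2 : T.im = 0 := by
    rw [← Complex.conj_eq_iff_im, hT, map_sum]
    rw [← sum_range_reflect_swap (fun a b => conj (R a) * R b)]
    refine Finset.sum_congr rfl fun a _ => ?_
    rw [map_mul, Complex.conj_conj, mul_comm]
  have h3 : conj Q * ∑ a ∈ Finset.range N, Z a * R (N - 1 - a) = S + T := by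
    rw [hS, hT, Finset.mul_sum, ← Finset.sum_add_distrib]
    refine Finset.sum_congr rfl fun a ha => ?_
    rw [← mul_assoc, hG a (Finset.mem_range.1 ha)]; ring
  have h4 : conj Q * X = -2 * Complex.I * (conj Q * W + (σ * e : ℝ) * (S + T)) +
      Complex.I * c * (conj Q * Q) := by
    rw [hX, ← h3]; ring
  have h5 : (conj Q * X).re = 2 * (conj Q * W).im + 2 * (σ * e) * S.im := by
    rw [h4, Complex.conj_mul']
    simp only [Complex.add_re, Complex.mul_re, Complex.mul_im, Complex.neg_re, Complex.neg_im,
      Complex.re_ofNat, Complex.im_ofNat, Complex.I_re, Complex.I_im, Complex.add_im,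
      Complex.ofReal_re, Complex.ofReal_im, h2, ← Complex.ofReal_pow]
    ring
  have h6 : (conj Q * W).im = e * (conj (Z 0) * Z N).im := by
    rcases hb with ⟨h, h0, hN⟩ | ⟨h, h0, hN⟩
    · rw [h, h0, hN, one_mul]
    · rw [h, h0, hN, neg_one_mul, ← Complex.conj_im, map_mul, Complex.conj_conj, mul_comm]
  rw [h1, h5, h6]
  simp only [Complex.add_re, Complex.mul_re, Complex.mul_im,
      Complex.I_re, Complex.I_im, Complex.add_im, Complex.sub_re, Complex.sub_im,
      Complex.ofReal_re, Complex.ofReal_im, Complex.conj_re, Complex.conj_im]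
  ring

namespace LaxChain

variable {s : Interaction} {q : Hardy g}

/-- The gradient of the observable of the chain, with respect to the real inner product. -/
def grad (C : LaxChain s q) : Hardy g :=
  (2 : ℂ) • (C.free - ((s.sign * C.orient : ℝ) : ℂ) • ∑ a ∈ Finset.range C.length,
    toep (g := g) (toep (g := g) q (incl (C.lift (C.length - 1 - a)))) (incl (C.lift a)))

/-- The vector `Y = w ± e Σ z_a r_{N-1-a}`, where `r_a` is the conjugate of the strictly negative
part of `q̄ z_a`. Up to an infinitesimal phase rotation of `q`, the symplectic gradient of the chain
is `-2iY`. -/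
def multiplier (C : LaxChain s q) : Hardy g :=
  C.free + ((s.sign * C.orient : ℝ) : ℂ) • ∑ a ∈ Finset.range C.length,
    hmul (incl (C.lift a)) (rem q (incl (C.lift (C.length - 1 - a))))

/-- The mean of `Σ z_a z̄_{N-1-a}`. -/
def meanDensity (C : LaxChain s q) : ℝ := meanWeight g *
  (∑ a ∈ Finset.range C.length,
    ⟪incl (C.lift (C.length - 1 - a)), incl (C.lift a)⟫_ℂ).re

/-- An explicit symplectic gradient of the observable of the chain. -/
def field (C : LaxChain s q) : Hardy g :=
  (-2 * Complex.I) • C.multiplier +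
    (Complex.I * ((2 * (s.sign * C.orient) * C.meanDensity : ℝ) : ℂ)) • q

end LaxChain

theorem coeFn_finset_sum {ι : Type*} (t : Finset ι) (f : ι → L2 g) :
    ((∑ i ∈ t, f i : L2 g) : g.Space → ℂ) =ᵐ[volume] fun x => ∑ i ∈ t, f i x := by
  classical
  induction t using Finset.induction_on with
  | empty =>
    simp only [Finset.sum_empty]
    exact Lp.coeFn_zero ℂ 2 volume
  | insert i t hi ih =>
    rw [Finset.sum_insert hi]
    filter_upwards [Lp.coeFn_add (f i) (∑ j ∈ t, f j), ih] with x h1 h2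
    rw [h1, Pi.add_apply, h2, Finset.sum_insert hi]

theorem integrable_conj_mul (a b : L2 g) : Integrable (fun x => conj (a x) * b x) volume :=
  MemLp.integrable_mul (L2.memLp_conj a) (L2.memLp b)

theorem ae_forall_lt {N : ℕ} {P : ℕ → g.Space → Prop} (h : ∀ a < N, ∀ᵐ x : g.Space, P a x) :
    ∀ᵐ x : g.Space, ∀ a < N, P a x :=
  ae_all_iff.2 fun a => by
    by_cases ha : a < N
    · exact (h a ha).mono fun x hx _ => hx
    · exact Eventually.of_forall fun x hx => absurd hx ha

namespace LaxChain

variable {s : Interaction} {q : Hardy g}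

/-- The function `Σ z_a z̄_{N-1-a}`. -/
def density (C : LaxChain s q) : L2 g := ∑ a ∈ Finset.range C.length,
  toL2 g fun x => conj ((incl (C.lift (C.length - 1 - a)) : L2 g) x) * (incl (C.lift a) : L2 g) x

/-- The momentum of `Σ z_a z̄_{N-1-a}`. -/
def densityMom (C : LaxChain s q) : L2 g := ∑ a ∈ Finset.range C.length,
  ((toL2 g fun x => conj ((incl (C.lift (C.length - 1 - a)) : L2 g) x) *
    (mom (C.lift a) : L2 g) x) - toL2 g fun x =>
      conj ((mom (C.lift (C.length - 1 - a)) : L2 g) x) * (incl (C.lift a) : L2 g) x)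

theorem isMomentum_density (C : LaxChain s q) : IsMomentum g C.density C.densityMom :=
  IsMomentum.sum _ fun _ _ => (isMomentum_mom _).conj_mul (isMomentum_mom _)
    (coeFn_toL2 (memLp_conj_mul_incl _ _)) (coeFn_toL2 (memLp_conj_incl_mul _ _))
    (coeFn_toL2 (memLp_conj_mul_incl _ _))

theorem coeFn_density (C : LaxChain s q) : C.density =ᵐ[volume] fun x =>
    ∑ a ∈ Finset.range C.length, conj ((incl (C.lift (C.length - 1 - a)) : L2 g) x) *
      (incl (C.lift a) : L2 g) x := by
  filter_upwards [coeFn_finset_sum (Finset.range C.length) fun a => toL2 g fun x =>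
    conj ((incl (C.lift (C.length - 1 - a)) : L2 g) x) * (incl (C.lift a) : L2 g) x,
    ae_forall_lt (N := C.length) fun a _ => coeFn_toL2
      (memLp_conj_mul_incl (incl (C.lift (C.length - 1 - a))) (C.lift a))] with x h1 h2
  rw [density, h1]
  exact Finset.sum_congr rfl fun a ha => h2 a (Finset.mem_range.1 ha)

theorem coeFn_densityMom (C : LaxChain s q) : C.densityMom =ᵐ[volume] fun x =>
    ∑ a ∈ Finset.range C.length, (conj ((incl (C.lift (C.length - 1 - a)) : L2 g) x) *
      (mom (C.lift a) : L2 g) x - conj ((mom (C.lift (C.length - 1 - a)) : L2 g) x) *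
      (incl (C.lift a) : L2 g) x) := by
  have h0 : ∀ a < C.length, ∀ᵐ x : g.Space, ((toL2 g fun x =>
      conj ((incl (C.lift (C.length - 1 - a)) : L2 g) x) *
        (mom (C.lift a) : L2 g) x) - toL2 g fun x =>
      conj ((mom (C.lift (C.length - 1 - a)) : L2 g) x) * (incl (C.lift a) : L2 g) x : L2 g) x =
      conj ((incl (C.lift (C.length - 1 - a)) : L2 g) x) *
      (mom (C.lift a) : L2 g) x - conj ((mom (C.lift (C.length - 1 - a)) : L2 g) x) *
      (incl (C.lift a) : L2 g) x := by
    intro a _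
    filter_upwards [Lp.coeFn_sub (toL2 g fun x =>
      conj ((incl (C.lift (C.length - 1 - a)) : L2 g) x) * (mom (C.lift a) : L2 g) x)
      (toL2 g fun x => conj ((mom (C.lift (C.length - 1 - a)) : L2 g) x) *
        (incl (C.lift a) : L2 g) x),
      coeFn_toL2 (memLp_conj_incl_mul (mom (C.lift a)) (C.lift (C.length - 1 - a))),
      coeFn_toL2 (memLp_conj_mul_incl (mom (C.lift (C.length - 1 - a))) (C.lift a))] with x h1 h2 h3
    rw [h1, Pi.sub_apply, h2, h3]
  filter_upwards [coeFn_finset_sum (Finset.range C.length) fun a => ((toL2 g fun x =>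
      conj ((incl (C.lift (C.length - 1 - a)) : L2 g) x) *
        (mom (C.lift a) : L2 g) x) - toL2 g fun x =>
      conj ((mom (C.lift (C.length - 1 - a)) : L2 g) x) * (incl (C.lift a) : L2 g) x : L2 g),
    ae_forall_lt h0] with x h1 h2
  rw [densityMom, h1]
  exact Finset.sum_congr rfl fun a ha => h2 a (Finset.mem_range.1 ha)

theorem integrable_densityMom (C : LaxChain s q) : Integrable C.densityMom volume := by
  refine Integrable.congr ?_ C.coeFn_densityMom.symm
  exact integrable_finsetSum _ fun a _ => (integrable_conj_mul _ _).sub (integrable_conj_mul _ _)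

theorem integral_density (C : LaxChain s q) : ∫ x, C.density x =
    ∑ a ∈ Finset.range C.length, ⟪incl (C.lift (C.length - 1 - a)), incl (C.lift a)⟫_ℂ := by
  rw [integral_congr_ae C.coeFn_density, integral_finsetSum _ fun a _ => integrable_conj_mul _ _]
  refine Finset.sum_congr rfl fun a _ => ?_
  rw [Submodule.coe_inner, inner_eq_integral]

theorem coeFn_multiplier (C : LaxChain s q) : (C.multiplier : L2 g) =ᵐ[volume] fun x =>
    (C.free : L2 g) x + ((s.sign * C.orient : ℝ) : ℂ) * ∑ a ∈ Finset.range C.length,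
      (incl (C.lift a) : L2 g) x * (rem q (incl (C.lift (C.length - 1 - a))) : L2 g) x := by
  set H : ℕ → Hardy g := fun a =>
    hmul (incl (C.lift a)) (rem q (incl (C.lift (C.length - 1 - a)))) with hH
  have h0 : (C.multiplier : L2 g) = (C.free : L2 g) + ((s.sign * C.orient : ℝ) : ℂ) •
      ∑ a ∈ Finset.range C.length, (H a : L2 g) := by
    rw [multiplier, Submodule.coe_add, Submodule.coe_smul, Submodule.coe_sum]
  rw [h0]
  filter_upwards [Lp.coeFn_add (C.free : L2 g) (((s.sign * C.orient : ℝ) : ℂ) •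
      ∑ a ∈ Finset.range C.length, (H a : L2 g)), Lp.coeFn_smul ((s.sign * C.orient : ℝ) : ℂ)
      (∑ a ∈ Finset.range C.length, (H a : L2 g)),
    coeFn_finset_sum (Finset.range C.length) fun a => (H a : L2 g),
    ae_forall_lt (N := C.length) fun a _ => coeFn_hmul_left
      (b := rem q (incl (C.lift (C.length - 1 - a)))) (essBdd_incl (C.lift a))] with x h1 h2 h3 h4
  rw [h1, Pi.add_apply, h2, Pi.smul_apply, h3, smul_eq_mul]
  congr 2
  exact Finset.sum_congr rfl fun a ha => h4 a (Finset.mem_range.1 ha)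

theorem coeFn_mom_lift (C : LaxChain s q) {a : ℕ} (ha : a < C.length) :
    ∀ᵐ x : g.Space, (mom (C.lift a) : L2 g) x = (C.vec (a + 1) : L2 g) x -
      C.shift * (C.vec a : L2 g) x +
      s.sign * ((q : L2 g) x * (toep (g := g) q (incl (C.lift a)) : L2 g) x) := by
  have h0 : (mom (C.lift a) : L2 g) = (C.vec (a + 1) : L2 g) - (C.shift : ℂ) • (C.vec a : L2 g) +
      (s.sign : ℂ) • (cubic q q (C.lift a) : L2 g) := by
    have h1 := C.lax_lift a ha
    rw [laxL_apply, sub_eq_iff_eq_add] at h1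
    rw [h1]; rfl
  rw [h0]
  filter_upwards [Lp.coeFn_add ((C.vec (a + 1) : L2 g) - (C.shift : ℂ) • (C.vec a : L2 g))
      ((s.sign : ℂ) • (cubic q q (C.lift a) : L2 g)),
    Lp.coeFn_sub (C.vec (a + 1) : L2 g) ((C.shift : ℂ) • (C.vec a : L2 g)),
    Lp.coeFn_smul (C.shift : ℂ) (C.vec a : L2 g),
    Lp.coeFn_smul (s.sign : ℂ) (cubic q q (C.lift a) : L2 g), coeFn_cubic q q (C.lift a)]
    with x h1 h2 h3 h4 h5
  rw [h1, Pi.add_apply, h2, Pi.sub_apply, h3, h4, Pi.smul_apply, Pi.smul_apply, h5, smul_eq_mul,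
    smul_eq_mul]

/-- Along the field of the chain, `Re(q̄ X)` is an exact derivative. -/
theorem re_conj_mul_field (C : LaxChain s q) : ∀ᵐ x : g.Space,
    (conj ((q : L2 g) x) * (C.field : L2 g) x).re =
      (Complex.I * (((-C.orient : ℝ) : ℂ) * C.densityMom x)).re := by
  have h0 : (C.field : L2 g) = (-2 * Complex.I) • (C.multiplier : L2 g) +
    (Complex.I * ((2 * (s.sign * C.orient) * C.meanDensity : ℝ) : ℂ)) • (q : L2 g) := rfl
  rw [h0]
  filter_upwards [Lp.coeFn_add ((-2 * Complex.I) • (C.multiplier : L2 g))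
      ((Complex.I * ((2 * (s.sign * C.orient) * C.meanDensity : ℝ) : ℂ)) • (q : L2 g)),
    Lp.coeFn_smul (-2 * Complex.I) (C.multiplier : L2 g),
    Lp.coeFn_smul (Complex.I * ((2 * (s.sign * C.orient) * C.meanDensity : ℝ) : ℂ)) (q : L2 g),
    C.coeFn_multiplier, C.coeFn_densityMom, ae_forall_lt fun a => C.coeFn_mom_lift,
    ae_forall_lt (N := C.length) fun a _ =>
      conj_mul_eq_toep_add_rem (memLp_conj_mul_incl q (C.lift a))] with x h1 h2 h3 h4 h5 h6 h7
  have hsub : ∀ a < C.length, (incl (C.lift a) : L2 g) x = (C.vec a : L2 g) x := fun a ha => by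
    rw [C.incl_lift a ha]
  have hsum : ∀ F : ℕ → ℂ → ℂ, ∑ a ∈ Finset.range C.length, F a ((incl (C.lift a) : L2 g) x) =
      ∑ a ∈ Finset.range C.length, F a ((C.vec a : L2 g) x) := fun F =>
    Finset.sum_congr rfl fun a ha => by rw [hsub a (Finset.mem_range.1 ha)]
  rw [h5]
  have h8 : ∑ a ∈ Finset.range C.length, (conj ((incl (C.lift (C.length - 1 - a)) : L2 g) x) *
      (mom (C.lift a) : L2 g) x - conj ((mom (C.lift (C.length - 1 - a)) : L2 g) x) *
      (incl (C.lift a) : L2 g) x) = ∑ a ∈ Finset.range C.length,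
      (conj ((C.vec (C.length - 1 - a) : L2 g) x) *
      (mom (C.lift a) : L2 g) x - conj ((mom (C.lift (C.length - 1 - a)) : L2 g) x) *
      (C.vec a : L2 g) x) := by
    refine Finset.sum_congr rfl fun a ha => ?_
    have ha' := Finset.mem_range.1 ha
    rw [hsub a ha', hsub (C.length - 1 - a) (by omega)]
  rw [h8]
  refine chain_pointwise C.length C.shift s.sign C.orient
    (2 * (s.sign * C.orient) * C.meanDensity) ((q : L2 g) x) ((C.free : L2 g) x) _
    (fun a => (C.vec a : L2 g) x) (fun a => (mom (C.lift a) : L2 g) x)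
    (fun a => (toep (g := g) q (incl (C.lift a)) : L2 g) x)
    (fun a => (rem q (incl (C.lift a)) : L2 g) x) (fun a ha => ?_) h6 ?_ ?_
  · rw [← h7 a ha, hsub a ha]
  · rw [h1, Pi.add_apply, h2, h3, Pi.smul_apply, Pi.smul_apply, h4, smul_eq_mul, smul_eq_mul,
      hsum fun a z => z * (rem q (incl (C.lift (C.length - 1 - a))) : L2 g) x]
  · rcases C.boundary with ⟨h, h9, h10⟩ | ⟨h, h9, h10⟩
    · exact Or.inl ⟨h, by rw [h9], by rw [h10]⟩
    · exact Or.inr ⟨h, by rw [h9], by rw [h10]⟩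

/-- The primitive of `Re(q̄ X)` is a multiple of the density of the chain minus its mean. -/
theorem primitive_field (C : LaxChain s q) : ∀ᵐ x : g.Space,
    (primitive g (fun y => (conj ((q : L2 g) y) * (C.field : L2 g) y).re) x : ℂ) =
      -C.orient * (C.density x - C.meanDensity) := by
  set c : ℂ := ((-C.orient : ℝ) : ℂ) with hc
  have h1 : (fun y => (conj ((q : L2 g) y) * (C.field : L2 g) y).re) =ᵐ[volume]
      fun y => (Complex.I * (c • C.densityMom : L2 g) y).re := by
    filter_upwards [C.re_conj_mul_field, Lp.coeFn_smul c C.densityMom] with x h1 h2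
    rw [h1, h2, Pi.smul_apply, smul_eq_mul]
  have hm := C.isMomentum_density.smul c
  have hi : Integrable (c • C.densityMom : L2 g) volume :=
    (C.integrable_densityMom.smul c).congr (Lp.coeFn_smul c C.densityMom).symm
  rw [primitive_congr h1]
  have h2 : ∫ x, (c • C.density : L2 g) x = c * ∫ x, C.density x := by
    rw [← integral_const_mul]
    exact integral_congr_ae (Lp.coeFn_smul c C.density)
  filter_upwards [primitive_momentum hm (integrable_fhat hm) hi, Lp.coeFn_smul c C.density,
    C.coeFn_density] with x h3 h4 h5
  have h6 : conj (C.density x) = C.density x := by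
    rw [h5, map_sum, ← sum_range_reflect_swap (fun a b => conj ((incl (C.lift b) : L2 g) x) *
      (incl (C.lift a) : L2 g) x)]
    refine Finset.sum_congr rfl fun a _ => ?_
    rw [map_mul, Complex.conj_conj, mul_comm]
  have h7 : ((C.density x).re : ℂ) = C.density x := Complex.conj_eq_iff_re.1 h6
  rw [h3, h2, h4, Pi.smul_apply, smul_eq_mul, hc, Complex.re_ofReal_mul, Complex.re_ofReal_mul,
    C.integral_density, meanDensity]
  push_cast
  rw [h7]
  ring

/-- The field of the chain is a symplectic gradient: `Ω X` is the gradient of the chain. -/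
theorem bigOmega_field (C : LaxChain s q) : bigOmega s q C.field = C.grad := by
  set T : ℕ → Hardy g := fun a =>
    toep (g := g) (toep (g := g) q (incl (C.lift (C.length - 1 - a)))) (incl (C.lift a)) with hT
  set H : ℕ → Hardy g := fun a =>
    hmul (incl (C.lift a)) (rem q (incl (C.lift (C.length - 1 - a)))) with hH
  set W : ℕ → L2 g := fun a => toL2 g fun x =>
    conj ((toep (g := g) q (incl (C.lift (C.length - 1 - a))) : L2 g) x) *
      (incl (C.lift a) : L2 g) x with hW
  set c : ℂ := -C.orient * Complex.I with hc
  have h1 : theta q C.field = c • (∑ a ∈ Finset.range C.length, (W a + (H a : L2 g)) -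
      (C.meanDensity : ℂ) • (q : L2 g)) := by
    refine toL2_eq ?_
    have hs : ∀ a < C.length, ∀ᵐ x : g.Space, (W a + (H a : L2 g) : L2 g) x =
        (q : L2 g) x * (conj ((incl (C.lift (C.length - 1 - a)) : L2 g) x) *
          (incl (C.lift a) : L2 g) x) := by
      intro a _
      filter_upwards [Lp.coeFn_add (W a) (H a : L2 g), coeFn_toL2 (memLp_conj_mul_incl
          (toep (g := g) q (incl (C.lift (C.length - 1 - a)))) (C.lift a)),
        coeFn_hmul_left (b := rem q (incl (C.lift (C.length - 1 - a)))) (essBdd_incl (C.lift a)),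
        conj_mul_eq_toep_add_rem (memLp_conj_mul_incl q (C.lift (C.length - 1 - a)))]
        with x h1 h2 h3 h4
      have h5 := congrArg conj h4
      simp only [map_mul, map_add, Complex.conj_conj] at h5
      rw [h1, Pi.add_apply, hW, hH, h2, h3]
      linear_combination -(incl (C.lift a) : L2 g) x * h5
    filter_upwards [Lp.coeFn_smul c (∑ a ∈ Finset.range C.length, (W a + (H a : L2 g)) -
        (C.meanDensity : ℂ) • (q : L2 g)),
      Lp.coeFn_sub (∑ a ∈ Finset.range C.length, (W a + (H a : L2 g)))
        ((C.meanDensity : ℂ) • (q : L2 g)), Lp.coeFn_smul (C.meanDensity : ℂ) (q : L2 g),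
      coeFn_finset_sum (Finset.range C.length) fun a => (W a + (H a : L2 g)), ae_forall_lt hs,
      C.primitive_field, C.coeFn_density] with x h1 h2 h3 h4 h5 h6 h7
    rw [h1, Pi.smul_apply, h2, Pi.sub_apply, h3, Pi.smul_apply, h4, h6, smul_eq_mul, smul_eq_mul,
      Finset.sum_congr rfl fun a ha => h5 a (Finset.mem_range.1 ha), ← Finset.mul_sum, ← h7, hc]
    ring
  have h2 : szego g (theta q C.field) = c • (∑ a ∈ Finset.range C.length, T a +
      ∑ a ∈ Finset.range C.length, H a - (C.meanDensity : ℂ) • q) := by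
    have h3 : ∀ f : Hardy g, szego g (f : L2 g) = f := fun f => Subtype.ext (szego_of_mem f.2)
    rw [h1, map_smul, map_sub, map_smul, map_sum, h3, ← Finset.sum_add_distrib]
    congr 2
    refine Finset.sum_congr rfl fun a _ => ?_
    rw [map_add, h3]
    rfl
  rw [bigOmega, h2, field, multiplier, grad, hc]
  push_cast
  generalize ∑ a ∈ Finset.range C.length, T a = t
  generalize ∑ a ∈ Finset.range C.length, H a = k
  generalize C.free = w
  match_scalars <;> ring_nf <;> simp only [Complex.I_sq] <;> ring

end LaxChain

/-! ### Antisymmetry of the symplectic form -/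

/-- The symplectic form as a double integral against the kernel of `∂̃⁻¹`. -/
theorem omega_eq (s : Interaction) (q f h : Hardy g) : omega s q f h = -(⟪f, h⟫_ℂ).im +
    2 * s.sign * ∫ x, (conj ((q : L2 g) x) * (f : L2 g) x).re *
      primitive g (fun y => (conj ((q : L2 g) y) * (h : L2 g) y).re) x := by
  set F : g.Space → ℝ := fun y => (conj ((q : L2 g) y) * (h : L2 g) y).re with hF
  have hFi : Integrable F volume := (integrable_conj_mul _ _).re
  set P := primitive g F with hP
  have hPm : AEStronglyMeasurable (fun x => (P x : ℂ)) volume :=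
    Complex.continuous_ofReal.comp_aestronglyMeasurable (aestronglyMeasurable_primitive hFi)
  have hPb : EssBdd fun x : g.Space => (P x : ℂ) :=
    ⟨_, Eventually.of_forall fun x => by
      rw [Complex.norm_real]; exact abs_primitive_le hFi x⟩
  have hm : MemLp (fun x => Complex.I * (q : L2 g) x * (P x : ℂ)) 2 volume :=
    memLp_mul_of_bdd ((L2.memLp (q : L2 g)).const_mul Complex.I) hPm hPb
  have ht : theta q h =ᵐ[volume] fun x => Complex.I * (q : L2 g) x * (P x : ℂ) := coeFn_toL2 hm
  have h1 : (Complex.I * ⟪f, szego g (theta q h)⟫_ℂ).re =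
      -∫ x, (conj ((q : L2 g) x) * (f : L2 g) x).re * P x := by
    have hi : Integrable (fun x => conj ((f : L2 g) x) * theta q h x) volume :=
      integrable_conj_mul _ _
    have e1 : (Complex.I * ∫ x, conj ((f : L2 g) x) * theta q h x).re =
        ∫ x, (Complex.I * (conj ((f : L2 g) x) * theta q h x)).re := by
      rw [← integral_const_mul]
      exact (integral_re (hi.const_mul Complex.I)).symm
    rw [inner_szego_right, inner_eq_integral, e1, ← integral_neg]
    refine integral_congr_ae ?_
    filter_upwards [ht] with x hx
    rw [hx]
    simp only [Complex.mul_re, Complex.mul_im, Complex.I_re, Complex.I_im, Complex.conj_re,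
      Complex.conj_im, Complex.ofReal_re, Complex.ofReal_im]
    ring
  rw [omega, bigOmega, Hardy.inner_smul_right, inner_sub_right, Hardy.inner_smul_right, mul_sub,
    mul_left_comm, Complex.sub_re, Complex.re_ofReal_mul, h1, Complex.mul_re, Complex.I_re,
    Complex.I_im]
  ring

theorem omega_antisymm (s : Interaction) (q f h : Hardy g) : omega s q f h = -omega s q h f := by
  have hi : ∀ k : Hardy g,
      Integrable (fun x : g.Space => (conj ((q : L2 g) x) * (k : L2 g) x).re) volume :=
    fun k => (integrable_conj_mul _ _).re
  rw [omega_eq, omega_eq, primitive_antisymm (hi f) (hi h), ← Hardy.inner_conj_symm h f,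
    Complex.conj_im]
  ring

theorem continuous_omega (s : Interaction) (q h : Hardy g) : Continuous fun f => omega s q f h :=
  Complex.continuous_re.comp (Continuous.inner (𝕜 := ℂ) (E := Hardy g) continuous_id
    continuous_const)

/-! ### Density of the Hardy–Sobolev spaces -/

theorem SobolevCurve.mem : ∀ {k : ℕ} {v : ℝ → Hardy g}, SobolevCurve g k v →
    v 0 ∈ HardySobolev g k
  | 0, _, _ => Set.mem_univ _
  | _ + 1, _, ⟨_, p, hp, hv⟩ => ⟨p 0, hp.mem, hv 0⟩

theorem HardySobolev.sub_mem {k : ℕ} {f h : Hardy g} (hf : f ∈ HardySobolev g k)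
    (hh : h ∈ HardySobolev g k) : f - h ∈ HardySobolev g k :=
  ((sobolevCurve_const hf).sub (sobolevCurve_const hh)).mem

theorem HardySobolev.of_succ {k : ℕ} {f : Hardy g} (hf : f ∈ HardySobolev g (k + 1)) :
    f ∈ HardySobolev g k := (sobolevCurve_const hf).of_succ.mem

/-- The free resolvent gains a derivative. -/
theorem incl_mem_of_freeL : ∀ {k : ℕ} {u : Sobolev g}, freeL 1 u ∈ HardySobolev g k →
    incl u ∈ HardySobolev g (k + 1)
  | 0, u, _ => ⟨mom u, Set.mem_univ _, isMomentum_mom u⟩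
  | k + 1, u, h => by
    refine ⟨mom u, ?_, isMomentum_mom u⟩
    have h1 : mom u = freeL 1 u - incl u := by
      rw [freeL_apply, Complex.ofReal_one, one_smul, add_sub_cancel_right]
    rw [h1]
    exact HardySobolev.sub_mem h (incl_mem_of_freeL (HardySobolev.of_succ h))

theorem dense_hardySobolev : ∀ n : ℕ, Dense (HardySobolev g n)
  | 0 => dense_univ
  | n + 1 => by
    have hb := freeL_bijective (g := g) zero_lt_one
    set e := ContinuousLinearEquiv.ofBijective (freeL (g := g) 1) (LinearMap.ker_eq_bot.2 hb.1)
      (LinearMap.range_eq_top.2 hb.2) with he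
    have h1 : DenseRange (incl ∘ e.symm) :=
      denseRange_incl.comp e.symm.surjective.denseRange incl.continuous
    refine (h1.dense_image (incl.continuous.comp e.symm.continuous)
      (dense_hardySobolev n)).mono ?_
    rintro _ ⟨h, hh, rfl⟩
    refine incl_mem_of_freeL ?_
    have h2 : freeL 1 (e.symm h) = h := e.apply_symm_apply h
    rw [h2]; exact hh

/-! ### A commutation identity for chains -/

theorem toep_coe_add_left (a b : Hardy g) (u : Sobolev g) :
    toep (g := g) ((a + b : Hardy g) : L2 g) (incl u) =
      toep (g := g) a (incl u) + toep (g := g) b (incl u) :=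
  toep_add_left (memLp_conj_mul_incl a u) (memLp_conj_mul_incl b u)

theorem toep_coe_smul_left (c : ℂ) (a : Hardy g) (u : Sobolev g) :
    toep (g := g) ((c • a : Hardy g) : L2 g) (incl u) = conj c • toep (g := g) a (incl u) :=
  toep_smul_left c (memLp_conj_mul_incl a u)

theorem toep_coe_sum_left {ι : Type*} (t : Finset ι) (a : ι → Hardy g) (u : Sobolev g) :
    toep (g := g) ((∑ i ∈ t, a i : Hardy g) : L2 g) (incl u) =
      ∑ i ∈ t, toep (g := g) (a i) (incl u) := by
  classical
  induction t using Finset.induction_on with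
  | empty =>
    rw [Finset.sum_empty, Finset.sum_empty, ← zero_smul ℂ (0 : Hardy g), toep_coe_smul_left,
      map_zero, zero_smul, zero_smul]
  | insert i t hi ih => rw [Finset.sum_insert hi, Finset.sum_insert hi, toep_coe_add_left, ih]

theorem toep_coe_add_right (u : Sobolev g) (a b : Hardy g) :
    toep (g := g) (incl u) ((a + b : Hardy g) : L2 g) =
      toep (g := g) (incl u) a + toep (g := g) (incl u) b :=
  toep_add_right (memLp_conj_incl_mul a u) (memLp_conj_incl_mul b u)

theorem toep_coe_smul_right (c : ℂ) (u : Sobolev g) (a : Hardy g) :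
    toep (g := g) (incl u) ((c • a : Hardy g) : L2 g) = c • toep (g := g) (incl u) a :=
  toep_smul_right c (memLp_conj_incl_mul a u)

theorem toep_coe_sub_right (u : Sobolev g) (a b : Hardy g) :
    toep (g := g) (incl u) ((a - b : Hardy g) : L2 g) =
      toep (g := g) (incl u) a - toep (g := g) (incl u) b := by
  rw [eq_sub_iff_add_eq, ← toep_coe_add_right, sub_add_cancel]

/-- Moving the factor `q C₊(q̄ ·)` from the symbol to the argument leaves the remainder of
`q̄ u'`. -/
theorem inner_toep_cubic_sub (q : Hardy g) (u u' f h : Sobolev g) :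
    ⟪toep (g := g) (incl u) (incl f), toep (g := g) (cubic q q u') (incl h)⟫_ℂ -
      ⟪toep (g := g) (incl u) (incl f), toep (g := g) (incl u') (cubic q q h)⟫_ℂ =
      -⟪toep (g := g) (hmul (incl u) (rem q (incl u'))) (incl f), toep (g := g) q (incl h)⟫_ℂ := by
  set A := toep (g := g) (incl u) (incl f) with hA
  set G := toep (g := g) q (incl u') with hG
  set H := toep (g := g) q (incl h) with hH
  set R := rem q (incl u') with hR
  have hAb : EssBdd ((A : L2 g) : g.Space → ℂ) := essBdd_toep (incl u) f
  have hGb : EssBdd ((G : L2 g) : g.Space → ℂ) := essBdd_toep q u'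
  have hHb : EssBdd ((H : L2 g) : g.Space → ℂ) := essBdd_toep q h
  have h1 : ⟪A, toep (g := g) (cubic q q u') (incl h)⟫_ℂ = ⟪hmul A G, H⟫_ℂ := by
    rw [inner_toep_right (memLp_conj_mul_incl _ h), hH,
      inner_toep_right (memLp_conj_mul_incl _ h)]
    refine integral_congr_ae ?_
    filter_upwards [coeFn_cubic q q u', coeFn_hmul_right (a := A) hGb] with x h2 h3
    rw [h2, h3]
    simp only [map_mul]
    ring
  have h2 : ⟪A, toep (g := g) (incl u') (cubic q q h)⟫_ℂ = ⟪hmul A G, H⟫_ℂ + ⟪A, hmul R H⟫_ℂ := by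
    rw [inner_toep_right (memLp_conj_incl_mul _ u'), Submodule.coe_inner, Submodule.coe_inner,
      inner_eq_integral, inner_eq_integral,
      ← integral_add (integrable_conj_mul _ _) (integrable_conj_mul _ _)]
    refine integral_congr_ae ?_
    filter_upwards [coeFn_cubic q q h, coeFn_hmul_right (a := A) hGb,
      coeFn_hmul_right (a := R) hHb, conj_mul_eq_toep_add_rem (memLp_conj_mul_incl q u')]
      with x h2 h3 h4 h5
    have h6 := congrArg conj h5
    simp only [map_mul, map_add, Complex.conj_conj] at h6
    rw [h2, h3, h4, map_mul]
    linear_combination conj ((A : L2 g) x) * (H : L2 g) x * h6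
  have h3 : ⟪toep (g := g) (hmul (incl u) R) (incl f), H⟫_ℂ = ⟪A, hmul R H⟫_ℂ := by
    rw [inner_toep_left (memLp_conj_mul_incl _ f), hA,
      inner_toep_left (memLp_conj_mul_incl _ f)]
    refine integral_congr_ae ?_
    filter_upwards [coeFn_hmul_left (b := R) (essBdd_incl u), coeFn_hmul_right (a := R) hHb]
      with x h2 h3
    rw [h2, h3]
    simp only [map_mul, Complex.conj_conj]
    ring
  rw [h1, h2, h3]
  ring

theorem inner_cubic_toep_sub (q : Hardy g) (u u' f h : Sobolev g) :
    ⟪toep (g := g) (cubic q q u) (incl f), toep (g := g) (incl u') (incl h)⟫_ℂ -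
      ⟪toep (g := g) (incl u) (cubic q q f), toep (g := g) (incl u') (incl h)⟫_ℂ =
      -⟪toep (g := g) q (incl f), toep (g := g) (hmul (incl u') (rem q (incl u))) (incl h)⟫_ℂ := by
  have h1 := congrArg conj (inner_toep_cubic_sub q u' u h f)
  simpa only [map_sub, map_neg, Hardy.inner_conj_symm] using h1

/-- The Leibniz rule, in weak form. -/
theorem inner_toep_mom_sub (u u' f h : Sobolev g) :
    ⟪toep (g := g) (incl u) (incl f), toep (g := g) (incl u') (mom h)⟫_ℂ -
      ⟪toep (g := g) (incl u) (mom f), toep (g := g) (incl u') (incl h)⟫_ℂ =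
    ⟪toep (g := g) (incl u) (incl f), toep (g := g) (mom u') (incl h)⟫_ℂ -
      ⟪toep (g := g) (mom u) (incl f), toep (g := g) (incl u') (incl h)⟫_ℂ := by
  have h1 : ⟪toep (g := g) (incl u) (incl f),
      toep (g := g) (incl u') (mom h) - toep (g := g) (mom u') (incl h)⟫_ℂ =
      ⟪toep (g := g) (incl u) (mom f) - toep (g := g) (mom u) (incl f),
      toep (g := g) (incl u') (incl h)⟫_ℂ :=
    (isMomentum_toep (isMomentum_mom u) (isMomentum_mom f)).inner_eq
      (isMomentum_toep (isMomentum_mom u') (isMomentum_mom h))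
  rw [inner_sub_right, inner_sub_left] at h1
  linear_combination h1

namespace LaxChain

variable {s : Interaction} {q : Hardy g}

theorem orient_mul_self (C : LaxChain s q) : C.orient * C.orient = 1 := by
  rcases C.boundary with ⟨h, -⟩ | ⟨h, -⟩ <;> rw [h] <;> norm_num

theorem mom_lift (C : LaxChain s q) {a : ℕ} (ha : a < C.length) :
    mom (C.lift a) = C.vec (a + 1) + ((-C.shift : ℝ) : ℂ) • C.vec a +
      (s.sign : ℂ) • cubic q q (C.lift a) := by
  have h1 := C.lax_lift a ha
  rw [laxL_apply, sub_eq_iff_eq_add] at h1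
  rw [h1, Complex.ofReal_neg, neg_smul, sub_eq_add_neg]

/-- The sesquilinear form `Σ ⟪C₊(z̄_a f), C₊(z̄_{N-1-a} h)⟫`. -/
def form (C : LaxChain s q) (f h : Hardy g) : ℂ := ∑ a ∈ Finset.range C.length,
  ⟪toep (g := g) (incl (C.lift a)) f, toep (g := g) (incl (C.lift (C.length - 1 - a))) h⟫_ℂ

theorem conj_form (C : LaxChain s q) (f h : Hardy g) : conj (C.form f h) = C.form h f := by
  rw [form, map_sum, form, ← sum_range_reflect_swap (fun a b =>
    ⟪toep (g := g) (incl (C.lift a)) h, toep (g := g) (incl (C.lift b)) f⟫_ℂ)]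
  exact Finset.sum_congr rfl fun a _ => Hardy.inner_conj_symm _ _

theorem form_sub_right (C : LaxChain s q) (f h k : Hardy g) :
    C.form f (h - k) = C.form f h - C.form f k := by
  simp only [form, toep_coe_sub_right, inner_sub_right, Finset.sum_sub_distrib]

theorem form_smul_right (C : LaxChain s q) (c : ℂ) (f h : Hardy g) :
    C.form f (c • h) = c * C.form f h := by
  simp only [form, toep_coe_smul_right, Hardy.inner_smul_right, Finset.mul_sum]

theorem form_sub_left (C : LaxChain s q) (f h k : Hardy g) :
    C.form (h - k) f = C.form h f - C.form k f := by
  rw [← conj_form, form_sub_right, map_sub, conj_form, conj_form]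

theorem form_smul_left (C : LaxChain s q) (c : ℂ) (f h : Hardy g) :
    C.form (c • h) f = conj c * C.form h f := by
  rw [← conj_form, form_smul_right, map_mul, conj_form]

/-- The commutator of the form with the Lax operator is given by the multiplier of the chain. -/
theorem form_laxL_sub (C : LaxChain s q) (f h : Sobolev g) :
    C.form (incl f) (laxL s q h) - C.form (laxL s q f) (incl h) =
      C.orient * (⟪toep (g := g) q (incl f), toep (g := g) C.multiplier (incl h)⟫_ℂ -
        ⟪toep (g := g) C.multiplier (incl f), toep (g := g) q (incl h)⟫_ℂ) := by
  set N := C.length with hN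
  set B : ℕ → ℕ → ℂ := fun a b =>
    ⟪toep (g := g) (C.vec b) (incl f), toep (g := g) (C.vec a) (incl h)⟫_ℂ with hB
  set P : ℕ → ℕ → ℂ := fun a b =>
    ⟪toep (g := g) (hmul (incl (C.lift a)) (rem q (incl (C.lift b)))) (incl f),
      toep (g := g) q (incl h)⟫_ℂ with hP
  set Q : ℕ → ℕ → ℂ := fun a b => ⟪toep (g := g) q (incl f),
    toep (g := g) (hmul (incl (C.lift a)) (rem q (incl (C.lift b)))) (incl h)⟫_ℂ with hQ
  have h1 : ∀ a ∈ Finset.range N,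
      ⟪toep (g := g) (incl (C.lift a)) (incl f),
        toep (g := g) (incl (C.lift (N - 1 - a))) (laxL s q h)⟫_ℂ -
      ⟪toep (g := g) (incl (C.lift a)) (laxL s q f),
        toep (g := g) (incl (C.lift (N - 1 - a))) (incl h)⟫_ℂ =
      -(B (N - 1 - a) (a + 1) - B (N - 1 - a + 1) a) +
        s.sign * (Q (N - 1 - a) a - P a (N - 1 - a)) := by
    intro a ha
    have ha' := Finset.mem_range.1 ha
    have e1 := inner_toep_mom_sub (C.lift a) (C.lift (N - 1 - a)) f h
    have e2 := inner_toep_cubic_sub q (C.lift a) (C.lift (N - 1 - a)) f h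
    have e3 := inner_cubic_toep_sub q (C.lift a) (C.lift (N - 1 - a)) f h
    rw [C.mom_lift ha', C.mom_lift (show N - 1 - a < C.length by omega)] at e1
    simp only [toep_coe_add_left, toep_coe_smul_left, inner_add_left, inner_add_right,
      Hardy.inner_smul_left, Hardy.inner_smul_right, Complex.conj_ofReal,
      C.incl_lift a ha', C.incl_lift (N - 1 - a) (show N - 1 - a < C.length by omega)] at e1 e2 e3
    simp only [laxL_apply, toep_coe_sub_right, toep_coe_smul_right, inner_sub_left,
      inner_sub_right, Hardy.inner_smul_left, Hardy.inner_smul_right, Complex.conj_ofReal]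
    simp only [hB, hP, hQ, C.incl_lift a ha',
      C.incl_lift (N - 1 - a) (show N - 1 - a < C.length by omega)]
    linear_combination e1 + (s.sign : ℂ) * e2 - (s.sign : ℂ) * e3
  have h2 : C.form (incl f) (laxL s q h) - C.form (laxL s q f) (incl h) =
      B N 0 - B 0 N + s.sign * (∑ a ∈ Finset.range N, Q a (N - 1 - a) -
        ∑ a ∈ Finset.range N, P a (N - 1 - a)) := by
    rw [form, form, ← Finset.sum_sub_distrib, Finset.sum_congr rfl h1, Finset.sum_add_distrib,
      Finset.sum_neg_distrib, sum_range_telescope, ← Finset.mul_sum, Finset.sum_sub_distrib,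
      sum_range_reflect_swap]
    ring
  have h3 : B N 0 - B 0 N = C.orient * (⟪toep (g := g) q (incl f), toep (g := g) C.free (incl h)⟫_ℂ
      - ⟪toep (g := g) C.free (incl f), toep (g := g) q (incl h)⟫_ℂ) := by
    rcases C.boundary with ⟨h, h0, hN'⟩ | ⟨h, h0, hN'⟩
    · simp only [hB, hN, h, h0, hN', Complex.ofReal_one, one_mul]
    · simp only [hB, hN, h, h0, hN', Complex.ofReal_neg, Complex.ofReal_one]
      ring
  have h4 : ⟪toep (g := g) q (incl f), toep (g := g) C.multiplier (incl h)⟫_ℂ =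
      ⟪toep (g := g) q (incl f), toep (g := g) C.free (incl h)⟫_ℂ +
        (s.sign * C.orient : ℝ) * ∑ a ∈ Finset.range N, Q a (N - 1 - a) := by
    rw [multiplier, toep_coe_add_left, toep_coe_smul_left, toep_coe_sum_left, inner_add_right,
      Hardy.inner_smul_right, Complex.conj_ofReal, inner_sum]
  have h5 : ⟪toep (g := g) C.multiplier (incl f), toep (g := g) q (incl h)⟫_ℂ =
      ⟪toep (g := g) C.free (incl f), toep (g := g) q (incl h)⟫_ℂ +
        (s.sign * C.orient : ℝ) * ∑ a ∈ Finset.range N, P a (N - 1 - a) := by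
    rw [multiplier, toep_coe_add_left, toep_coe_smul_left, toep_coe_sum_left, inner_add_left,
      Hardy.inner_smul_left, Complex.conj_ofReal, Complex.conj_ofReal, sum_inner]
  have h6 : (C.orient : ℂ) * C.orient = 1 := by
    rw [← Complex.ofReal_mul, C.orient_mul_self, Complex.ofReal_one]
  rw [h2, h3, h4, h5]
  push_cast
  linear_combination -((s.sign : ℂ) * (∑ a ∈ Finset.range N, Q a (N - 1 - a) -
        ∑ a ∈ Finset.range N, P a (N - 1 - a))) * h6

end LaxChain

/-! ### Vanishing of the Poisson brackets -/

/-- The pairing of `w` with `u r'`, where `r'` is the conjugate of the strictly negative part of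
`q̄ u'`, is a pairing of Toeplitz terms up to a contribution of the zero mode. -/
theorem inner_hmul_rem (q w : Hardy g) (u u' : Sobolev g) :
    ⟪hmul (incl u) (rem q (incl u')), w⟫_ℂ =
      ⟪toep (g := g) (incl u') q, toep (g := g) (incl u) w⟫_ℂ -
        meanWeight g * (⟪q, incl u'⟫_ℂ * ⟪incl u, w⟫_ℂ) := by
  set c : ℂ := meanWeight g * ⟪incl u', q⟫_ℂ with hc
  have h1 : hmul (incl u) (rem q (incl u')) =
      hmul (incl u) (toep (g := g) (incl u') q) - c • incl u := by
    refine hmul_eq ?_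
    filter_upwards [toep_swap_eq (memLp_conj_mul_incl q u'),
      coeFn_hmul_left (b := toep (g := g) (incl u') q) (essBdd_incl u),
      Lp.coeFn_sub (hmul (incl u) (toep (g := g) (incl u') q) : L2 g) (c • (incl u : L2 g)),
      Lp.coeFn_smul c (incl u : L2 g)] with x h1 h2 h3 h4
    rw [Submodule.coe_sub, Submodule.coe_smul, h3, Pi.sub_apply, h2, h4, Pi.smul_apply, h1,
      smul_eq_mul, hc]
    ring
  have h2 := congrArg conj (inner_toep_eq (memLp_conj_incl_mul w u)
    (coeFn_hmul_left (b := toep (g := g) (incl u') q) (essBdd_incl u)))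
  rw [Hardy.inner_conj_symm, Hardy.inner_conj_symm] at h2
  rw [h1, inner_sub_left, Hardy.inner_smul_left, ← h2, hc, map_mul, Hardy.inner_conj_symm,
    Complex.conj_ofReal, mul_assoc]

namespace LaxChain

variable {s : Interaction} {q : Hardy g}

/-- The commutation identity, summed over the second chain and telescoped. -/
theorem im_form_eq (C C' : LaxChain s q) :
    C'.orient * (C.form q C'.free).im = -C.orient * (∑ b ∈ Finset.range C'.length,
      ⟪toep (g := g) C.multiplier (incl (C'.lift b)),
        toep (g := g) q (incl (C'.lift (C'.length - 1 - b)))⟫_ℂ).im := by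
  set N := C'.length with hN
  set K := ∑ b ∈ Finset.range N, ⟪toep (g := g) C.multiplier (incl (C'.lift b)),
        toep (g := g) q (incl (C'.lift (N - 1 - b)))⟫_ℂ with hK
  have h1 : ∀ b ∈ Finset.range N,
      -(C.form (C'.vec (b + 1)) (C'.vec (N - 1 - b)) -
        C.form (C'.vec b) (C'.vec (N - 1 - b + 1))) =
      C.orient * (⟪toep (g := g) q (incl (C'.lift b)),
          toep (g := g) C.multiplier (incl (C'.lift (N - 1 - b)))⟫_ℂ -
        ⟪toep (g := g) C.multiplier (incl (C'.lift b)),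
          toep (g := g) q (incl (C'.lift (N - 1 - b)))⟫_ℂ) := by
    intro b hb
    have hb' := Finset.mem_range.1 hb
    have hb2 : N - 1 - b < C'.length := by omega
    rw [← C.form_laxL_sub, C'.lax_lift b hb', C'.lax_lift _ hb2, C'.incl_lift b hb',
      C'.incl_lift _ hb2, form_sub_right, form_sub_left, form_smul_right, form_smul_left,
      Complex.conj_ofReal]
    ring
  have h2 := Finset.sum_congr rfl h1
  rw [Finset.sum_neg_distrib, sum_range_telescope (fun c d => C.form (C'.vec d) (C'.vec c)),
    ← Finset.mul_sum, Finset.sum_sub_distrib, ← hK] at h2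
  have h3 : ∑ b ∈ Finset.range N, ⟪toep (g := g) q (incl (C'.lift b)),
      toep (g := g) C.multiplier (incl (C'.lift (N - 1 - b)))⟫_ℂ = conj K := by
    rw [hK, map_sum, ← sum_range_reflect_swap (fun a b => ⟪toep (g := g) q (incl (C'.lift a)),
      toep (g := g) C.multiplier (incl (C'.lift b))⟫_ℂ)]
    exact Finset.sum_congr rfl fun a _ => (Hardy.inner_conj_symm _ _).symm
  have h4 : (C.form (C'.vec 0) (C'.vec N)).im = -C.orient * K.im := by
    have h5 := congrArg Complex.im h2
    rw [h3, ← C.conj_form (C'.vec 0) (C'.vec N)] at h5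
    simp only [Complex.neg_im, Complex.sub_im, Complex.conj_im, Complex.im_ofReal_mul] at h5
    linarith
  rcases C'.boundary with ⟨h, h0, hN'⟩ | ⟨h, h0, hN'⟩
  · rw [h, one_mul, ← h4, h0, hN, hN']
  · rw [h, ← h4, h0, hN, hN', ← C.conj_form q C'.free, Complex.conj_im]; ring

theorem im_inner_multiplier (C C' : LaxChain s q)
    (h : ∀ a ≤ C.length, ∀ b ≤ C'.length, (⟪C.vec a, C'.vec b⟫_ℂ).im = 0) :
    (⟪C.multiplier, C'.free⟫_ℂ).im = s.sign * C.orient * (C.form q C'.free).im := by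
  have hq : ∀ a < C.length, (⟪q, incl (C.lift a)⟫_ℂ).im = 0 := fun a ha => by
    rw [C.incl_lift a ha, ← Hardy.inner_conj_symm, Complex.conj_im, neg_eq_zero]
    rcases C'.boundary with ⟨-, h0, -⟩ | ⟨-, -, h0⟩
    · rw [← h a ha.le 0 (Nat.zero_le _), h0]
    · rw [← h a ha.le _ le_rfl, h0]
  have hw : ∀ a ≤ C.length, (⟪C.vec a, C'.free⟫_ℂ).im = 0 := fun a ha => by
    rcases C'.boundary with ⟨-, -, h0⟩ | ⟨-, h0, -⟩
    · rw [← h a ha _ le_rfl, h0]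
    · rw [← h a ha 0 (Nat.zero_le _), h0]
  have hww : (⟪C.free, C'.free⟫_ℂ).im = 0 := by
    rcases C.boundary with ⟨-, -, h0⟩ | ⟨-, h0, -⟩
    · rw [← hw _ le_rfl, h0]
    · rw [← hw 0 (Nat.zero_le _), h0]
  have hs : (∑ a ∈ Finset.range C.length,
      ⟪hmul (incl (C.lift a)) (rem q (incl (C.lift (C.length - 1 - a)))), C'.free⟫_ℂ).im =
      (C.form q C'.free).im := by
    rw [form, ← sum_range_reflect_swap (fun a b => ⟪toep (g := g) (incl (C.lift a)) q,
      toep (g := g) (incl (C.lift b)) C'.free⟫_ℂ), Complex.im_sum, Complex.im_sum]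
    refine Finset.sum_congr rfl fun a ha => ?_
    have ha' := Finset.mem_range.1 ha
    have h1 := hq (C.length - 1 - a) (by omega)
    have h2 := hw a ha'.le
    rw [← C.incl_lift a ha'] at h2
    rw [inner_hmul_rem, Complex.sub_im, Complex.im_ofReal_mul, Complex.mul_im, h1, h2]
    ring
  rw [multiplier, inner_add_left, Hardy.inner_smul_left, sum_inner, Complex.conj_ofReal,
    Complex.add_im, hww, Complex.im_ofReal_mul, hs, zero_add]

/-- If the inner products between two chains are real, then the observables of the chains are in
involution. -/
theorem re_inner_field_grad (C C' : LaxChain s q)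
    (h : ∀ a ≤ C.length, ∀ b ≤ C'.length, (⟪C.vec a, C'.vec b⟫_ℂ).im = 0) :
    (⟪C.field, C'.grad⟫_ℂ).re = 0 := by
  set N := C'.length with hN
  set K := ∑ b ∈ Finset.range N, ⟪toep (g := g) C.multiplier (incl (C'.lift b)),
        toep (g := g) q (incl (C'.lift (N - 1 - b)))⟫_ℂ with hK
  set H := ∑ b ∈ Finset.range N, ⟪toep (g := g) q (incl (C'.lift b)),
        toep (g := g) q (incl (C'.lift (N - 1 - b)))⟫_ℂ with hH
  set c : ℝ := 2 * (s.sign * C.orient) * C.meanDensity with hc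
  have hHim : H.im = 0 := by
    rw [← Complex.conj_eq_iff_im, hH, map_sum, ← sum_range_reflect_swap (fun a b =>
      ⟪toep (g := g) q (incl (C'.lift a)), toep (g := g) q (incl (C'.lift b))⟫_ℂ)]
    exact Finset.sum_congr rfl fun a _ => Hardy.inner_conj_symm _ _
  have hq : (⟪q, C'.free⟫_ℂ).im = 0 := by
    rcases C.boundary with ⟨-, h0, -⟩ | ⟨-, -, h0⟩ <;>
    rcases C'.boundary with ⟨-, -, h1⟩ | ⟨-, h1, -⟩
    · rw [← h 0 (Nat.zero_le _) _ le_rfl, h0, hN, h1]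
    · rw [← h 0 (Nat.zero_le _) 0 (Nat.zero_le _), h0, h1]
    · rw [← h _ le_rfl _ le_rfl, h0, hN, h1]
    · rw [← h _ le_rfl 0 (Nat.zero_le _), h0, h1]
  have h1 : ∀ b, ⟪C.field, toep (g := g) (toep (g := g) q (incl (C'.lift (N - 1 - b))))
      (incl (C'.lift b))⟫_ℂ = conj (-2 * Complex.I *
      ⟪toep (g := g) C.multiplier (incl (C'.lift b)),
        toep (g := g) q (incl (C'.lift (N - 1 - b)))⟫_ℂ + Complex.I * c *
      ⟪toep (g := g) q (incl (C'.lift b)),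
        toep (g := g) q (incl (C'.lift (N - 1 - b)))⟫_ℂ) := by
    intro b
    rw [← Hardy.inner_conj_symm, inner_toep_swap (essBdd_incl _), field, toep_coe_add_left,
      toep_coe_smul_left, toep_coe_smul_left, inner_add_left, Hardy.inner_smul_left,
      Hardy.inner_smul_left, Complex.conj_conj, Complex.conj_conj]
  have h2 : ∑ b ∈ Finset.range N, ⟪C.field, toep (g := g)
      (toep (g := g) q (incl (C'.lift (N - 1 - b)))) (incl (C'.lift b))⟫_ℂ =
      conj (-2 * Complex.I * K + Complex.I * c * H) := by
    rw [Finset.sum_congr rfl fun b _ => h1 b, ← map_sum, Finset.sum_add_distrib, ← Finset.mul_sum,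
      ← Finset.mul_sum]
  have h3 : ⟪C.field, C'.free⟫_ℂ = 2 * Complex.I * ⟪C.multiplier, C'.free⟫_ℂ -
      Complex.I * c * ⟪q, C'.free⟫_ℂ := by
    rw [field, inner_add_left, Hardy.inner_smul_left, Hardy.inner_smul_left]
    simp only [map_mul, map_neg, Complex.conj_I, Complex.conj_ofReal, Complex.conj_ofNat]
    ring
  have h4 := C.im_inner_multiplier C' h
  have h5 := C.im_form_eq C'
  rw [← hN, ← hK] at h5
  rw [grad, Hardy.inner_smul_right, inner_sub_right, Hardy.inner_smul_right, inner_sum, ← hN, h2,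
    h3]
  simp only [Complex.mul_re, Complex.mul_im, Complex.sub_re, Complex.sub_im, Complex.conj_re,
    Complex.conj_im, Complex.add_re, Complex.add_im, Complex.I_re, Complex.I_im, Complex.ofReal_re,
    Complex.ofReal_im, Complex.neg_re, Complex.neg_im, Complex.re_ofNat, Complex.im_ofNat, hHim, hq,
    h4]
  have e1 := C.orient_mul_self
  have e2 := C'.orient_mul_self
  linear_combination (-4 * s.sign * C.orient * C'.orient) * h5 +
    (4 * s.sign * C.orient * (C.form q C'.free).im) * e2 +
    (4 * s.sign * C'.orient * K.im) * e1

end LaxChain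

/-! ### The chains of the observables -/

/-- The field of a chain is a symplectic gradient of an observable whose derivative is the gradient
of the chain. -/
theorem LaxChain.hasSymplecticGradient {s : Interaction} {q : Hardy g} (C : LaxChain s q)
    {F : Observable g}
    (h : ∀ f ∈ F.dom, HasDerivAt (fun ε : ℝ => F.val (q + (ε : ℂ) • f)) (⟪f, C.grad⟫_ℂ).re 0) :
    HasSymplecticGradient s F q C.field := fun f hf => by
  rw [omega, C.bigOmega_field]
  exact h f hf

/-- The chain `q, L_q q, …, L_qⁿ q`. -/
def energyChain {s : Interaction} {q : Hardy g} {n : ℕ} (u : ℕ → Sobolev g)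
    (hu : ∀ k < n, incl (u k) = (lax s q)^[k] q) : LaxChain s q where
  length := n
  shift := 0
  lift := u
  vec k := (lax s q)^[k] q
  incl_lift := hu
  lax_lift k hk := by
    rw [← lax_incl, hu k hk, Function.iterate_succ_apply', Complex.ofReal_zero, zero_smul, sub_zero]
  orient := 1
  free := (lax s q)^[n] q
  boundary := Or.inl ⟨rfl, rfl, rfl⟩

/-- The chain `(L_q + κ)⁻¹ q, q`. -/
def betaChain {s : Interaction} {q : Hardy g} {κ : ℝ} (m : Sobolev g)
    (hm : shiftL s q κ m = q) : LaxChain s q where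
  length := 1
  shift := κ
  lift _ := m
  vec a := if a = 0 then incl m else q
  incl_lift a ha := by rw [if_pos (by omega)]
  lax_lift a ha := by
    rw [if_neg (by omega), if_pos (by omega), eq_sub_iff_add_eq, ← shiftL_apply, hm]
  orient := -1
  free := incl m
  boundary := Or.inr ⟨rfl, rfl, rfl⟩

theorem hasSymplecticGradient_energy {s : Interaction} {q : Hardy g} {n : ℕ}
    (hq : q ∈ HardySobolev g n) {u : ℕ → Sobolev g}
    (hu : ∀ k < n, incl (u k) = (lax s q)^[k] q) :
    HasSymplecticGradient s (energy s g n) q (energyChain u hu).field := by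
  refine (energyChain u hu).hasSymplecticGradient fun f hf => ?_
  have h := hasDerivAt_energy s hq hf hu
  simp only [LaxChain.grad, energyChain, mul_one]
  exact h

theorem hasSymplecticGradient_beta {s : Interaction} {q : Hardy g} {κ : ℝ}
    (h : Function.Bijective (shiftL s q κ)) {m : Sobolev g} (hm : shiftL s q κ m = q) :
    HasSymplecticGradient s (beta s g κ) q (betaChain m hm).field := by
  refine (betaChain m hm).hasSymplecticGradient fun f _ => ?_
  have h := hasDerivAt_beta h hm f
  simp only [LaxChain.grad, betaChain, mul_neg, mul_one, Complex.ofReal_neg, neg_smul,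
    sub_neg_eq_add, Finset.sum_range_one]
  exact h

theorem exists_lift_iterate (s : Interaction) {q : Hardy g} {n : ℕ} (hq : q ∈ HardySobolev g n) :
    ∃ u : ℕ → Sobolev g, ∀ k < n, incl (u k) = (lax s q)^[k] q := by
  obtain ⟨u, hu⟩ := exists_iterate_lift s (sobolevCurve_const hq)
  exact ⟨fun k => u k 0, fun k hk => ((hu k hk).2 0).1⟩

/-! ### Reality of the inner products -/

theorem inner_iterate_shift {s : Interaction} {q : Hardy g} {n : ℕ} {u : ℕ → Sobolev g}
    (hu : ∀ k < n, incl (u k) = (lax s q)^[k] q) {a b : ℕ} (ha : a < n) (hb : b < n) :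
    ⟪(lax s q)^[a + 1] q, (lax s q)^[b] q⟫_ℂ = ⟪(lax s q)^[a] q, (lax s q)^[b + 1] q⟫_ℂ := by
  rw [Function.iterate_succ_apply', Function.iterate_succ_apply', ← hu a ha, ← hu b hb, lax_incl,
    lax_incl, inner_laxL]

theorem im_inner_eq_zero_of_eq {f h : Hardy g} (hfh : ⟪f, h⟫_ℂ = ⟪h, f⟫_ℂ) :
    (⟪f, h⟫_ℂ).im = 0 := by
  rw [← Complex.conj_eq_iff_im, Hardy.inner_conj_symm, hfh]

theorem im_inner_iterate {s : Interaction} {q : Hardy g} {n : ℕ} (hq : q ∈ HardySobolev g n)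
    {a b : ℕ} (ha : a ≤ n) (hb : b ≤ n) :
    (⟪(lax s q)^[a] q, (lax s q)^[b] q⟫_ℂ).im = 0 := by
  obtain ⟨u, hu⟩ := exists_lift_iterate s hq
  have key : ∀ k a, a + k ≤ n → ∀ j ≤ k, ⟪(lax s q)^[a] q, (lax s q)^[a + k] q⟫_ℂ =
      ⟪(lax s q)^[a + j] q, (lax s q)^[a + k - j] q⟫_ℂ := by
    intro k a hak j hj
    induction j with
    | zero => rfl
    | succ j ih =>
      rw [ih (by omega), show a + k - j = a + k - (j + 1) + 1 by omega,
        ← inner_iterate_shift hu (by omega) (by omega), add_assoc]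
  have key2 : ∀ k a, a + k ≤ n → ⟪(lax s q)^[a] q, (lax s q)^[a + k] q⟫_ℂ =
      ⟪(lax s q)^[a + k] q, (lax s q)^[a] q⟫_ℂ := fun k a hak => by
    rw [key k a hak k le_rfl, Nat.add_sub_cancel]
  refine im_inner_eq_zero_of_eq ?_
  rcases le_total a b with h | h
  · obtain ⟨k, rfl⟩ := Nat.exists_eq_add_of_le h
    exact key2 k a hb
  · obtain ⟨k, rfl⟩ := Nat.exists_eq_add_of_le h
    exact (key2 k b ha).symm

theorem laxL_of_shiftL {s : Interaction} {q f : Hardy g} {κ : ℝ} {m : Sobolev g}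
    (hm : shiftL s q κ m = f) : laxL s q m = f - (κ : ℂ) • incl m := by
  rw [eq_sub_iff_add_eq, ← shiftL_apply, hm]

theorem im_inner_resolvent_self {s : Interaction} {q : Hardy g} {κ : ℝ} {m : Sobolev g}
    (hm : shiftL s q κ m = q) : (⟪incl m, q⟫_ℂ).im = 0 := by
  have h1 := inner_laxL s q m m
  rw [laxL_of_shiftL hm, inner_sub_left, inner_sub_right, Hardy.inner_smul_left,
    Hardy.inner_smul_right, Complex.conj_ofReal] at h1
  exact im_inner_eq_zero_of_eq (by linear_combination h1)

theorem im_inner_resolvent_iterate {s : Interaction} {q : Hardy g} {κ : ℝ} {m : Sobolev g}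
    (hm : shiftL s q κ m = q) {n : ℕ} (hq : q ∈ HardySobolev g n) {b : ℕ} (hb : b ≤ n) :
    (⟪incl m, (lax s q)^[b] q⟫_ℂ).im = 0 := by
  obtain ⟨u, hu⟩ := exists_lift_iterate s hq
  induction b with
  | zero => exact im_inner_resolvent_self hm
  | succ b ih =>
    have h1 := inner_laxL s q m (u b)
    rw [← lax_incl s q (u b), hu b (by omega), ← Function.iterate_succ_apply' (lax s q),
      laxL_of_shiftL hm, inner_sub_left, Hardy.inner_smul_left, Complex.conj_ofReal] at h1
    have h2 : (⟪q, (lax s q)^[b] q⟫_ℂ).im = 0 := im_inner_iterate hq (Nat.zero_le n) (by omega)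
    rw [h1, Complex.sub_im, Complex.im_ofReal_mul, h2, ih (by omega)]
    ring

theorem im_inner_resolvent_resolvent {s : Interaction} {q : Hardy g} {κ κ' : ℝ} {m m' : Sobolev g}
    (h : Function.Bijective (shiftL s q κ)) (hm : shiftL s q κ m = q)
    (hm' : shiftL s q κ' m' = q) : (⟪incl m, incl m'⟫_ℂ).im = 0 := by
  rcases eq_or_ne κ κ' with rfl | hne
  · rw [h.1 (hm'.trans hm.symm)]
    exact im_inner_eq_zero_of_eq rfl
  -- the resolvent identity
  · have h1 := inner_laxL s q m m'
    rw [laxL_of_shiftL hm, laxL_of_shiftL hm', inner_sub_left, inner_sub_right,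
      Hardy.inner_smul_left, Hardy.inner_smul_right, Complex.conj_ofReal] at h1
    have h2 := congrArg Complex.im h1
    simp only [Complex.sub_im, Complex.im_ofReal_mul] at h2
    have h3 := im_inner_resolvent_self hm'
    rw [← Hardy.inner_conj_symm, Complex.conj_im, neg_eq_zero] at h3
    rw [im_inner_resolvent_self hm, h3] at h2
    have h4 : (κ - κ') * (⟪incl m, incl m'⟫_ℂ).im = 0 := by linarith
    exact (mul_eq_zero.1 h4).resolve_left (sub_ne_zero.2 hne)

/-! ### Poisson brackets -/

/-- The choice of a symplectic gradient does not matter in Poisson brackets. -/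
theorem omega_symplecticGradient {s : Interaction} {q X : Hardy g} {F : Observable g}
    (hF : Dense F.dom) (hX : HasSymplecticGradient s F q X) (f : Hardy g) :
    omega s q f (symplecticGradient s F q) = omega s q f X := by
  have h1 : HasSymplecticGradient s F q (symplecticGradient s F q) := by
    have h : ∃ X, HasSymplecticGradient s F q X := ⟨X, hX⟩
    rw [symplecticGradient, dif_pos h]
    exact h.choose_spec
  exact congrFun ((continuous_omega s q _).ext_on hF (continuous_omega s q X)
    fun f hf => (h1 f hf).unique (hX f hf)) f

/-- Observables of chains whose members have real inner products Poisson commute. -/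
theorem poissonBracket_eq_zero {s : Interaction} {q : Hardy g} {F G : Observable g}
    {C C' : LaxChain s q} (hF : Dense F.dom) (hG : Dense G.dom)
    (hC : HasSymplecticGradient s F q C.field) (hC' : HasSymplecticGradient s G q C'.field)
    (h : ∀ a ≤ C.length, ∀ b ≤ C'.length, (⟪C.vec a, C'.vec b⟫_ℂ).im = 0) :
    poissonBracket s F G q = 0 := by
  rw [poissonBracket, omega_symplecticGradient hF hC, omega_antisymm,
    omega_symplecticGradient hG hC', omega, C'.bigOmega_field, C.re_inner_field_grad C' h, neg_zero]

end CCM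

end

theorem proposition6p1 (g : Geometry) (s : Interaction) (q : Hardy g)
    (hq : q ∈ massBall g s.criticalMass) :
    -- `L_q + κ` is a bijection from its domain onto the Hardy space, `β(κ, ·)` is real at `q`, and
    -- it has a symplectic gradient there
    (∀ κ : ℝ, 1 ≤ κ →
      (∀ f : Hardy g, ∃! m : Hardy g, IsLax s q m (f - (κ : ℂ) • m)) ∧
      (⟪q, resolventVector s κ q⟫_ℂ).im = 0 ∧
      ∃ X : Hardy g, HasSymplecticGradient s (beta s g κ) q X) ∧
    -- for `q` in `Hⁿ₊`, the iterates of `L_q` on `q` are defined up to order `n`, `E_n` is real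
    -- at `q`, and it has a symplectic gradient there
    (∀ n : ℕ, q ∈ HardySobolev g n →
      (∀ k < n, IsLax s q ((lax s q)^[k] q) ((lax s q)^[k + 1] q)) ∧
      (⟪q, (lax s q)^[n] q⟫_ℂ).im = 0 ∧
      ∃ X : Hardy g, HasSymplecticGradient s (energy s g n) q X) ∧
    -- the Poisson brackets vanish
    (∀ κ κ' : ℝ, 1 ≤ κ → 1 ≤ κ' →
      poissonBracket s (beta s g κ') (beta s g κ) q = 0) ∧
    (∀ (κ' : ℝ) (n : ℕ), 1 ≤ κ' → q ∈ HardySobolev g n →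
      poissonBracket s (beta s g κ') (energy s g n) q = 0) ∧
    (∀ m n : ℕ, q ∈ HardySobolev g m → q ∈ HardySobolev g n →
      poissonBracket s (energy s g m) (energy s g n) q = 0) := by
  refine ⟨fun κ hκ => ?_, fun n hn => ?_, fun κ κ' hκ hκ' => ?_, fun κ n hκ hn => ?_,
    fun k n hk hn => ?_⟩
  · have hb := shiftL_bijective hq hκ
    obtain ⟨m, hm⟩ := hb.2 q
    refine ⟨existsUnique_isLax hb, ?_, _, hasSymplecticGradient_beta hb hm⟩
    rw [resolventVector_eq hb hm, ← Hardy.inner_conj_symm, Complex.conj_im,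
      im_inner_resolvent_self hm, neg_zero]
  · obtain ⟨u, hu⟩ := exists_lift_iterate s hn
    refine ⟨fun k hk => ?_, im_inner_iterate hn (Nat.zero_le n) le_rfl, _,
      hasSymplecticGradient_energy hn hu⟩
    rw [Function.iterate_succ_apply', ← hu k hk, lax_incl]
    exact isLax_incl s q (u k)
  · have hb := shiftL_bijective hq hκ
    have hb' := shiftL_bijective hq hκ'
    obtain ⟨m, hm⟩ := hb.2 q
    obtain ⟨m', hm'⟩ := hb'.2 q
    refine poissonBracket_eq_zero dense_univ dense_univ (hasSymplecticGradient_beta hb' hm')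
      (hasSymplecticGradient_beta hb hm) fun a _ b _ => ?_
    simp only [betaChain]
    split_ifs
    · exact im_inner_resolvent_resolvent hb' hm' hm
    · exact im_inner_resolvent_self hm'
    · rw [← Hardy.inner_conj_symm, Complex.conj_im, im_inner_resolvent_self hm, neg_zero]
    · exact im_inner_eq_zero_of_eq rfl
  · have hb := shiftL_bijective hq hκ
    obtain ⟨m, hm⟩ := hb.2 q
    obtain ⟨u, hu⟩ := exists_lift_iterate s hn
    refine poissonBracket_eq_zero dense_univ (dense_hardySobolev n)
      (hasSymplecticGradient_beta hb hm) (hasSymplecticGradient_energy hn hu) fun a _ b hb => ?_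
    simp only [betaChain, energyChain] at hb ⊢
    split_ifs
    · exact im_inner_resolvent_iterate hm hn hb
    · exact im_inner_iterate hn (Nat.zero_le n) hb
  · obtain ⟨u, hu⟩ := exists_lift_iterate s hk
    obtain ⟨v, hv⟩ := exists_lift_iterate s hn
    refine poissonBracket_eq_zero (dense_hardySobolev k) (dense_hardySobolev n)
      (hasSymplecticGradient_energy hk hu) (hasSymplecticGradient_energy hn hv)
      fun a ha b hb => ?_
    simp only [energyChain] at ha hb ⊢
    rcases le_total k n with h | h
    · exact im_inner_iterate hn (ha.trans h) hb
    · exact im_inner_iterate hk ha (hb.trans h)
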